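/- Let $\mathbb{N}=\{1,2,3,\dots\}$. For $n\in\mathbb{N}$ let $C_n\subseteq\mathbb{R}^2$ be the circle of radius $\frac1n$ centered at $(\frac1n,0)$, let $\mathbb{H}=\bigcup_{n\ge 1}C_n\subseteq\mathbb{R}^2$ be the Hawaiian Earring with base point $b_0=(0,0)$, and let $\ell_n:[0,1]\to C_n$, $\ell_n(t)=\frac1n(1-\cos 2\pi t,\ \sin 2\pi t)$. Let $D$ be the closed disk of radius $4$ about $(0,0)$, let $D_1$, $D_2$ be the closed disks of radius $1$ about $(-2,0)$ and $(2,0)$, and let $P=D\setminus(D_1^\circ\cup D_2^\circ)$ be the resulting pair of pants, with boundary $\partial P=\partial D\cup\partial D_1\cup\partial D_2$. Let $\alpha,\beta,\gamma$ be the parametrizations $t\mapsto c+r(-\cos 2\pi t,\ \sin 2\pi t)$, $t\in[0,1]$, of $\partial D$, $\partial D_1$, $\partial D_2$ respectively, where $c$ is the center and $r$ the radius of the circle in question (clockwise, starting at the leftmost point). For each $n\in\mathbb{N}$ let $P_n$ be a copy of $P$ and let $f_n:\partial P_n\to\mathbb{H}$ be the map with $$f_n\circ\alpha=\ell_n,\qquad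 f_n\circ\beta=\ell_{2n},\qquad f_n\circ\gamma=\ell_{2n+1}.$$ Let $\mathbb{P}=\mathbb{H}\cup_f\coprod_{n\ge1}P_n$ (the "Hawaiian Pants") be the adjunction space obtained from $\mathbb{H}$ by attaching all $P_n$ along the maps $f_n$, that is, the quotient of the topological disjoint union $\mathbb{H}\sqcup\coprod_{n\ge 1}P_n$ by the equivalence relation generated by $x\sim f_n(x)$ for $x\in\partial P_n$, $n\in\mathbb{N}$, with the quotient topology. Then the fundamental group $\pi_1(\mathbb{P},b_0)$ is locally free: every finitely generated subgroup of $\pi_1(\mathbb{P},b_0)$ is a free group. -/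

import Mathlib

namespace HawaiianPants

open Metric

/-- The relation `a ∼ f a` for `a ∈ A` on the disjoint union of `X` and `Y`, where `f : A → X` is
defined on a subset `A` of `Y`. -/
inductive GlueRel {X Y : Type} (A : Set Y) (f : A → X) : X ⊕ Y → X ⊕ Y → Prop
  | glue (a : A) : GlueRel A f (Sum.inr a.1) (Sum.inl (f a))

/-- The adjunction space `X ∪_f Y`: the quotient of the disjoint union of `X` and `Y` by the
equivalence relation generated by `a ∼ f a` for `a ∈ A`. -/
def AdjunctionSpace {X Y : Type} (A : Set Y) (f : A → X) : Type :=
  Quot (GlueRel A f)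

/-- The quotient topology. -/
instance {X Y : Type} [TopologicalSpace X] [TopologicalSpace Y] (A : Set Y) (f : A → X) :
    TopologicalSpace (AdjunctionSpace A f) :=
  inferInstanceAs (TopologicalSpace (Quot (GlueRel A f)))

/-- The circle `C_n` of radius `1/n` centered at `(1/n, 0)`; the plane is identified with `ℂ`. -/
def C (n : ℕ+) : Set ℂ := sphere (1 / (n : ℂ)) (1 / (n : ℝ))

/-- The Hawaiian Earring `ℍ = C₁ ∪ C₂ ∪ ⋯`. -/
def earring : Set ℂ := ⋃ n : ℕ+, C n

/-- The pair of pants: the closed disk `D` of radius `4` about `0` minus the interiors of the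
disks `D₁`, `D₂` of radius `1` about `-2` and `2`. -/
def pants : Set ℂ := closedBall 0 4 \ (ball (-2) 1 ∪ ball 2 1)

/-- The boundary of the pair of pants: `∂D ∪ ∂D₁ ∪ ∂D₂`. -/
def pantsBoundary : Set ℂ := sphere 0 4 ∪ (sphere (-2) 1 ∪ sphere 2 1)

/-- The clockwise loop once around the circle with center `c` and radius `r`, starting at its
leftmost point: `t ↦ c + r (-cos 2πt, sin 2πt)`. -/
noncomputable def clockwise (c : ℂ) (r : ℝ) (t : unitInterval) : ℂ :=
  c + r * (-(Real.cos (2 * Real.pi * t) : ℂ) + (Real.sin (2 * Real.pi * t) : ℂ) * Complex.I)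

/-- The loop `ℓ_n(t) = (1/n) (1 - cos 2πt, sin 2πt)` around `C_n`. -/
noncomputable def ell (n : ℕ+) (t : unitInterval) : ℂ :=
  1 / (n : ℂ) *
    ((1 - Real.cos (2 * Real.pi * t) : ℂ) + (Real.sin (2 * Real.pi * t) : ℂ) * Complex.I)

open Classical in
/-- The attaching map `∂P_n → ℍ` as a map into the plane: on `∂D`, `∂D₁`, `∂D₂` it is the
orientation preserving similarity onto `C_n`, `C_{2n}`, `C_{2n+1}` that takes leftmost point to
leftmost point (the base point `0`). -/
noncomputable def attachFun (n : ℕ+) (z : ℂ) : ℂ :=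
  if z ∈ sphere (0 : ℂ) 4 then 1 / (n : ℂ) * (1 + z / 4)
  else if z ∈ sphere (-2 : ℂ) 1 then 1 / ((2 * n : ℕ+) : ℂ) * (1 + (z + 2))
  else 1 / ((2 * n + 1 : ℕ+) : ℂ) * (1 + (z - 2))

theorem mem_C_of_norm_eq_one (n : ℕ+) {w : ℂ} (hw : ‖w‖ = 1) : 1 / (n : ℂ) * (1 + w) ∈ C n := by
  have : 1 / (n : ℂ) * (1 + w) - 1 / (n : ℂ) = 1 / (n : ℂ) * w := by ring
  simp [C, this, hw, -one_div]

theorem attachFun_mem {n : ℕ+} {z : ℂ} (hz : z ∈ pantsBoundary) : attachFun n z ∈ earring := by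
  unfold attachFun
  split_ifs with h1 h2
  · refine Set.mem_iUnion.2 ⟨n, mem_C_of_norm_eq_one n ?_⟩
    have : ‖z‖ = 4 := by simpa using h1
    simp [this]
  · refine Set.mem_iUnion.2 ⟨2 * n, mem_C_of_norm_eq_one (2 * n) ?_⟩
    simpa [dist_eq_norm] using h2
  · refine Set.mem_iUnion.2 ⟨2 * n + 1, mem_C_of_norm_eq_one (2 * n + 1) ?_⟩
    have h3 : z ∈ sphere (2 : ℂ) 1 := (hz.resolve_left h1).resolve_left h2
    simpa [dist_eq_norm] using h3

/-- The disjoint union `∐ₙ P_n` of countably many pairs of pants, `n = 1, 2, 3, …`. -/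
abbrev AllPants : Type := Σ _ : ℕ+, pants

/-- The disjoint union `∐ₙ ∂P_n`. -/
def allBoundary : Set AllPants := {p | (p.2 : ℂ) ∈ pantsBoundary}

/-- The map `f : ∐ₙ ∂P_n → ℍ`. -/
noncomputable def attach (p : allBoundary) : earring :=
  ⟨attachFun p.1.1 (p.1.2 : ℂ), attachFun_mem p.2⟩

theorem sphere_disjoint_aux {z : ℂ} (h : z ∈ sphere (0 : ℂ) 4) :
    z ∉ sphere (-2 : ℂ) 1 ∧ z ∉ sphere (2 : ℂ) 1 := by
  have h0 : ‖z‖ = 4 := by simpa using h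
  constructor <;> intro h'
  · have h1 : ‖z - (-2)‖ = 1 := by rwa [mem_sphere, dist_eq_norm] at h'
    have := norm_sub_norm_le z (-2)
    rw [h0, h1] at this; norm_num at this
  · have h1 : ‖z - 2‖ = 1 := by rwa [mem_sphere, dist_eq_norm] at h'
    have := norm_sub_norm_le z 2
    rw [h0, h1] at this; norm_num at this

theorem sphere_disjoint_aux' {z : ℂ} (h : z ∈ sphere (2 : ℂ) 1) : z ∉ sphere (-2 : ℂ) 1 := by
  intro h'
  have h0 : ‖z - 2‖ = 1 := by rwa [mem_sphere, dist_eq_norm] at h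
  have h1 : ‖z - (-2)‖ = 1 := by rwa [mem_sphere, dist_eq_norm] at h'
  have := norm_sub_le (z - (-2)) (z - 2)
  rw [h0, h1] at this; norm_num at this

theorem norm_unit_aux (s : ℝ) : ‖-(Real.cos s : ℂ) + (Real.sin s : ℂ) * Complex.I‖ = 1 := by
  rw [← Complex.ofReal_neg, Complex.norm_add_mul_I]; simp

theorem clockwise_mem (c : ℂ) {r : ℝ} (hr : 0 ≤ r) (t : unitInterval) :
    clockwise c r t ∈ sphere c r := by
  rw [mem_sphere, dist_eq_norm, clockwise, add_sub_cancel_left, norm_mul, norm_unit_aux]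
  simp [abs_of_nonneg hr]

/-- `f_n ∘ α_n = ℓ_n`, where `α_n` is the clockwise parametrization of `∂D`. -/
theorem attachFun_outer (n : ℕ+) (t : unitInterval) :
    attachFun n (clockwise 0 4 t) = ell n t := by
  rw [attachFun, if_pos (clockwise_mem 0 (by norm_num) t), clockwise, ell]
  push_cast; ring

/-- `f_n ∘ β_n = ℓ_{2n}`, where `β_n` is the clockwise parametrization of `∂D₁`. -/
theorem attachFun_left (n : ℕ+) (t : unitInterval) :
    attachFun n (clockwise (-2) 1 t) = ell (2 * n) t := by
  have h := clockwise_mem (-2) zero_le_one t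
  rw [attachFun, if_neg fun h' => (sphere_disjoint_aux h').1 h, if_pos h, clockwise, ell]
  push_cast; ring

/-- `f_n ∘ γ_n = ℓ_{2n+1}`, where `γ_n` is the clockwise parametrization of `∂D₂`. -/
theorem attachFun_right (n : ℕ+) (t : unitInterval) :
    attachFun n (clockwise 2 1 t) = ell (2 * n + 1) t := by
  have h := clockwise_mem 2 zero_le_one t
  rw [attachFun, if_neg fun h' => (sphere_disjoint_aux h').2 h, if_neg (sphere_disjoint_aux' h),
    clockwise, ell]
  push_cast; ring

/-- The Hawaiian Pants `ℙ = ℍ ∪_f ∐ₙ P_n`, with the quotient topology. -/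
abbrev Space : Type := AdjunctionSpace allBoundary attach

theorem zero_mem_earring : (0 : ℂ) ∈ earring :=
  Set.mem_iUnion.2 ⟨1, by simp [C]⟩

/-- The base point `b₀ = (0,0) ∈ ℍ ⊆ ℙ`. -/
def basePoint : Space := Quot.mk _ (Sum.inl ⟨0, zero_mem_earring⟩)

/-- A group is locally free if each of its finitely generated subgroups is a free group. -/
def IsLocallyFree (G : Type) [Group G] : Prop :=
  ∀ K : Subgroup G, K.FG → IsFreeGroup K

end HawaiianPants

namespace HawaiianPants

/-! ### Ranks of free groups, and limits of locally free groups -/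

section Algebra

/-! A loop or a homotopy in the space is compact, so it meets the interiors of only finitely many
pants (`exists_subset_stage`). The group is therefore the direct limit of the groups of the earring
with only `P_1, …, P_m` attached.

In such a finite stage the pants can be collapsed one after another. The outer boundary of `P_1` is
`C_1`, and no other pants are attached along `C_1`. So `P_1` deforms vertically onto its real axis
together with its inner circles, which are `C_2` and `C_3`. Now `P_2` has a free outer circle up to
isolated points that do not move, and so on. After `m` steps what is left lies in a one-dimensional
space `graph`: the earring and the real axes of the pants. Each collapse is injective on fundamental
groups (`isLocallyFree_stage_of_succ`).

For `graph` and its subspaces, continuous circle valued functions, one for each edge, give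
homomorphisms to the free groups on the first `N` edges, as the holonomy of a covering. The main
point is that they jointly have trivial kernel (`homotopic_refl_of_hol_eq_one`). Along a loop with
trivial holonomies, lift to the Cayley trees of these free groups, weight the edges summably, and
pass to an ultralimit of the tree metrics. The limit is a continuous `0`-hyperbolic pseudometric on
the closed-up interval, and points at distance zero have the same image. So the loop factors through
a real tree, and it contracts along the tree to the root.

The algebra needed is that local freeness survives both limits. A finitely generated subgroup is the
image of a free group `F` of finite rank, mapped to a sequence of groups in which the images are
free and the kernels are monotone. Ranks of these images are monotone and bounded, and a surjection
between free groups of equal finite rank is injective (`freeGroup_hopfian`), so the kernels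
stabilize. This yields `isLocallyFree_of_antitone` for separating sequences of quotients and
`isLocallyFree_of_directLimit` for direct limits. -/

instance freeGroup_residuallyFinite {α : Type*} : Group.ResiduallyFinite (FreeGroup α) := by
  classical
  refine Group.residuallyFinite_of_forall_exists_finite_monoidHom fun g hg => ?_
  -- Left multiplication by a letter is a partial bijection of the finite set of suffixes of the
  -- reduced word of `g`. Any extension to permutations gives an action in which `g` moves `1` to
  -- `g`.
  let T : Finset (FreeGroup α) := (g.toWord.tails.map FreeGroup.mk).toFinset
  have hT : ∀ v, v <:+ g.toWord → FreeGroup.mk v ∈ T := fun v hv => by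
    simp only [T, List.mem_toFinset, List.mem_map, List.mem_tails]
    exact ⟨v, hv, rfl⟩
  let e : ∀ a : α, {x : T // FreeGroup.of a * x.1 ∈ T} ≃ {x : T // (FreeGroup.of a)⁻¹ * x.1 ∈ T} :=
    fun a =>
    { toFun := fun x => ⟨⟨FreeGroup.of a * x.1.1, x.2⟩, by simp⟩
      invFun := fun x => ⟨⟨(FreeGroup.of a)⁻¹ * x.1.1, x.2⟩, by simp⟩
      left_inv := fun x => by simp
      right_inv := fun x => by simp }
  let π : FreeGroup α →* Equiv.Perm T := FreeGroup.lift fun a => (e a).extendSubtype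
  have hπ : ∀ a (x : T) (hx : FreeGroup.of a * x.1 ∈ T),
      π (FreeGroup.of a) x = ⟨FreeGroup.of a * x.1, hx⟩ := fun a x hx => by
    simp only [π, FreeGroup.lift_apply_of]
    rw [Equiv.extendSubtype_apply_of_mem (e a) x hx]
    rfl
  have key : ∀ v (hv : v <:+ g.toWord),
      π (FreeGroup.mk v) ⟨1, hT [] (List.nil_suffix)⟩ = ⟨FreeGroup.mk v, hT v hv⟩ := by
    intro v
    induction v with
    | nil => intro hv; simp [← FreeGroup.one_eq_mk]
    | cons p v ih =>
      intro hv
      have hv' : v <:+ g.toWord := (List.suffix_cons p v).trans hv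
      obtain ⟨a, b⟩ := p
      cases b
      · have h1 : FreeGroup.mk ((a, false) :: v) = (FreeGroup.of a)⁻¹ * FreeGroup.mk v := by
          simp [FreeGroup.of, FreeGroup.inv_mk, FreeGroup.invRev]
        have h2 := hT _ hv
        simp only [h1, map_mul, map_inv, Equiv.Perm.mul_apply, ih hv']
        rw [Equiv.Perm.inv_eq_iff_eq, hπ]
        · simp
        · simpa using hT v hv'
      · have h1 : FreeGroup.mk ((a, true) :: v) = FreeGroup.of a * FreeGroup.mk v := by
          simp [FreeGroup.of]
        have h2 := hT _ hv
        rw [h1] at h2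
        simp only [h1, map_mul, Equiv.Perm.mul_apply, ih hv']
        rw [hπ _ _ h2]
  have := key g.toWord List.suffix_rfl
  refine ⟨Equiv.Perm T, inferInstance, inferInstance, π, fun h' => ?_⟩
  have h2 := congrArg Subtype.val this
  have h3 : (π (FreeGroup.mk g.toWord) ⟨1, hT [] List.nil_suffix⟩ : FreeGroup α) =
      FreeGroup.mk g.toWord := h2
  rw [FreeGroup.mk_toWord, h'] at h3
  exact hg h3.symm

/-- Surjective endomorphisms of finitely generated free groups are injective. -/
theorem freeGroup_hopfian {ι : Type*} [Finite ι] (f : FreeGroup ι →* FreeGroup ι)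
    (hf : Function.Surjective f) : Function.Injective f := by
  rw [injective_iff_map_eq_one]
  intro g hg
  by_contra hne
  obtain ⟨H, hH⟩ := Group.exists_finiteIndexNormalSubgroup_notMem g hne
  -- Malcev's argument: `g` survives in a finite quotient, and there are only finitely many
  -- homomorphisms to that quotient. Composition with the surjection `f` permutes them, so the
  -- quotient map factors through `f` and kills `g` after all.
  have : Finite (FreeGroup ι →* FreeGroup ι ⧸ H.toSubgroup) :=
    Finite.of_equiv _ (FreeGroup.lift (α := ι) (β := FreeGroup ι ⧸ H.toSubgroup))
  have hinj : Function.Injective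
      fun φ : FreeGroup ι →* FreeGroup ι ⧸ H.toSubgroup => φ.comp f := fun φ φ' h =>
    (MonoidHom.cancel_right hf).1 h
  obtain ⟨φ, hφ⟩ := Finite.surjective_of_injective hinj (QuotientGroup.mk' H.toSubgroup)
  have h1 : QuotientGroup.mk' H.toSubgroup g = 1 := by
    rw [← hφ]; simp [hg]
  exact hH ((QuotientGroup.eq_one_iff g).1 h1)

/-- The number of homomorphisms to the group with two elements. -/
noncomputable def numChar (A : Type*) [Group A] : ℕ := Nat.card (A →* Multiplicative (ZMod 2))

theorem finite_char_of_surjective {A B : Type*} [Group A] [Group B] {f : A →* B}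
    (hf : Function.Surjective f) [Finite (A →* Multiplicative (ZMod 2))] :
    Finite (B →* Multiplicative (ZMod 2)) :=
  Finite.of_injective (fun φ => φ.comp f) fun _ _ h => (MonoidHom.cancel_right hf).1 h

theorem numChar_le_of_surjective {A B : Type*} [Group A] [Group B] {f : A →* B}
    (hf : Function.Surjective f) [Finite (A →* Multiplicative (ZMod 2))] :
    numChar B ≤ numChar A :=
  Nat.card_le_card_of_injective (fun φ : B →* Multiplicative (ZMod 2) => φ.comp f)
    fun _ _ h => (MonoidHom.cancel_right hf).1 h

instance finite_char_freeGroup {ι : Type*} [Finite ι] :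
    Finite (FreeGroup ι →* Multiplicative (ZMod 2)) :=
  Finite.of_equiv _ (FreeGroup.lift (α := ι) (β := Multiplicative (ZMod 2)))

/-- This makes `numChar` a substitute for the rank that is defined for all groups and visibly
monotone under surjections. -/
theorem numChar_freeGroup {ι : Type*} [Finite ι] : numChar (FreeGroup ι) = 2 ^ Nat.card ι := by
  rw [numChar, ← Nat.card_congr (FreeGroup.lift (α := ι) (β := Multiplicative (ZMod 2))),
    Nat.card_fun]
  congr 1
  simp

theorem finite_of_finite_char {ι : Type*} [Finite (FreeGroup ι →* Multiplicative (ZMod 2))] :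
    Finite ι := by
  classical
  have : Finite (ι → Multiplicative (ZMod 2)) :=
    Finite.of_equiv _ (FreeGroup.lift (α := ι) (β := Multiplicative (ZMod 2))).symm
  refine Finite.of_injective
    (fun i : ι => (Pi.mulSingle i (Multiplicative.ofAdd 1) : ι → Multiplicative (ZMod 2)))
    fun i j h => ?_
  by_contra hij
  have := congrFun h i
  simp [hij] at this

/-- A surjection between finitely generated free groups, the target having at least the rank of
the source, is injective. -/
theorem injective_of_surjective_of_numChar_le {A B : Type} [Group A] [Group B] [IsFreeGroup A]
    [IsFreeGroup B] {f : A →* B} (hf : Function.Surjective f)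
    [Finite (A →* Multiplicative (ZMod 2))] (h : numChar A ≤ numChar B) :
    Function.Injective f := by
  have hB := finite_char_of_surjective hf
  let a := IsFreeGroup.mulEquiv A
  let b := IsFreeGroup.mulEquiv B
  have h1 := finite_char_of_surjective a.symm.surjective (f := a.symm.toMonoidHom)
  have h2 := finite_char_of_surjective b.symm.surjective (f := b.symm.toMonoidHom)
  have := finite_of_finite_char (ι := IsFreeGroup.Generators A)
  have := finite_of_finite_char (ι := IsFreeGroup.Generators B)
  have ha : numChar A = 2 ^ Nat.card (IsFreeGroup.Generators A) :=
    numChar_freeGroup (ι := IsFreeGroup.Generators A) ▸ Nat.card_congr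
      (MulEquiv.monoidHomCongrLeftEquiv a.symm)
  have hb : numChar B = 2 ^ Nat.card (IsFreeGroup.Generators B) :=
    numChar_freeGroup (ι := IsFreeGroup.Generators B) ▸ Nat.card_congr
      (MulEquiv.monoidHomCongrLeftEquiv b.symm)
  have hcard : Nat.card (IsFreeGroup.Generators B) = Nat.card (IsFreeGroup.Generators A) := by
    have := le_antisymm (numChar_le_of_surjective hf) h
    rw [ha, hb] at this
    exact Nat.pow_right_injective le_rfl this
  -- Bases of equal size identify the target with the source, which turns `f` into a surjective
  -- endomorphism.
  let c : B ≃* A := b.symm.trans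
    ((FreeGroup.freeGroupCongr (Finite.card_eq.1 hcard).some).trans a)
  have hinj := freeGroup_hopfian
    ((a.symm.toMonoidHom.comp (c.toMonoidHom.comp f)).comp a.toMonoidHom)
    (a.symm.surjective.comp ((c.surjective.comp hf).comp a.surjective))
  intro x y hxy
  have := @hinj (a.symm x) (a.symm y) (by simp [hxy])
  exact a.symm.injective this

section Stabilization

variable {F : Type} [Group F] [Finite (F →* Multiplicative (ZMod 2))]

/-- Comparable kernels of homomorphisms with free images agree if the larger kernel does not
have a smaller rank. -/
theorem ker_eq_of_numChar_le {A B : Type} [Group A] [Group B] {α : F →* A} {β : F →* B}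
    [IsFreeGroup α.range] [IsFreeGroup β.range] (hk : α.ker ≤ β.ker)
    (h : numChar α.range ≤ numChar β.range) : α.ker = β.ker := by
  refine le_antisymm hk fun x hx => ?_
  have h1 : α.rangeRestrict.ker ≤ β.rangeRestrict.ker := by
    rwa [MonoidHom.ker_rangeRestrict, MonoidHom.ker_rangeRestrict]
  have hs := finite_char_of_surjective α.rangeRestrict_surjective
  let θ : α.range →* β.range :=
    MonoidHom.liftOfSurjective α.rangeRestrict α.rangeRestrict_surjective ⟨β.rangeRestrict, h1⟩
  have hθ : ∀ y, θ (α.rangeRestrict y) = β.rangeRestrict y := fun y =>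
    MonoidHom.liftOfRightInverse_comp_apply _ _ _ _ y
  have hsurj : Function.Surjective θ := fun b => by
    obtain ⟨y, rfl⟩ := β.rangeRestrict_surjective b
    exact ⟨_, hθ y⟩
  have hinj := injective_of_surjective_of_numChar_le hsurj h
  rw [← MonoidHom.ker_rangeRestrict, MonoidHom.mem_ker]
  apply hinj
  rw [hθ, map_one, ← MonoidHom.mem_ker, MonoidHom.ker_rangeRestrict]
  exact hx

variable {G : ℕ → Type} [∀ i, Group (G i)] (φ : ∀ i, F →* G i)
  [∀ i, IsFreeGroup (φ i).range]

/-- When kernels grow, each image is a quotient of the earlier ones, so ranks can only drop; past an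
index of minimal rank nothing more is killed. -/
theorem exists_ker_eq_of_monotone (h : Monotone fun i => (φ i).ker) :
    ∃ m, ∀ k, m ≤ k → (φ k).ker = (φ m).ker := by
  obtain ⟨m, hm⟩ : ∃ m, ∀ k, numChar (φ m).range ≤ numChar (φ k).range := by
    have := WellFounded.has_min (wellFounded_lt (α := ℕ))
      (Set.range fun i => numChar (φ i).range) (Set.range_nonempty _)
    obtain ⟨_, ⟨m, rfl⟩, hm⟩ := this
    exact ⟨m, fun k => not_lt.1 (hm _ ⟨k, rfl⟩)⟩
  exact ⟨m, fun k hk => (ker_eq_of_numChar_le (h hk) (hm k)).symm⟩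

/-- When kernels shrink, ranks can only rise, and they are bounded because every image is a quotient
of `F`; past an index of maximal rank the kernel is constant. -/
theorem exists_ker_eq_of_antitone (h : Antitone fun i => (φ i).ker) :
    ∃ m, ∀ k, m ≤ k → (φ k).ker = (φ m).ker := by
  have hb : BddAbove (Set.range fun i => numChar (φ i).range) := by
    refine ⟨numChar F, ?_⟩
    rintro _ ⟨i, rfl⟩
    exact numChar_le_of_surjective (φ i).rangeRestrict_surjective
  obtain ⟨m, hm⟩ := Nat.sSup_mem (Set.range_nonempty _) hb
  refine ⟨m, fun k hk => ker_eq_of_numChar_le (h hk) ?_⟩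
  have := le_csSup hb ⟨k, rfl⟩
  rw [← hm] at this
  exact this

end Stabilization

theorem isFreeGroup_range_of_ker_eq {F A B : Type} [Group F] [Group A] [Group B] {α : F →* A}
    {β : F →* B} (h : α.ker = β.ker) [IsFreeGroup β.range] : IsFreeGroup α.range :=
  IsFreeGroup.ofMulEquiv <| (QuotientGroup.quotientKerEquivRange β).symm.trans <|
    (QuotientGroup.quotientMulEquivOfEq h.symm).trans (QuotientGroup.quotientKerEquivRange α)

theorem IsLocallyFree.isFreeGroup_range {F A : Type} [Group F] [Group.FG F] [Group A]
    (h : IsLocallyFree A) (α : F →* A) : IsFreeGroup α.range :=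
  h _ ((Group.fg_iff_subgroup_fg _).1 inferInstance)

/-- Passing from subgroups to homomorphisms out of a fixed free group places all the kernels to be
compared in one group. -/
theorem isLocallyFree_iff {A : Type} [Group A] : IsLocallyFree A ↔
    ∀ (ι : Type) (_ : Finite ι) (φ : FreeGroup ι →* A), IsFreeGroup φ.range := by
  refine ⟨fun h ι _ φ => h.isFreeGroup_range φ, fun h K hK => ?_⟩
  have hK' : Group.FG K := (Group.fg_iff_subgroup_fg K).2 hK
  obtain ⟨ι, hι, φ, hφ⟩ := Group.fg_iff_exists_freeGroup_hom_surjective_finite.1 hK'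
  have h1 := h ι hι (K.subtype.comp φ)
  have h2 : (K.subtype.comp φ).range = K := by
    rw [MonoidHom.range_comp, MonoidHom.range_eq_top.2 hφ, ← MonoidHom.range_eq_map,
      Subgroup.range_subtype]
  rwa [h2] at h1

/-- A group with a descending sequence of normal subgroups with trivial intersection and locally
free quotients is locally free. -/
theorem isLocallyFree_of_antitone {A : Type} [Group A] {G : ℕ → Type} [∀ i, Group (G i)]
    (hG : ∀ i, IsLocallyFree (G i)) (ρ : ∀ i, A →* G i) (hρ : Antitone fun i => (ρ i).ker)
    (h : ∀ x, (∀ i, ρ i x = 1) → x = 1) : IsLocallyFree A := by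
  rw [isLocallyFree_iff]
  intro ι _ φ
  have := fun i => (hG i).isFreeGroup_range ((ρ i).comp φ)
  have hanti : Antitone fun i => ((ρ i).comp φ).ker := fun i j hij x hx =>
    hρ hij (show φ x ∈ (ρ j).ker from hx)
  obtain ⟨m, hm⟩ := exists_ker_eq_of_antitone (fun i => (ρ i).comp φ) hanti
  -- The stable kernel lies in all the kernels of the sequence, and their intersection is `φ.ker`.
  refine isFreeGroup_range_of_ker_eq (β := (ρ m).comp φ) (le_antisymm (fun x hx => ?_)
    fun x hx => h _ fun i => ?_)
  · have hx' : φ x = 1 := hx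
    simp [MonoidHom.mem_ker, hx']
  · rcases le_total i m with him | him
    · exact hanti him hx
    · rw [← hm i him] at hx
      exact hx

theorem IsLocallyFree.of_injective {A B : Type} [Group A] [Group B] (hB : IsLocallyFree B)
    (f : A →* B) (hf : Function.Injective f) : IsLocallyFree A :=
  isLocallyFree_of_antitone (G := fun _ => B) (fun _ => hB) (fun _ => f)
    (fun _ _ _ => le_rfl) fun x hx => hf (by simpa using hx 0)

theorem isLocallyFree_freeGroup (ι : Type) : IsLocallyFree (FreeGroup ι) := fun _ _ =>
  inferInstance

/-- A sequential direct limit of locally free groups is locally free. -/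
theorem isLocallyFree_of_directLimit {A : Type} [Group A] {G : ℕ → Type} [∀ i, Group (G i)]
    (hG : ∀ i, IsLocallyFree (G i)) (τ : ∀ i j, i ≤ j → G i →* G j) (ι : ∀ i, G i →* A)
    (hτ : ∀ i j k (hij : i ≤ j) (hjk : j ≤ k) x, τ j k hjk (τ i j hij x) = τ i k (hij.trans hjk) x)
    (hι : ∀ i j (hij : i ≤ j) x, ι j (τ i j hij x) = ι i x)
    (hsurj : ∀ a, ∃ i x, ι i x = a)
    (hker : ∀ i x, ι i x = 1 → ∃ j, ∃ hij : i ≤ j, τ i j hij x = 1) : IsLocallyFree A := by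
  rw [isLocallyFree_iff]
  intro S _ φ
  choose i₀ x₀ hx₀ using fun s => hsurj (φ (FreeGroup.of s))
  obtain ⟨m, hm⟩ := (Set.finite_range i₀).bddAbove
  have hm' : ∀ s, i₀ s ≤ m := fun s => hm ⟨s, rfl⟩
  -- The finitely many generators come from one common `G m`, so `φ` lifts there. An element of
  -- `φ.ker` then dies at some finite index and hence lies in the stable kernel.
  let φm : FreeGroup S →* G m := FreeGroup.lift fun s => τ _ _ (hm' s) (x₀ s)
  have hφm : (ι m).comp φm = φ := by
    ext s
    simp [φm, hι, hx₀]
  let Φ : ∀ k, FreeGroup S →* G (m + k) := fun k => (τ m (m + k) (Nat.le_add_right m k)).comp φm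
  have hΦ : ∀ k l (h : k ≤ l) x, Φ l x = τ _ _ (Nat.add_le_add_left h m) (Φ k x) := by
    intro k l h x
    simp [Φ, hτ]
  have hΦι : ∀ k x, ι (m + k) (Φ k x) = φ x := by
    intro k x
    simp only [Φ, MonoidHom.comp_apply, hι, ← hφm]
  have := fun k => (hG (m + k)).isFreeGroup_range (Φ k)
  have hmono : Monotone fun k => (Φ k).ker := fun k l h x hx => by
    rw [MonoidHom.mem_ker] at hx ⊢
    rw [hΦ k l h, hx, map_one]
  obtain ⟨k, hk⟩ := exists_ker_eq_of_monotone Φ hmono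
  refine isFreeGroup_range_of_ker_eq (β := Φ k) (le_antisymm (fun x hx => ?_) fun x hx => ?_)
  · rw [MonoidHom.mem_ker, ← hΦι 0] at hx
    obtain ⟨j, hj, h1⟩ := hker _ _ hx
    obtain ⟨l, rfl⟩ := Nat.exists_eq_add_of_le (show m ≤ j from hj)
    have h2 : x ∈ (Φ l).ker := by
      rw [MonoidHom.mem_ker, hΦ 0 l (Nat.zero_le l), h1]
    rcases le_total l k with h3 | h3
    · exact hmono h3 h2
    · rwa [← hk l h3]
  · rw [MonoidHom.mem_ker] at hx ⊢
    rw [← hΦι k, hx, map_one]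

end Algebra

/-! ### Weighted metrics on the Cayley tree of a free group -/

section LetterCount

variable {α : Type} [DecidableEq α]

/-- The number of occurrences of the letter `e`, with either sign, in a word. -/
def wordCount (e : α) (L : List (α × Bool)) : ℕ := L.countP fun p => p.1 = e

/-- The number of occurrences of the letter `e`, with either sign, in the reduced word of `g`. -/
def letterCount (e : α) (g : FreeGroup α) : ℕ := wordCount e g.toWord

theorem wordCount_append (e : α) (L L' : List (α × Bool)) :
    wordCount e (L ++ L') = wordCount e L + wordCount e L' := List.countP_append

theorem wordCount_invRev (e : α) (L : List (α × Bool)) :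
    wordCount e (FreeGroup.invRev L) = wordCount e L := by
  simp [wordCount, FreeGroup.invRev, List.countP_map, Function.comp_def]

theorem letterCount_one (e : α) : letterCount e 1 = 0 := by
  simp [letterCount, wordCount]

theorem letterCount_mul_le (e : α) (g h : FreeGroup α) :
    letterCount e (g * h) ≤ letterCount e g + letterCount e h := by
  rw [letterCount, letterCount, letterCount, ← wordCount_append]
  exact (FreeGroup.toWord_mul_sublist g h).countP_le

theorem letterCount_inv (e : α) (g : FreeGroup α) : letterCount e g⁻¹ = letterCount e g := by
  rw [letterCount, FreeGroup.toWord_inv, wordCount_invRev, letterCount]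

theorem letterCount_of_zpow (e a : α) (k : ℤ) :
    letterCount e (FreeGroup.of a ^ k) = if a = e then k.natAbs else 0 := by
  have h : ∀ n : ℕ, letterCount e (FreeGroup.of a ^ n) = if a = e then n else 0 := fun n => by
    rw [letterCount, FreeGroup.toWord_of_pow, wordCount, List.countP_replicate]
    simp
  obtain ⟨n, rfl | rfl⟩ := k.eq_nat_or_neg
  · simpa using h n
  · simpa [letterCount_inv] using h n

/-- The exponent sum of the letter `e`. -/
def expSum (e : α) : FreeGroup α →* Multiplicative ℤ :=
  FreeGroup.lift fun a => Multiplicative.ofAdd (if a = e then 1 else 0)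

theorem abs_expSum_le (e : α) (g : FreeGroup α) :
    |(expSum e g).toAdd| ≤ letterCount e g := by
  have key : ∀ L : List (α × Bool), |(expSum e (FreeGroup.mk L)).toAdd| ≤ wordCount e L := by
    intro L
    induction L with
    | nil => simp [← FreeGroup.one_eq_mk]
    | cons p L ih =>
      have h1 : FreeGroup.mk (p :: L) = FreeGroup.mk [p] * FreeGroup.mk L := by simp
      have h2 : |(expSum e (FreeGroup.mk [p])).toAdd| ≤ if p.1 = e then 1 else 0 := by
        obtain ⟨a, b⟩ := p
        cases b <;> by_cases h : a = e <;> simp [expSum, h]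
      rw [h1, map_mul, toAdd_mul]
      refine (abs_add_le _ _).trans ((add_le_add h2 ih).trans ?_)
      simp only [wordCount, List.countP_cons]
      by_cases h : p.1 = e <;> simp [h, add_comm]
  have := key g.toWord
  rwa [FreeGroup.mk_toWord] at this

/-- The prefix `p` leads to the point where the geodesics from `1` branch. The first letters after
it differ, so nothing cancels where the two remainders meet. -/
theorem exists_commonPrefix (L L' : List (α × Bool)) (hL : FreeGroup.IsReduced L)
    (hL' : FreeGroup.IsReduced L') : ∃ p u v, L = p ++ u ∧ L' = p ++ v ∧
      FreeGroup.IsReduced (FreeGroup.invRev u ++ v) ∧ ∀ q, q <+: L → q <+: L' → q <+: p := by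
  induction L generalizing L' with
  | nil => exact ⟨[], [], L', by simp, by simp, by simpa using hL', fun q h _ => h⟩
  | cons a L ih =>
    have hinv : FreeGroup.IsReduced (FreeGroup.invRev (a :: L)) := by
      rw [FreeGroup.isReduced_iff_reduce_eq, FreeGroup.reduce_invRev, hL.reduce_eq]
    cases L' with
    | nil => exact ⟨[], a :: L, [], by simp, by simp, by simpa using hinv, fun q _ h => h⟩
    | cons b L' =>
      by_cases hab : a = b
      · subst hab
        obtain ⟨p, u, v, rfl, rfl, h3, h4⟩ := ih L' (hL.infix (List.suffix_cons _ _).isInfix)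
          (hL'.infix (List.suffix_cons _ _).isInfix)
        refine ⟨a :: p, u, v, rfl, rfl, h3, fun q hq hq' => ?_⟩
        cases q with
        | nil => exact List.nil_prefix
        | cons c q =>
          rw [List.cons_prefix_cons] at hq hq' ⊢
          exact ⟨hq.1, h4 q hq.2 hq'.2⟩
      · refine ⟨[], a :: L, b :: L', rfl, rfl, ?_, fun q hq hq' => ?_⟩
        · rw [FreeGroup.IsReduced, List.isChain_append]
          refine ⟨hinv, hL', ?_⟩
          intro x hx y hy
          simp only [FreeGroup.invRev, List.map_cons, List.reverse_cons, List.getLast?_append,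
            List.getLast?_singleton, Option.some_or, Option.mem_def, Option.some.injEq,
            List.head?_cons] at hx hy
          subst hx hy
          obtain ⟨a1, a2⟩ := a
          obtain ⟨b1, b2⟩ := b
          intro h
          simp only at h ⊢
          subst h
          cases a2 <;> cases b2 <;> simp_all
        · cases q with
          | nil => exact List.nil_prefix
          | cons c q =>
            rw [List.cons_prefix_cons] at hq hq'
            exact absurd (hq.1.symm.trans hq'.1) hab

/-- The weighted length of a word. -/
def wordLength (S : Finset α) (w : α → ℝ) (L : List (α × Bool)) : ℝ :=
  ∑ e ∈ S, w e * wordCount e L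

/-- The weighted length of the reduced word of `g⁻¹ h`: the distance of two vertices of the
weighted Cayley tree of the free group. -/
def treeDist (S : Finset α) (w : α → ℝ) (g h : FreeGroup α) : ℝ :=
  ∑ e ∈ S, w e * letterCount e (g⁻¹ * h)

theorem wordLength_append (S : Finset α) (w : α → ℝ) (L L' : List (α × Bool)) :
    wordLength S w (L ++ L') = wordLength S w L + wordLength S w L' := by
  simp [wordLength, wordCount_append, mul_add, Finset.sum_add_distrib]

theorem wordLength_le_of_prefix {S : Finset α} {w : α → ℝ} (hw : ∀ e, 0 ≤ w e)
    {L L' : List (α × Bool)} (h : L <+: L') : wordLength S w L ≤ wordLength S w L' := by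
  obtain ⟨u, rfl⟩ := h
  rw [wordLength_append]
  have : 0 ≤ wordLength S w u := Finset.sum_nonneg fun e _ => mul_nonneg (hw e) (by positivity)
  linarith

/-- The length of the common prefix is the Gromov product of `g` and `h` at the vertex `1`. -/
theorem treeDist_eq (S : Finset α) (w : α → ℝ) (g h : FreeGroup α) : ∃ p,
    p <+: g.toWord ∧ p <+: h.toWord ∧ (∀ q, q <+: g.toWord → q <+: h.toWord → q <+: p) ∧
    treeDist S w g h =
      wordLength S w g.toWord + wordLength S w h.toWord - 2 * wordLength S w p := by
  obtain ⟨p, u, v, hu, hv, hred, hmax⟩ := exists_commonPrefix g.toWord h.toWord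
    FreeGroup.isReduced_toWord FreeGroup.isReduced_toWord
  refine ⟨p, ⟨u, hu.symm⟩, ⟨v, hv.symm⟩, hmax, ?_⟩
  have h1 : (g⁻¹ * h).toWord = FreeGroup.invRev u ++ v := by
    have hg : g = FreeGroup.mk p * FreeGroup.mk u := by
      rw [FreeGroup.mul_mk, ← hu, FreeGroup.mk_toWord]
    have hh : h = FreeGroup.mk p * FreeGroup.mk v := by
      rw [FreeGroup.mul_mk, ← hv, FreeGroup.mk_toWord]
    have : g⁻¹ * h = FreeGroup.mk (FreeGroup.invRev u ++ v) := by
      rw [hg, hh, ← FreeGroup.mul_mk, ← FreeGroup.inv_mk]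
      group
    rw [this, FreeGroup.toWord_mk, hred.reduce_eq]
  have h2 : treeDist S w g h = wordLength S w (FreeGroup.invRev u ++ v) := by
    simp only [treeDist, wordLength, letterCount, h1]
  have h3 : wordLength S w (FreeGroup.invRev u) = wordLength S w u := by
    simp only [wordLength, wordCount_invRev]
  rw [h2, wordLength_append, h3, hu, hv, wordLength_append, wordLength_append]
  ring

/-- Trees are `0`-hyperbolic. -/
theorem treeDist_four_point {S : Finset α} {w : α → ℝ} (hw : ∀ e, 0 ≤ w e)
    (x y z o : FreeGroup α) : treeDist S w x y + treeDist S w o z ≤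
      max (treeDist S w x z + treeDist S w o y) (treeDist S w z y + treeDist S w o x) := by
  have key : ∀ x y z : FreeGroup α, treeDist S w x y + wordLength S w z.toWord ≤
      max (treeDist S w x z + wordLength S w y.toWord)
        (treeDist S w z y + wordLength S w x.toWord) := by
    intro x y z
    obtain ⟨p, hp1, hp2, hp3, hp⟩ := treeDist_eq S w x y
    obtain ⟨q, hq1, hq2, hq3, hq⟩ := treeDist_eq S w x z
    obtain ⟨r, hr1, hr2, hr3, hr⟩ := treeDist_eq S w z y
    rw [hp, hq, hr, le_max_iff]
    -- Both `q` and `r` are prefixes of the word of `z`, so they are comparable, and the shorter one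
    -- is a common prefix of `x` and `y`. The base vertex `1` is moved to `o` afterwards by left
    -- translation.
    rcases List.prefix_or_prefix_of_prefix hq2 hr1 with h | h
    · left
      have := wordLength_le_of_prefix (S := S) hw (hp3 q hq1 (h.trans hr2))
      linarith
    · right
      have := wordLength_le_of_prefix (S := S) hw (hp3 r (h.trans hq1) hr2)
      linarith
  have h1 : ∀ x y : FreeGroup α, treeDist S w (o⁻¹ * x) (o⁻¹ * y) = treeDist S w x y := by
    intro x y
    simp only [treeDist]
    group
  have h2 : ∀ x : FreeGroup α, wordLength S w (o⁻¹ * x).toWord = treeDist S w o x :=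
    fun x => rfl
  have := key (o⁻¹ * x) (o⁻¹ * y) (o⁻¹ * z)
  simpa only [h1, h2] using this

theorem treeDist_self (S : Finset α) (w : α → ℝ) (g : FreeGroup α) : treeDist S w g g = 0 := by
  simp [treeDist, letterCount_one]

theorem treeDist_comm (S : Finset α) (w : α → ℝ) (g h : FreeGroup α) :
    treeDist S w g h = treeDist S w h g := by
  have : h⁻¹ * g = (g⁻¹ * h)⁻¹ := by group
  simp only [treeDist, this, letterCount_inv]

theorem treeDist_triangle {S : Finset α} {w : α → ℝ} (hw : ∀ e, 0 ≤ w e)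
    (x y z : FreeGroup α) : treeDist S w x z ≤ treeDist S w x y + treeDist S w y z := by
  rw [treeDist, treeDist, treeDist, ← Finset.sum_add_distrib]
  refine Finset.sum_le_sum fun e _ => ?_
  rw [← mul_add]
  refine mul_le_mul_of_nonneg_left ?_ (hw e)
  have := letterCount_mul_le e (x⁻¹ * y) (y⁻¹ * z)
  rw [show x⁻¹ * y * (y⁻¹ * z) = x⁻¹ * z by group] at this
  exact_mod_cast this

end LetterCount

/-! ### Loops that factor through real trees -/

open unitInterval Topology Filter

/-- A `0`-hyperbolic continuous pseudometric on the unit interval with identified endpoints: a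
parametrization of the contour of a real tree. -/
structure IsContour (D : I → I → ℝ) : Prop where
  self : ∀ s, D s s = 0
  comm : ∀ s t, D s t = D t s
  triangle : ∀ s t u, D s u ≤ D s t + D t u
  four_point : ∀ s t u, D s t + D 0 u ≤ max (D s u + D 0 t) (D u t + D 0 s)
  small : ∀ ε > 0, ∃ δ > 0, ∀ s t : I, |(s : ℝ) - t| ≤ δ → D s t ≤ ε
  closed : D 0 1 = 0

namespace IsContour

variable {D : I → I → ℝ} (hD : IsContour D)
include hD

theorem nonneg (s t : I) : 0 ≤ D s t := by
  have := hD.triangle s t s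
  rw [hD.self, hD.comm t s] at this
  linarith

theorem continuous_left (s : I) : Continuous (D s) := by
  rw [Metric.continuous_iff]
  intro t ε hε
  obtain ⟨δ, hδ, h⟩ := hD.small (ε / 2) (by linarith)
  refine ⟨δ, hδ, fun u hu => ?_⟩
  rw [Subtype.dist_eq, Real.dist_eq] at hu
  have h1 := h u t hu.le
  have h2 := hD.triangle s t u
  have h3 := hD.triangle s u t
  rw [hD.comm t u] at h2
  rw [Real.dist_eq, abs_lt]
  constructor <;> linarith

/-- The Gromov product of the endpoints of an arc is bounded below by the minimal height. -/
theorem dist_le_of_height_ge {a : ℝ} {s t : I} (hst : s ≤ t)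
    (ha : ∀ u, s ≤ u → u ≤ t → a ≤ D 0 u) : D s t ≤ D 0 s + D 0 t - 2 * a := by
  refine le_of_forall_pos_le_add fun ε hε => ?_
  obtain ⟨δ, hδ, h⟩ := hD.small ε hε
  -- Walk along the arc in steps of length at most `δ`. The four point condition is an ultrametric
  -- inequality for Gromov products, so the errors enter through a minimum: `ε` does not grow with
  -- the number of steps.
  have key : ∀ n : ℕ, ∀ u, s ≤ u → u ≤ t → (u : ℝ) - s ≤ n * δ →
      D s u ≤ D 0 s + D 0 u - 2 * a + ε := by
    intro n
    induction n with
    | zero =>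
      intro u h1 h2 h3
      obtain rfl : s = u := le_antisymm h1 (by
        simpa using h3)
      have := ha s le_rfl hst
      rw [hD.self]
      linarith
    | succ n ih =>
      intro u h1 h2 h3
      have hsu : (s : ℝ) ≤ u := h1
      let v : I := ⟨max s (u - δ), le_max_of_le_left s.2.1, max_le s.2.2 (by linarith [u.2.2])⟩
      have hsv : s ≤ v := Subtype.coe_le_coe.1 (le_max_left (s : ℝ) _)
      have hvu : v ≤ u := Subtype.coe_le_coe.1 (max_le hsu (by linarith))
      have hd : |(v : ℝ) - u| ≤ δ := by
        have h4 : (u : ℝ) - δ ≤ v := le_max_right _ _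
        have h5 : (v : ℝ) ≤ u := hvu
        rw [abs_le]
        constructor <;> linarith
      have hv := ih v hsv (hvu.trans h2) (by
        rcases max_choice (s : ℝ) (u - δ) with h4 | h4
        · have : (v : ℝ) = s := h4
          rw [this, sub_self]
          positivity
        · have : (v : ℝ) = u - δ := h4
          rw [this]
          push_cast at h3
          linarith)
      have h4 := hD.four_point s u v
      have h5 := h v u hd
      have h6 := ha v hsv (hvu.trans h2)
      have h7 := ha u h1 h2
      rcases le_max_iff.1 h4 with h8 | h8 <;> linarith
  obtain ⟨n, hn⟩ := exists_nat_ge (((t : ℝ) - s) / δ)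
  exact key n t hst le_rfl ((div_le_iff₀ hδ).1 hn)

/-- The ancestor of `t` at height `a`. -/
theorem exists_ancestor (t : I) {a : ℝ} (ha : 0 ≤ a) (hat : a ≤ D 0 t) :
    ∃ r, D 0 r = a ∧ D r t ≤ D 0 t - a := by
  have hcont := hD.continuous_left 0
  -- The ancestor is the last parameter before `t` of height at most `a`. By the intermediate value
  -- theorem the height stays at least `a` from there to `t`.
  have hcomp : IsCompact {r : I | r ≤ t ∧ D 0 r ≤ a} :=
    ((isClosed_le continuous_id continuous_const).inter
      (isClosed_le hcont continuous_const)).isCompact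
  obtain ⟨r, ⟨hrt, hra⟩, hmax⟩ := hcomp.exists_isGreatest
    ⟨0, t.2.1, by rw [hD.self]; exact ha⟩
  have hge : ∀ u, r ≤ u → u ≤ t → a ≤ D 0 u := by
    intro u hru hut
    by_contra! hlt
    have : a ∈ Set.Icc (D 0 u) (D 0 t) := ⟨hlt.le, hat⟩
    obtain ⟨v, hv, hva⟩ := intermediate_value_Icc hut hcont.continuousOn this
    have h1 := hmax ⟨hv.2, hva.le⟩
    obtain rfl : v = u := le_antisymm (h1.trans hru) hv.1
    linarith
  have heq : D 0 r = a := le_antisymm hra (hge r le_rfl hrt)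
  refine ⟨r, heq, ?_⟩
  have := hD.dist_le_of_height_ge hrt hge
  linarith

/-- In a tree either one of the ancestors lies on the common trunk, where only heights matter, or
both lie beyond the branch point, on the geodesic from `t` to `t'`. The bound controls the ancestor
jointly in its height and in `t`. -/
theorem dist_ancestor_le {t t' r r' : I} (hr : D r t ≤ D 0 t - D 0 r)
    (hr' : D r' t' ≤ D 0 t' - D 0 r') : D r r' ≤ max |D 0 r - D 0 r'| (D t t') := by
  have h1 := hD.four_point r t' t
  have h2 := hD.four_point r r' t'
  rw [hD.comm t' r'] at h2
  have h4 := hD.nonneg r t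
  have h5 := hD.nonneg r' t'
  have h6 := le_abs_self (D 0 r - D 0 r')
  have h7 := neg_abs_le (D 0 r - D 0 r')
  rw [le_max_iff]
  rcases le_max_iff.1 h1 with h1 | h1 <;> rcases le_max_iff.1 h2 with h2 | h2
  · left; linarith
  · left; linarith
  · by_cases h8 : D r r' ≤ |D 0 r - D 0 r'|
    · exact Or.inl h8
    · right; linarith
  · left; linarith

/-- As the interval is compact, `D r` has a positive minimum on the complement of an open preimage;
so `f` is continuous also for the pseudometric. -/
theorem eventually_mem {X : Type*} [TopologicalSpace X] {f : I → X} (hf : Continuous f)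
    (hDf : ∀ s t, D s t = 0 → f s = f t) (r : I) {V : Set X} (hV : V ∈ 𝓝 (f r)) :
    ∃ δ > 0, ∀ s, D r s < δ → f s ∈ V := by
  obtain ⟨U, hUV, hU, hrU⟩ := mem_nhds_iff.1 hV
  have hcomp : IsCompact (f ⁻¹' U)ᶜ := (hU.preimage hf).isClosed_compl.isCompact
  rcases (f ⁻¹' U)ᶜ.eq_empty_or_nonempty with h | h
  · refine ⟨1, one_pos, fun s _ => hUV ?_⟩
    have : s ∈ f ⁻¹' U := by rw [Set.compl_empty_iff.1 h]; trivial
    exact this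
  · obtain ⟨m, hm, hmin⟩ := hcomp.exists_isMinOn h (hD.continuous_left r).continuousOn
    refine ⟨D r m, lt_of_le_of_ne (hD.nonneg r m) fun h0 => hm ?_, fun s hs => ?_⟩
    · change f m ∈ U
      rwa [← hDf r m h0.symm]
    · by_contra hsV
      exact absurd (hmin (show s ∈ (f ⁻¹' U)ᶜ from fun h' => hsV (hUV h'))) (not_le.2 hs)

/-- A loop that factors through a real tree is null-homotopic. -/
theorem homotopic_refl {X : Type*} [TopologicalSpace X] {x : X} (f : Path x x)
    (hDf : ∀ s t, D s t = 0 → f s = f t) : f.Homotopic (Path.refl x) := by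
  obtain ⟨m, -, hm⟩ := isCompact_univ.exists_isMaxOn ⟨0, Set.mem_univ (0 : I)⟩
    (hD.continuous_left 0).continuousOn
  have hmax : ∀ t, D 0 t ≤ D 0 m := fun t => hm (Set.mem_univ t)
  have hmin : ∀ k t : I, 0 ≤ min ((k : ℝ) * D 0 m) (D 0 t) := fun k t =>
    le_min (mul_nonneg k.2.1 (hD.nonneg _ _)) (hD.nonneg _ _)
  -- The homotopy truncates heights at `k` times the maximal height, which slides every point down
  -- to the root as `k` falls to `0`. The chosen parameter `r k t` need not be continuous, but its
  -- class modulo `D`, and so its image under `f`, is.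
  choose r hr1 hr2 using fun k t : I => hD.exists_ancestor t (hmin k t) (min_le_right _ _)
  have hr2' : ∀ k t, D (r k t) t ≤ D 0 t - D 0 (r k t) := fun k t => by
    rw [hr1]; exact hr2 k t
  have hcont : Continuous fun p : I × I => f (r p.1 p.2) := by
    rw [continuous_iff_continuousAt]
    rintro ⟨k, t⟩ V hV
    obtain ⟨δ, hδ, hV'⟩ := hD.eventually_mem f.continuous hDf (r k t) hV
    have h1 : Continuous fun p : I × I => min ((p.1 : ℝ) * D 0 m) (D 0 p.2) :=
      ((continuous_subtype_val.comp continuous_fst).mul continuous_const).min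
        ((hD.continuous_left 0).comp continuous_snd)
    have h2 : Continuous fun p : I × I => max |D 0 (r k t) - min ((p.1 : ℝ) * D 0 m) (D 0 p.2)|
        (D t p.2) :=
      (continuous_const.sub h1).abs.max ((hD.continuous_left t).comp continuous_snd)
    have h3 : max |D 0 (r k t) - min ((k : ℝ) * D 0 m) (D 0 t)| (D t t) < δ := by
      rw [hr1, hD.self]
      simpa using hδ
    have h4 : ∀ᶠ p in 𝓝 (k, t), max |D 0 (r k t) - min ((p.1 : ℝ) * D 0 m) (D 0 p.2)|
        (D t p.2) < δ := h2.continuousAt.eventually_lt_const h3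
    rw [Filter.mem_map]
    filter_upwards [h4] with p hp
    refine hV' _ (lt_of_le_of_lt ?_ hp)
    rw [← hr1 p.1 p.2]
    exact hD.dist_ancestor_le (hr2' k t) (hr2' p.1 p.2)
  have hzero : ∀ t, D 0 t = 0 → ∀ k, f (r k t) = x := fun t ht k => by
    have h1 := hr1 k t
    rw [ht, min_eq_right (mul_nonneg k.2.1 (hD.nonneg _ _))] at h1
    rw [← hDf _ _ h1, f.source]
  refine ⟨ContinuousMap.HomotopyRel.symm
    { toFun := fun p => f (r p.1 p.2)
      continuous_toFun := hcont
      map_zero_left := fun t => ?_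
      map_one_left := fun t => ?_
      prop' := fun k t ht => ?_ }⟩
  · have h1 := hr1 0 t
    rw [Set.Icc.coe_zero, zero_mul, min_eq_left (hD.nonneg _ _)] at h1
    change f (r 0 t) = x
    rw [← hDf _ _ h1, f.source]
  · have h1 := hr1 1 t
    rw [Set.Icc.coe_one, one_mul, min_eq_right (hmax t)] at h1
    have h2 := hr2' 1 t
    rw [h1, sub_self] at h2
    exact hDf _ _ (le_antisymm h2 (hD.nonneg _ _))
  · rcases ht with rfl | rfl
    · exact hzero 0 (hD.self 0) k
    · exact hzero 1 hD.closed k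

end IsContour

/-! ### Holonomy of multivalued functions -/

/-- Multivalued functions `Φ i : X → G`, defined on the members of an open cover, that differ by
locally constant factors. -/
structure Gauge (κ X G : Type) [TopologicalSpace X] [Group G] where
  U : κ → Set X
  isOpen : ∀ i, IsOpen (U i)
  index : X → κ
  mem_index : ∀ x, x ∈ U (index x)
  Φ : κ → X → G
  locConst : ∀ i j x, x ∈ U i → x ∈ U j →
    ∀ᶠ y in 𝓝 x, Φ i y * (Φ j y)⁻¹ = Φ i x * (Φ j x)⁻¹

namespace Gauge

variable {κ X G A B : Type} [TopologicalSpace X] [Group G] [TopologicalSpace A]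
  [TopologicalSpace B] (Γ : Gauge κ X G)

/-- A development of `f` is a single valued continuation of the multivalued function along `f`. -/
def IsDev (f : A → X) (g : A → G) : Prop :=
  ∀ a i, f a ∈ Γ.U i → ∀ᶠ b in 𝓝 a, g b * (Γ.Φ i (f b))⁻¹ = g a * (Γ.Φ i (f a))⁻¹

variable {Γ}

theorem IsDev.comp {f : A → X} {g : A → G} (h : Γ.IsDev f g) {k : B → A} (hk : Continuous k) :
    Γ.IsDev (f ∘ k) (g ∘ k) := fun b i hi => (hk.tendsto b).eventually (h (k b) i hi)

theorem isDev_const (x : X) (g : G) : Γ.IsDev (fun _ : A => x) (fun _ => g) := fun _ _ _ =>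
  Eventually.of_forall fun _ => rfl

/-- Two developments differ by a left factor that is locally constant, and it drops out of the
increments. -/
theorem IsDev.unique [PreconnectedSpace A] {f : A → X} {g g' : A → G} (h : Γ.IsDev f g)
    (h' : Γ.IsDev f g') (a b : A) : (g a)⁻¹ * g b = (g' a)⁻¹ * g' b := by
  have hloc : IsLocallyConstant fun a => g a * (g' a)⁻¹ := by
    rw [IsLocallyConstant.iff_eventually_eq]
    intro a
    filter_upwards [h a _ (Γ.mem_index _), h' a _ (Γ.mem_index _)] with b hb hb'
    have e1 := congrArg₂ (fun x y => x * y⁻¹) hb hb'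
    simpa using e1
  have h1 := hloc.apply_eq_of_preconnectedSpace a b
  have h2 : g b = g a * (g' a)⁻¹ * g' b := by rw [h1]; group
  rw [h2]; group

theorem IsDev.eq_of_subset {f : A → X} {g : A → G} (h : Γ.IsDev f g) {s : Set A}
    (hs : IsPreconnected s) {i : κ} (hi : ∀ a ∈ s, f a ∈ Γ.U i) {a b : A} (ha : a ∈ s)
    (hb : b ∈ s) : (g a)⁻¹ * g b = (Γ.Φ i (f a))⁻¹ * Γ.Φ i (f b) := by
  have := isPreconnected_iff_preconnectedSpace.1 hs
  have hloc : IsLocallyConstant fun a : s => g a * (Γ.Φ i (f a))⁻¹ := by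
    rw [IsLocallyConstant.iff_eventually_eq]
    intro a
    exact continuous_subtype_val.continuousAt.eventually (h a i (hi a a.2))
  have h1 := hloc.apply_eq_of_preconnectedSpace ⟨a, ha⟩ ⟨b, hb⟩
  simp only at h1
  have h2 : g b = g a * (Γ.Φ i (f a))⁻¹ * Γ.Φ i (f b) := by rw [h1]; group
  rw [h2]; group

variable (Γ)

/-- The covering space of single valued germs. -/
def bundleCore [TopologicalSpace G] [DiscreteTopology G] : FiberBundleCore κ X G where
  baseSet := Γ.U
  isOpen_baseSet := Γ.isOpen
  indexAt := Γ.index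
  mem_baseSet_at := Γ.mem_index
  coordChange i j x v := v * (Γ.Φ i x * (Γ.Φ j x)⁻¹)
  coordChange_self i x _ v := by simp
  continuousOn_coordChange i j := by
    rintro ⟨x, v⟩ ⟨⟨hi, hj⟩, -⟩
    refine ContinuousAt.continuousWithinAt ?_
    refine ContinuousAt.congr (f := fun p : X × G => p.2 * (Γ.Φ i x * (Γ.Φ j x)⁻¹)) ?_ ?_
    · exact (continuous_of_discreteTopology (f := fun v : G => v * (Γ.Φ i x * (Γ.Φ j x)⁻¹))).comp
        continuous_snd |>.continuousAt
    · filter_upwards [continuous_fst.continuousAt.eventually (Γ.locConst i j x hi hj)] with p hp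
      rw [hp]
  coordChange_comp i j k x _ v := by group

/-- Lift `f` to the covering with discrete fibre `G`: local constancy of the fibre coordinate in
each chart is the defining property of a development. Intervals give the holonomy, squares its
homotopy invariance. -/
theorem exists_isDev [SimplyConnectedSpace A] [LocallyPathConnectedSpace A] (f : C(A, X)) :
    ∃ g : A → G, Γ.IsDev f g := by
  let _ : TopologicalSpace G := ⊥
  have : DiscreteTopology G := ⟨rfl⟩
  let Z := Γ.bundleCore
  have cov : IsCoveringMap Z.proj := FiberBundle.isCoveringMap
  obtain ⟨a₀⟩ : Nonempty A := PathConnectedSpace.nonempty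
  obtain ⟨F, ⟨-, hF⟩, -⟩ := cov.existsUnique_continuousMap_lifts f a₀ ⟨f a₀, (1 : G)⟩ rfl
  have hF' : ∀ a, (F a).1 = f a := fun a => congrFun hF a
  let v : A → G := fun a => (F a).2
  refine ⟨fun a => v a * Γ.Φ (Γ.index (f a)) (f a), fun a i hi => ?_⟩
  have hmem : F a ∈ (Z.localTriv i).source := by
    rw [Z.mem_localTriv_source, hF']
    exact hi
  have hcont : ContinuousAt (fun b => (Z.localTriv i (F b)).2) a :=
    continuous_snd.continuousAt.comp
      (((Z.localTriv i).continuousAt hmem).comp F.continuous.continuousAt)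
  have hval : ∀ b, (Z.localTriv i (F b)).2 =
      v b * Γ.Φ (Γ.index (f b)) (f b) * (Γ.Φ i (f b))⁻¹ := by
    intro b
    change v b * (Γ.Φ (Γ.index (F b).1) (F b).1 * (Γ.Φ i (F b).1)⁻¹) = _
    rw [hF', mul_assoc]
  have hopen : {(Z.localTriv i (F a)).2} ∈ 𝓝 (Z.localTriv i (F a)).2 :=
    (isOpen_discrete _).mem_nhds rfl
  filter_upwards [hcont hopen] with b hb
  rw [← hval, ← hval]
  exact hb

instance : ContractibleSpace I := (convex_Icc (0 : ℝ) 1).contractibleSpace ⟨0, by simp⟩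

instance : LocallyPathConnectedSpace I :=
  (isQuotientMap_projIcc (h := zero_le_one' ℝ)).locallyPathConnectedSpace

variable {x y z : X}

/-- The holonomy along a path. -/
noncomputable def hol (γ : Path x y) : G :=
  ((Γ.exists_isDev γ.toContinuousMap).choose 0)⁻¹ *
    (Γ.exists_isDev γ.toContinuousMap).choose 1

theorem hol_eq {γ : Path x y} {g : I → G} (h : Γ.IsDev γ g) : Γ.hol γ = (g 0)⁻¹ * g 1 :=
  (Γ.exists_isDev γ.toContinuousMap).choose_spec.unique h 0 1

/-- A development of the concatenated path restricts to developments of both halves. -/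
theorem hol_trans (γ : Path x y) (γ' : Path y z) :
    Γ.hol (γ.trans γ') = Γ.hol γ * Γ.hol γ' := by
  obtain ⟨g, hg⟩ := Γ.exists_isDev (γ.trans γ').toContinuousMap
  have hg' : Γ.IsDev (γ.trans γ') g := hg
  let k : I → I := fun t => ⟨t / 2, by linarith [t.2.1], by linarith [t.2.2]⟩
  let k' : I → I := fun t => ⟨(1 + t) / 2, by linarith [t.2.1], by linarith [t.2.2]⟩
  have hk : Continuous k := by fun_prop
  have hk' : Continuous k' := by fun_prop
  have e1 : γ.trans γ' ∘ k = γ := by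
    ext t
    have : (t : ℝ) / 2 ≤ 1 / 2 := by linarith [t.2.2]
    simp only [Function.comp, Path.trans_apply, k, this, dif_pos]
    congr 1
    ext
    simp
    ring
  have e2 : γ.trans γ' ∘ k' = γ' := by
    ext t
    simp only [Function.comp, Path.trans_apply, k']
    split_ifs with h
    · have h0 : (t : ℝ) = 0 := le_antisymm (by linarith) t.2.1
      have h1 : t = 0 := Subtype.ext h0
      have h2 : ∀ (p : 2 * ((1 + (t : ℝ)) / 2) ∈ I), γ ⟨2 * ((1 + (t : ℝ)) / 2), p⟩ = y := by
        intro p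
        refine Eq.trans (congrArg γ ?_) γ.target
        ext
        simp [h0]
      rw [h2, h1, γ'.source]
    · congr 1
      ext
      simp
      ring
  have h1 := Γ.hol_eq (γ := γ) (e1 ▸ hg'.comp hk)
  have h2 := Γ.hol_eq (γ := γ') (e2 ▸ hg'.comp hk')
  rw [Γ.hol_eq hg', h1, h2]
  have e3 : k 0 = 0 := by ext; simp [k]
  have e4 : k' 1 = 1 := by ext; simp [k']
  have e5 : k' 0 = k 1 := by ext; simp [k, k']
  simp only [Function.comp, e3, e4, e5]
  group

/-- Develop the whole homotopy over the square: the development is constant along the two sides on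
which the endpoints are fixed. -/
theorem hol_eq_of_homotopic {γ γ' : Path x y} (h : γ.Homotopic γ') : Γ.hol γ = Γ.hol γ' := by
  obtain ⟨H⟩ := h
  obtain ⟨g, hg⟩ := Γ.exists_isDev H.toContinuousMap
  have hc : ∀ (k : I → I × I), Continuous k → Γ.IsDev (fun t => H (k t)) (g ∘ k) :=
    fun k hk => hg.comp hk
  have h0 := hc (fun t => (0, t)) (by fun_prop)
  have h1 := hc (fun t => (1, t)) (by fun_prop)
  have hl := hc (fun t => (t, 0)) (by fun_prop)
  have hr := hc (fun t => (t, 1)) (by fun_prop)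
  simp only [Path.Homotopy.source, Path.Homotopy.target] at hl hr
  have el := hl.unique (isDev_const x 1) 0 1
  have er := hr.unique (isDev_const y 1) 0 1
  simp only [H.apply_zero, H.apply_one] at h0 h1
  rw [Γ.hol_eq h0, Γ.hol_eq h1]
  simp only [Function.comp, inv_one, mul_one, inv_mul_eq_one] at el er ⊢
  rw [el, er]

/-- The holonomy homomorphism of the fundamental group. -/
noncomputable def holHom (x : X) : FundamentalGroup X x →* G :=
  MonoidHom.mk'
    -- The product `p * q` of loop classes is represented by `q.trans p`, so holonomy reverses
    -- products and the inverse restores the order.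
    (fun p => (Quotient.lift (s := Path.Homotopic.setoid x x) (fun γ => Γ.hol γ)
      (fun _ _ h => Γ.hol_eq_of_homotopic h) p)⁻¹)
    (by
      intro p q
      induction p using Path.Homotopic.Quotient.ind with | mk p =>
      induction q using Path.Homotopic.Quotient.ind with | mk q =>
      change (Γ.hol (q.trans p))⁻¹ = (Γ.hol p)⁻¹ * (Γ.hol q)⁻¹
      rw [hol_trans, mul_inv_rev])

theorem holHom_mk (x : X) (γ : Path x x) :
    Γ.holHom x (Path.Homotopic.Quotient.mk γ : Path.Homotopic.Quotient x x) = (Γ.hol γ)⁻¹ := rfl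

end Gauge

/-! ### Charts of the circle and real lifts -/

section CircleCharts

/-- The representative in `[-1/2, 1/2)`. -/
noncomputable def rep (x : UnitAddCircle) : ℝ := AddCircle.equivIco (1 : ℝ) (-1 / 2) x

/-- The representative in `[0, 1)`. -/
noncomputable def posRep (x : UnitAddCircle) : ℝ := AddCircle.equivIco (1 : ℝ) 0 x

/-- The point opposite to `0`. -/
noncomputable def antipode : UnitAddCircle := ((-1 / 2 : ℝ) : UnitAddCircle)

theorem coe_rep (x : UnitAddCircle) : (rep x : UnitAddCircle) = x := AddCircle.coe_equivIco ..

theorem coe_posRep (x : UnitAddCircle) : (posRep x : UnitAddCircle) = x :=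
  AddCircle.coe_equivIco ..

theorem rep_coe {r : ℝ} (hr : |r| < 1 / 2) : rep (r : UnitAddCircle) = r := by
  rw [abs_lt] at hr
  exact AddCircle.equivIco_coe_of_mem (p := (1 : ℝ)) (a := -1 / 2)
    ⟨by linarith [hr.1], by linarith [hr.2]⟩

theorem rep_zero : rep 0 = 0 := by
  have := rep_coe (r := 0) (by norm_num)
  simpa using this

theorem zero_ne_antipode : (0 : UnitAddCircle) ≠ antipode := by
  intro h
  have h1 : rep antipode = -1 / 2 :=
    AddCircle.equivIco_coe_of_mem (p := (1 : ℝ)) (a := -1 / 2) ⟨le_rfl, by norm_num⟩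
  rw [← h, rep_zero] at h1
  norm_num at h1

theorem continuousAt_rep {x : UnitAddCircle} (hx : x ≠ antipode) : ContinuousAt rep x :=
  continuousAt_subtype_val.comp (AddCircle.continuousAt_equivIco (1 : ℝ) (-1 / 2) hx)

theorem continuousAt_posRep {x : UnitAddCircle} (hx : x ≠ 0) : ContinuousAt posRep x :=
  continuousAt_subtype_val.comp
    (AddCircle.continuousAt_equivIco (1 : ℝ) 0 (by simpa using hx))

/-- The integer difference of the two representatives. -/
noncomputable def sheet (x : UnitAddCircle) : ℤ := round (posRep x - rep x)

theorem sheet_eq (x : UnitAddCircle) : (sheet x : ℝ) = posRep x - rep x := by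
  have h : ((posRep x - rep x : ℝ) : UnitAddCircle) = 0 := by
    rw [AddCircle.coe_sub, coe_rep, coe_posRep, sub_self]
  obtain ⟨n, hn⟩ := AddCircle.coe_eq_zero_iff (1 : ℝ) |>.1 h
  rw [zsmul_one] at hn
  rw [sheet, ← hn, round_intCast]

theorem eventually_sheet_eq {x : UnitAddCircle} (h0 : x ≠ 0) (h1 : x ≠ antipode) :
    ∀ᶠ y in 𝓝 x, sheet y = sheet x := by
  have hc : ContinuousAt (fun y => posRep y - rep y) x :=
    (continuousAt_posRep h0).sub (continuousAt_rep h1)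
  filter_upwards [hc.eventually (Metric.ball_mem_nhds _ one_pos)] with y hy
  rw [Real.dist_eq, ← sheet_eq, ← sheet_eq, ← Int.cast_sub, ← Int.cast_abs] at hy
  have : |sheet y - sheet x| < 1 := by exact_mod_cast hy
  rw [Int.abs_lt_one_iff] at this
  linarith

theorem exists_real_lift (p : C(I, UnitAddCircle)) :
    ∃ Θ : C(I, ℝ), ∀ t, (Θ t : UnitAddCircle) = p t := by
  obtain ⟨Θ, hΘ, -⟩ := (AddCircle.isCoveringMap_coe (1 : ℝ)).exists_path_lifts p (rep (p 0))
    (coe_rep _).symm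
  exact ⟨Θ, fun t => congrFun hΘ t⟩

theorem real_lift_unique {Θ Θ' : I → ℝ} (h : Continuous Θ) (h' : Continuous Θ')
    (heq : ∀ t, (Θ t : UnitAddCircle) = Θ' t) (s t : I) : Θ t - Θ s = Θ' t - Θ' s := by
  have hs : ((Θ s - Θ' s : ℝ) : UnitAddCircle) = 0 := by
    rw [AddCircle.coe_sub, heq, sub_self]
  have := (AddCircle.isCoveringMap_coe (1 : ℝ)).eq_of_comp_eq h
    (h'.add (continuous_const (y := Θ s - Θ' s)))
    (by
      ext u
      change (Θ u : UnitAddCircle) = ((Θ' u + (Θ s - Θ' s) : ℝ) : UnitAddCircle)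
      rw [AddCircle.coe_add, hs, heq, add_zero]) s (by simp)
  have h2 : Θ t = Θ' t + (Θ s - Θ' s) := congrFun this t
  linarith

end CircleCharts

/-! ### Graph like spaces and their holonomy in free groups -/

/-- Continuous circle valued functions, at most one of which is nonzero at any point: collapsing
the common zeros turns `Y` into a subspace of an infinite product of circles that is a shrinking
wedge. The points of `Y` are separated by functions in the divisible hull of the given ones. -/
structure IsGraphLike (Y : Type) [TopologicalSpace Y] (c : ℕ → C(Y, UnitAddCircle)) : Prop where
  disj : ∀ y i j, c i y ≠ 0 → c j y ≠ 0 → i = j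
  sep : ∀ y y', y ≠ y' → ∃ (ψ : C(Y, UnitAddCircle)) (q : ℕ) (S : Finset ℕ) (n : ℕ → ℤ),
    q ≠ 0 ∧ (∀ u, q • ψ u = ∑ e ∈ S, n e • c e u) ∧ ψ y ≠ ψ y'

namespace IsGraphLike

variable {Y : Type} [TopologicalSpace Y] {c : ℕ → C(Y, UnitAddCircle)} (hY : IsGraphLike Y c)

open Classical in
/-- The multivalued function to the free group on the first `N` edges. -/
noncomputable def gauge (N : ℕ) : Gauge (Option ℕ) Y (FreeGroup ℕ) where
  -- Besides the open edges there is one chart around the vertices, cut off at the midpoints. Since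
  -- `sheet` is `0` on the first half of the circle and `1` on the second, a development changes
  -- only at midpoints, by the letter of the edge crossed.
  U i := i.elim {y | ∀ e ∈ Finset.range N, c e y ≠ antipode} fun e => {y | e < N ∧ c e y ≠ 0}
  isOpen i := by
    cases i with
    | none =>
      simp only [Option.elim, Set.ofPred_forall]
      exact isOpen_biInter_finset fun e _ => isOpen_ne.preimage (c e).continuous
    | some e => exact isOpen_const.and (isOpen_ne.preimage (c e).continuous)
  index y := if h : ∃ e < N, c e y = antipode then some h.choose else none
  mem_index y := by
    split_ifs with h
    · exact ⟨h.choose_spec.1, fun h0 => zero_ne_antipode (h0.symm.trans h.choose_spec.2)⟩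
    · intro e he hce
      exact h ⟨e, Finset.mem_range.1 he, hce⟩
  Φ i y := i.elim 1 fun e => FreeGroup.of e ^ sheet (c e y)
  locConst i j x hi hj := by
    cases i with
    | none =>
      cases j with
      | none => simp
      | some e =>
        have h1 := (c e).continuous.continuousAt.eventually
          (eventually_sheet_eq hj.2 (hi e (Finset.mem_range.2 hj.1)))
        filter_upwards [h1] with y hy
        simp [hy]
    | some e =>
      cases j with
      | none =>
        have h1 := (c e).continuous.continuousAt.eventually
          (eventually_sheet_eq hi.2 (hj e (Finset.mem_range.2 hi.1)))
        filter_upwards [h1] with y hy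
        simp [hy]
      | some e' =>
        obtain rfl := hY.disj x e e' hi.2 hj.2
        simp

/-- `e ↦ e ^ M`. -/
def powHom (M : ℕ) : FreeGroup ℕ →* FreeGroup ℕ := FreeGroup.lift fun e => FreeGroup.of e ^ M

open Classical in
/-- The position of a point on its edge, measured in steps of length `1 / M`. -/
noncomputable def position (c : ℕ → C(Y, UnitAddCircle)) (N M : ℕ) (y : Y) : FreeGroup ℕ :=
  -- Disjointness leaves no freedom in the choice, and the value `1` fits with the value of the
  -- formula where the edge functions vanish.
  if h : ∃ e < N, c e y ≠ 0 then FreeGroup.of h.choose ^ ⌊M * rep (c h.choose y)⌋ else 1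

include hY

theorem position_eq {N M e : ℕ} {y : Y} (he : e < N) (hy : c e y ≠ 0) :
    position c N M y = FreeGroup.of e ^ ⌊M * rep (c e y)⌋ := by
  have h : ∃ e < N, c e y ≠ 0 := ⟨e, he, hy⟩
  rw [position, dif_pos h, hY.disj y _ _ h.choose_spec.2 hy]

theorem position_cases {N M e : ℕ} (he : e < N) (y : Y) :
    (position c N M y = FreeGroup.of e ^ ⌊M * rep (c e y)⌋) ∨
      (c e y = 0 ∧ ∃ e' ≠ e, ∃ k : ℤ, position c N M y = FreeGroup.of e' ^ k) := by
  by_cases h : c e y = 0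
  · right
    refine ⟨h, ?_⟩
    by_cases h' : ∃ e' < N, c e' y ≠ 0
    · obtain ⟨e', he', hy⟩ := h'
      exact ⟨e', fun h0 => hy (h0 ▸ h), _, hY.position_eq he' hy⟩
    · exact ⟨e + 1, by simp, 0, by rw [position, dif_neg h', zpow_zero]⟩
  · exact Or.inl (hY.position_eq he h)

theorem letterCount_position {N M e : ℕ} (he : e < N) (y : Y) :
    letterCount e (position c N M y) = (⌊M * rep (c e y)⌋).natAbs := by
  rcases hY.position_cases (M := M) he y with h | ⟨h, e', hne, k, hk⟩
  · rw [h, letterCount_of_zpow, if_pos rfl]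
  · rw [hk, letterCount_of_zpow, if_neg hne, h, rep_zero]
    simp

theorem expSum_position {N M e : ℕ} (he : e < N) (y : Y) :
    (expSum e (position c N M y)).toAdd = ⌊M * rep (c e y)⌋ := by
  rcases hY.position_cases (M := M) he y with h | ⟨h, e', hne, k, hk⟩
  · simp [h, expSum]
  · simp [hk, h, rep_zero, expSum, hne]

omit hY in
theorem expSum_powHom (M e : ℕ) (x : FreeGroup ℕ) :
    (expSum e (powHom M x)).toAdd = M * (expSum e x).toAdd := by
  have : (expSum e).comp (powHom M) = (zpowGroupHom (M : ℤ)).comp (expSum e) := by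
    ext a
    simp [powHom, expSum]
  have h := DFunLike.congr_fun this x
  simp only [MonoidHom.comp_apply] at h
  rw [h]
  simp

end IsGraphLike

/-! ### Lifts of paths to the subdivided Cayley trees -/

namespace IsGraphLike

variable {Y : Type} [TopologicalSpace Y] {c : ℕ → C(Y, UnitAddCircle)} (hY : IsGraphLike Y c)

/-- The position in the free group of the lift of a path. -/
noncomputable def liftPos (c : ℕ → C(Y, UnitAddCircle)) (N M : ℕ) (f : I → Y)
    (g : I → FreeGroup ℕ) (t : I) : FreeGroup ℕ :=
  -- Replacing each letter by its `M`-th power subdivides the edges of the Cayley tree into `M`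
  -- steps. The second factor moves from the vertex given by `g t` by at most about half an edge.
  powHom M (g t) * position c N M (f t)

section Dev

variable {f : C(I, Y)} {N : ℕ} {g : I → FreeGroup ℕ} (hg : (hY.gauge N).IsDev f g) {e : ℕ}
  (he : e < N) {Θ : C(I, ℝ)} (hΘ : ∀ t, (Θ t : UnitAddCircle) = c e (f t))

include hg he

/-- The jump of `rep` at the midpoint of the edge is compensated by the letter that the development
gains there. Near a zero of `c e` both summands behave, since the chart used there is not that of
`e`; elsewhere the sum is `posRep` up to a constant. -/
theorem continuous_expSum_add_rep :
    Continuous fun t => (((expSum e (g t)).toAdd : ℤ) : ℝ) + rep (c e (f t)) := by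
  rw [continuous_iff_continuousAt]
  intro t
  have hct : ContinuousAt (fun u => c e (f u)) t := by fun_prop
  by_cases h : c e (f t) = 0
  · set i := (hY.gauge N).index (f t) with hi
    have hmem := (hY.gauge N).mem_index (f t)
    rw [← hi] at hmem
    have hone : ∀ y, expSum e ((hY.gauge N).Φ i y) = 1 := by
      intro y
      cases hj : i with
      | none => simp [gauge]
      | some e' =>
        have hne : e' ≠ e := by
          rintro rfl
          rw [hj] at hmem
          exact hmem.2 h
        simp [gauge, expSum, hne]
    have h1 : ∀ᶠ u in 𝓝 t, (((expSum e (g t)).toAdd : ℤ) : ℝ) + rep (c e (f u)) =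
        (((expSum e (g u)).toAdd : ℤ) : ℝ) + rep (c e (f u)) := by
      filter_upwards [hg t i hmem] with u hu
      have := congrArg (expSum e) hu
      simp only [map_mul, map_inv, hone, inv_one, mul_one] at this
      rw [this]
    refine ContinuousAt.congr ?_ h1
    refine continuousAt_const.add (ContinuousAt.comp (g := rep) ?_ hct)
    exact continuousAt_rep (by rw [h]; exact zero_ne_antipode)
  · have h1 : ∀ᶠ u in 𝓝 t, (((expSum e (g t)).toAdd - sheet (c e (f t)) : ℤ) : ℝ) +
        posRep (c e (f u)) = (((expSum e (g u)).toAdd : ℤ) : ℝ) + rep (c e (f u)) := by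
      filter_upwards [hg t (some e) ⟨he, h⟩] with u hu
      have := congrArg (fun x => (expSum e x).toAdd) hu
      simp only [gauge, Option.elim, map_mul, map_inv, map_zpow, expSum, FreeGroup.lift_apply_of,
        if_true, toAdd_mul, toAdd_inv, toAdd_zpow, toAdd_ofAdd, smul_eq_mul, mul_one] at this
      have h2 : ((expSum e (g t)).toAdd - sheet (c e (f t)) : ℤ) =
        (expSum e (g u)).toAdd - sheet (c e (f u)) := by
        simp only [expSum]; linarith
      rw [h2]
      push_cast
      rw [sheet_eq]
      ring
    refine ContinuousAt.congr ?_ h1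
    exact continuousAt_const.add (ContinuousAt.comp (g := posRep) (continuousAt_posRep h) hct)

include hΘ

theorem expSum_add_rep_sub (s t : I) :
    Θ t - Θ s = ((((expSum e (g t)).toAdd : ℤ) : ℝ) + rep (c e (f t))) -
      ((((expSum e (g s)).toAdd : ℤ) : ℝ) + rep (c e (f s))) := by
  refine real_lift_unique Θ.continuous (hY.continuous_expSum_add_rep hg he) (fun u => ?_) s t
  rw [hΘ, AddCircle.coe_add, coe_rep]
  have : ((((expSum e (g u)).toAdd : ℤ) : ℝ) : UnitAddCircle) = 0 := by
    rw [AddCircle.coe_eq_zero_iff]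
    exact ⟨(expSum e (g u)).toAdd, by simp⟩
  rw [this, zero_add]

/-- The exponent sums of the lift approximate the real lifts of the circle valued functions. -/
theorem abs_expSum_liftPos_sub_le (M : ℕ) (s t : I) :
    |((((expSum e ((liftPos c N M f g s)⁻¹ * liftPos c N M f g t)).toAdd : ℤ) : ℝ)) -
      M * (Θ t - Θ s)| ≤ 1 := by
  rw [hY.expSum_add_rep_sub hg he hΘ s t]
  simp only [liftPos, map_mul, map_inv, toAdd_mul, toAdd_inv, expSum_powHom,
    hY.expSum_position he]
  push_cast
  have h1 := Int.floor_le ((M : ℝ) * rep (c e (f t)))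
  have h2 := Int.lt_floor_add_one ((M : ℝ) * rep (c e (f t)))
  have h3 := Int.floor_le ((M : ℝ) * rep (c e (f s)))
  have h4 := Int.lt_floor_add_one ((M : ℝ) * rep (c e (f s)))
  rw [abs_le]
  constructor <;> linarith

/-- The exponent sum is a lower bound for the letter count; in the limit, distance zero in the tree
will force equality of the real lifts. -/
theorem mul_abs_sub_le (M : ℕ) (s t : I) : M * |Θ t - Θ s| ≤
    letterCount e ((liftPos c N M f g s)⁻¹ * liftPos c N M f g t) + 1 := by
  have h1 := hY.abs_expSum_liftPos_sub_le hg he hΘ M s t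
  have h2 : |((((expSum e ((liftPos c N M f g s)⁻¹ * liftPos c N M f g t)).toAdd : ℤ) : ℝ))| ≤
      letterCount e ((liftPos c N M f g s)⁻¹ * liftPos c N M f g t) := by
    rw [← Int.cast_abs]
    exact_mod_cast abs_expSum_le e ((liftPos c N M f g s)⁻¹ * liftPos c N M f g t)
  have h3 : (M : ℝ) * |Θ t - Θ s| = |M * (Θ t - Θ s)| := by
    rw [abs_mul, Nat.abs_cast]
  rw [h3]
  have h4 := abs_sub_abs_le_abs_sub ((M : ℝ) * (Θ t - Θ s))
    ((((expSum e ((liftPos c N M f g s)⁻¹ * liftPos c N M f g t)).toAdd : ℤ) : ℝ))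
  rw [abs_sub_comm] at h1
  linarith

omit hY he hΘ hg in
theorem letterCount_powHom_eq_zero (M : ℕ) {x : FreeGroup ℕ}
    (hx : x ∈ Subgroup.closure (FreeGroup.of '' {a | a ≠ e})) : letterCount e (powHom M x) = 0 := by
  induction hx using Subgroup.closure_induction with
  | mem x hx =>
    obtain ⟨a, ha, rfl⟩ := hx
    have := letterCount_of_zpow e a M
    rw [if_neg ha] at this
    simpa [powHom] using this
  | one => simp [letterCount_one]
  | mul x y _ _ hx hy =>
    have := letterCount_mul_le e (powHom M x) (powHom M y)
    rw [map_mul]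
    omega
  | inv x _ hx => rw [map_inv, letterCount_inv, hx]

omit he hΘ in
-- The letter `e` is gained only at the midpoint of its edge; away from it some chart other than
-- that of `e` is available, so the coset of the development is locally constant.
theorem inv_mul_mem_closure {s t : I} (hst : s ≤ t)
    (hne : ∀ u ∈ Set.Icc s t, c e (f u) ≠ antipode) :
    (g s)⁻¹ * g t ∈ Subgroup.closure (FreeGroup.of '' {a | a ≠ e}) := by
  have := isPreconnected_iff_preconnectedSpace.1 (isPreconnected_Icc (a := s) (b := t))
  have hloc : IsLocallyConstant fun u : Set.Icc s t =>
      (g u : FreeGroup ℕ ⧸ Subgroup.closure (FreeGroup.of '' {a | a ≠ e})) := by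
    rw [IsLocallyConstant.iff_eventually_eq]
    intro u
    obtain ⟨i, hi, hie⟩ : ∃ i, f u ∈ (hY.gauge N).U i ∧ i ≠ some e := by
      have hmem := (hY.gauge N).mem_index (f u)
      by_cases h : (hY.gauge N).index (f u) = some e
      · refine ⟨none, fun e' _ => ?_, by simp⟩
        rw [h] at hmem
        by_cases he' : e' = e
        · rw [he']
          exact hne u u.2
        · have : c e' (f u) = 0 := by
            by_contra h0
            exact he' (hY.disj _ _ _ h0 hmem.2)
          rw [this]
          exact zero_ne_antipode
      · exact ⟨_, hmem, h⟩
    have hΦ : ∀ y, (hY.gauge N).Φ i y ∈ Subgroup.closure (FreeGroup.of '' {a | a ≠ e}) := by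
      intro y
      cases i with
      | none => exact one_mem _
      | some e' =>
        have h' : FreeGroup.of e' ∈ FreeGroup.of '' {a | a ≠ e} :=
          ⟨e', fun h => hie (by rw [h]), rfl⟩
        exact Subgroup.zpow_mem _ (Subgroup.subset_closure h') _
    filter_upwards [continuous_subtype_val.continuousAt.eventually (hg u i hi)] with v hv
    rw [QuotientGroup.eq]
    have : (g v)⁻¹ * g u = ((hY.gauge N).Φ i (f v))⁻¹ * (hY.gauge N).Φ i (f u) := by
      have h2 : g v = g u * ((hY.gauge N).Φ i (f u))⁻¹ * (hY.gauge N).Φ i (f v) := by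
        rw [← hv]; group
      rw [h2]; group
    rw [this]
    exact mul_mem (inv_mem (hΦ _)) (hΦ _)
  have := hloc.apply_eq_of_preconnectedSpace
    (⟨s, le_rfl, hst⟩ : Set.Icc s t) ⟨t, hst, le_rfl⟩
  rwa [QuotientGroup.eq] at this

/-- The lift moves along `e` no more than the path itself does. -/
theorem letterCount_liftPos_le (M : ℕ) {s t : I} (hst : s ≤ t) {ε : ℝ} (hε : ε < 1 / 2)
    (hosc : ∀ u ∈ Set.Icc s t, ∀ v ∈ Set.Icc s t, |Θ u - Θ v| ≤ ε) :
    (letterCount e ((liftPos c N M f g s)⁻¹ * liftPos c N M f g t) : ℝ) ≤ 2 * M * ε + 2 := by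
  have hs : s ∈ Set.Icc s t := ⟨le_rfl, hst⟩
  have ht : t ∈ Set.Icc s t := ⟨hst, le_rfl⟩
  have hε0 : 0 ≤ ε := (abs_nonneg _).trans (hosc s hs s hs)
  have hM : (0 : ℝ) ≤ M := Nat.cast_nonneg M
  -- If the path meets a zero of `c e`, then as `ε < 1 / 2` it never reaches the midpoint of `e`,
  -- and the letter comes only from the positions of the two endpoints. Otherwise the path stays
  -- inside the edge, the displacement is a power of `e`, and its letter count is the absolute
  -- exponent sum.
  by_cases hzero : ∃ u₀ ∈ Set.Icc s t, c e (f u₀) = 0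
  · obtain ⟨u₀, hu₀, h0⟩ := hzero
    have hrep : ∀ u ∈ Set.Icc s t, rep (c e (f u)) = Θ u - Θ u₀ := by
      intro u hu
      rw [← rep_coe ((hosc u hu u₀ hu₀).trans_lt hε), AddCircle.coe_sub, hΘ, hΘ, h0, sub_zero]
    have hne : ∀ u ∈ Set.Icc s t, c e (f u) ≠ antipode := by
      intro u hu h
      have h1 := hrep u hu
      have h2 : rep antipode = -1 / 2 :=
        AddCircle.equivIco_coe_of_mem (p := (1 : ℝ)) (a := -1 / 2) ⟨le_rfl, by norm_num⟩
      have h3 := hosc u hu u₀ hu₀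
      rw [← h1, h, h2] at h3
      norm_num at h3
      linarith
    have hmid := letterCount_powHom_eq_zero (e := e) M (hY.inv_mul_mem_closure hg hst hne)
    have hpos : ∀ u ∈ Set.Icc s t, (letterCount e (position c N M (f u)) : ℝ) ≤ M * ε + 1 := by
      intro u hu
      rw [hY.letterCount_position he, hrep u hu, Nat.cast_natAbs, Int.cast_abs]
      have h1 := Int.floor_le ((M : ℝ) * (Θ u - Θ u₀))
      have h2 := Int.lt_floor_add_one ((M : ℝ) * (Θ u - Θ u₀))
      have h3 := abs_le.1 (hosc u hu u₀ hu₀)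
      have h4 := mul_le_mul_of_nonneg_left h3.1 hM
      have h5 := mul_le_mul_of_nonneg_left h3.2 hM
      rw [abs_le]
      constructor <;> linarith
    have heq : (liftPos c N M f g s)⁻¹ * liftPos c N M f g t =
        (position c N M (f s))⁻¹ * powHom M ((g s)⁻¹ * g t) * position c N M (f t) := by
      simp only [liftPos, map_mul, map_inv]
      group
    have h1 := letterCount_mul_le e ((position c N M (f s))⁻¹ * powHom M ((g s)⁻¹ * g t))
      (position c N M (f t))
    have h2 := letterCount_mul_le e (position c N M (f s))⁻¹ (powHom M ((g s)⁻¹ * g t))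
    rw [letterCount_inv, hmid] at h2
    have h3 : (letterCount e ((liftPos c N M f g s)⁻¹ * liftPos c N M f g t) : ℝ) ≤
        letterCount e (position c N M (f s)) + letterCount e (position c N M (f t)) := by
      rw [heq]
      exact_mod_cast h1.trans (by omega)
    linarith [hpos s hs, hpos t ht]
  · push Not at hzero
    have hdev := hg.eq_of_subset isPreconnected_Icc
      (i := some e) (fun u hu => ⟨he, hzero u hu⟩) hs ht
    obtain ⟨k, hk⟩ : ∃ k : ℤ, (liftPos c N M f g s)⁻¹ * liftPos c N M f g t =
        FreeGroup.of e ^ k := by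
      refine ⟨-⌊M * rep (c e (f s))⌋ + (M * -sheet (c e (f s)) + (M * sheet (c e (f t)) +
        ⌊M * rep (c e (f t))⌋)), ?_⟩
      have heq : (liftPos c N M f g s)⁻¹ * liftPos c N M f g t =
          (position c N M (f s))⁻¹ * powHom M ((g s)⁻¹ * g t) * position c N M (f t) := by
        simp only [liftPos, map_mul, map_inv]
        group
      rw [heq, hdev, hY.position_eq he (hzero s hs), hY.position_eq he (hzero t ht)]
      simp only [gauge, Option.elim, map_zpow, powHom, FreeGroup.lift_apply_of,
        ← zpow_natCast, ← zpow_mul, ← zpow_neg, ← zpow_add, mul_neg, mul_add, add_assoc]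
    have h1 := hY.abs_expSum_liftPos_sub_le hg he hΘ M s t
    rw [hk] at h1 ⊢
    have h2 : (expSum e (FreeGroup.of e ^ k)).toAdd = k := by simp [expSum]
    rw [h2] at h1
    rw [letterCount_of_zpow, if_pos rfl, Nat.cast_natAbs, Int.cast_abs]
    have h3 := abs_le.1 (hosc t ht s hs)
    have h4 := mul_le_mul_of_nonneg_left h3.1 hM
    have h5 := mul_le_mul_of_nonneg_left h3.2 hM
    have h6 := abs_le.1 h1
    have h7 : 0 ≤ M * ε := mul_nonneg hM hε0
    rw [abs_le]
    constructor <;> linarith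

end Dev

end IsGraphLike

/-! ### The limit tree of a loop with trivial holonomies -/

namespace IsGraphLike

variable {Y : Type} [TopologicalSpace Y] {c : ℕ → C(Y, UnitAddCircle)} (hY : IsGraphLike Y c)

/-- Uniform continuity on the unit interval. -/
theorem exists_osc_le (Θ : C(I, ℝ)) {ε : ℝ} (hε : 0 < ε) :
    ∃ δ > 0, ∀ s t : I, |(s : ℝ) - t| ≤ δ → |Θ s - Θ t| ≤ ε := by
  obtain ⟨δ, hδ, h⟩ := Metric.uniformContinuous_iff.1
    (CompactSpace.uniformContinuous_of_continuous Θ.continuous) ε hε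
  refine ⟨δ / 2, by linarith, fun s t hst => ?_⟩
  have : dist s t < δ := by
    rw [Subtype.dist_eq, Real.dist_eq]
    linarith
  have := h this
  rw [Real.dist_eq] at this
  exact this.le

include hY

/-- The number of steps along the edge `e` between two points of the lift is small for close
points, uniformly in the number of edges taken into account. -/
theorem letterCount_small {f : C(I, Y)} {e : ℕ} {Θ : C(I, ℝ)}
    (hΘ : ∀ t, (Θ t : UnitAddCircle) = c e (f t)) {ε : ℝ} (hε : 0 < ε) :
    ∃ δ > 0, ∀ s t : I, |(s : ℝ) - t| ≤ δ → ∀ N, e < N → ∀ g, (hY.gauge N).IsDev f g → ∀ M : ℕ,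
      (letterCount e ((liftPos c N M f g s)⁻¹ * liftPos c N M f g t) : ℝ) ≤ 2 * M * ε + 2 := by
  obtain ⟨δ, hδ, h⟩ := exists_osc_le Θ (lt_min hε (by norm_num : (0 : ℝ) < 1 / 4))
  have key : ∀ s t : I, s ≤ t → |(s : ℝ) - t| ≤ δ → ∀ N, e < N → ∀ g, (hY.gauge N).IsDev f g →
      ∀ M : ℕ, (letterCount e ((liftPos c N M f g s)⁻¹ * liftPos c N M f g t) : ℝ) ≤
        2 * M * ε + 2 := by
    intro s t hst hd N he g hg M
    have h1 := hY.letterCount_liftPos_le hg he hΘ M hst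
      ((min_le_right ε (1 / 4)).trans_lt (by norm_num)) fun u hu v hv => h u v ?_
    · refine h1.trans ?_
      have : 2 * (M : ℝ) * min ε (1 / 4) ≤ 2 * M * ε :=
        mul_le_mul_of_nonneg_left (min_le_left _ _) (by positivity)
      linarith
    · have hu1 : (s : ℝ) ≤ u := hu.1
      have hu2 : (u : ℝ) ≤ t := hu.2
      have hv1 : (s : ℝ) ≤ v := hv.1
      have hv2 : (v : ℝ) ≤ t := hv.2
      rw [abs_le] at hd ⊢
      constructor <;> linarith
  refine ⟨δ, hδ, fun s t hd N he g hg M => ?_⟩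
  rcases le_total s t with hst | hst
  · exact key s t hst hd N he g hg M
  · rw [abs_sub_comm] at hd
    have := key t s hst hd N he g hg M
    rwa [← letterCount_inv, show ((liftPos c N M f g t)⁻¹ * liftPos c N M f g s)⁻¹ =
      (liftPos c N M f g s)⁻¹ * liftPos c N M f g t by group] at this

/-- Cut the interval into steps short enough for `letterCount_small` with `ε = 1`. Each costs at
most `2 * M + 2 ≤ 4 * M` letters, and an arbitrary pair of points is joined through `0`. The bound
depends on the edge and the path only, which makes the weights of the limit tree possible. -/
theorem letterCount_bounded {f : C(I, Y)} {e : ℕ} {Θ : C(I, ℝ)}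
    (hΘ : ∀ t, (Θ t : UnitAddCircle) = c e (f t)) :
    ∃ K : ℝ, 0 ≤ K ∧ ∀ s t : I, ∀ N, e < N → ∀ g, (hY.gauge N).IsDev f g → ∀ M : ℕ, 1 ≤ M →
      (letterCount e ((liftPos c N M f g s)⁻¹ * liftPos c N M f g t) : ℝ) ≤ K * M := by
  obtain ⟨δ, hδ, h⟩ := hY.letterCount_small hΘ one_pos
  have key : ∀ n : ℕ, ∀ t : I, (t : ℝ) ≤ n * δ → ∀ N, e < N → ∀ g, (hY.gauge N).IsDev f g →
      ∀ M : ℕ, 1 ≤ M → (letterCount e ((liftPos c N M f g 0)⁻¹ * liftPos c N M f g t) : ℝ) ≤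
        (4 * n) * M := by
    intro n
    induction n with
    | zero =>
      intro t ht N he g hg M hM
      obtain rfl : t = 0 := Subtype.ext (le_antisymm (by simpa using ht) t.2.1)
      simp [letterCount_one]
    | succ n ih =>
      intro t ht N he g hg M hM
      let v : I := ⟨max 0 (t - δ), le_max_left _ _, max_le zero_le_one (by linarith [t.2.2])⟩
      have hd : |(v : ℝ) - t| ≤ δ := by
        have h4 : (t : ℝ) - δ ≤ v := le_max_right _ _
        have h5 : (v : ℝ) ≤ t := max_le t.2.1 (by linarith)
        rw [abs_le]
        constructor <;> linarith
      have hv := ih v (max_le (by positivity) (by push_cast at ht; linarith)) N he g hg M hM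
      have h1 := h v t hd N he g hg M
      have h2 := letterCount_mul_le e ((liftPos c N M f g 0)⁻¹ * liftPos c N M f g v)
        ((liftPos c N M f g v)⁻¹ * liftPos c N M f g t)
      rw [show (liftPos c N M f g 0)⁻¹ * liftPos c N M f g v *
        ((liftPos c N M f g v)⁻¹ * liftPos c N M f g t) =
        (liftPos c N M f g 0)⁻¹ * liftPos c N M f g t by group] at h2
      have h3 : (letterCount e ((liftPos c N M f g 0)⁻¹ * liftPos c N M f g t) : ℝ) ≤
        letterCount e ((liftPos c N M f g 0)⁻¹ * liftPos c N M f g v) +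
        letterCount e ((liftPos c N M f g v)⁻¹ * liftPos c N M f g t) := by exact_mod_cast h2
      have h4 : (1 : ℝ) ≤ M := by exact_mod_cast hM
      push_cast
      linarith
  obtain ⟨n, hn⟩ := exists_nat_ge (1 / δ)
  rw [div_le_iff₀ hδ] at hn
  refine ⟨8 * n, by positivity, fun s t N he g hg M hM => ?_⟩
  have h1 := key n s (s.2.2.trans hn) N he g hg M hM
  have h2 := key n t (t.2.2.trans hn) N he g hg M hM
  have h3 := letterCount_mul_le e ((liftPos c N M f g s)⁻¹ * liftPos c N M f g 0)
    ((liftPos c N M f g 0)⁻¹ * liftPos c N M f g t)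
  rw [show (liftPos c N M f g s)⁻¹ * liftPos c N M f g 0 *
    ((liftPos c N M f g 0)⁻¹ * liftPos c N M f g t) =
    (liftPos c N M f g s)⁻¹ * liftPos c N M f g t by group, ← letterCount_inv e
    ((liftPos c N M f g s)⁻¹ * liftPos c N M f g 0), show ((liftPos c N M f g s)⁻¹ *
    liftPos c N M f g 0)⁻¹ = (liftPos c N M f g 0)⁻¹ * liftPos c N M f g s by group] at h3
  have h4 : (letterCount e ((liftPos c N M f g s)⁻¹ * liftPos c N M f g t) : ℝ) ≤
    letterCount e ((liftPos c N M f g 0)⁻¹ * liftPos c N M f g s) +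
    letterCount e ((liftPos c N M f g 0)⁻¹ * liftPos c N M f g t) := by exact_mod_cast h3
  linarith

/-- Along the path the relation `q • ψ = ∑ n e • c e` lifts to the reals up to a constant, and there
it can be divided by `q`, which is impossible in the circle. So the edge functions, which do not
separate vertices by their values, still do so by their lifts. -/
theorem eq_of_real_lift_eq {f : C(I, Y)} {Θ : ℕ → C(I, ℝ)}
    (hΘ : ∀ e t, (Θ e t : UnitAddCircle) = c e (f t)) {s t : I} (h : ∀ e, Θ e s = Θ e t) :
    f s = f t := by
  by_contra hne
  obtain ⟨ψ, q, S, n, hq, hψ, hne'⟩ := hY.sep _ _ hne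
  obtain ⟨Ψ, hΨ⟩ := exists_real_lift (ψ.comp f)
  have h1 := real_lift_unique (Θ := fun u => q * Ψ u) (Θ' := fun u => ∑ e ∈ S, n e * Θ e u)
    (by fun_prop) (by fun_prop) (fun u => ?_) s t
  · simp only [h, sub_self] at h1
    rw [← mul_sub, mul_eq_zero] at h1
    have h2 : Ψ t = Ψ s := by
      rcases h1 with h1 | h1
      · exact absurd (by exact_mod_cast h1) hq
      · linarith
    have h3 := hΨ t
    rw [h2, hΨ s] at h3
    exact hne' h3
  · have e1 : ((q * Ψ u : ℝ) : UnitAddCircle) = q • (Ψ u : UnitAddCircle) := by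
      rw [← nsmul_eq_mul, AddCircle.coe_nsmul]
    have e2 : ((∑ e ∈ S, n e * Θ e u : ℝ) : UnitAddCircle) =
        ∑ e ∈ S, n e • (Θ e u : UnitAddCircle) := by
      rw [← QuotientAddGroup.mk'_apply, map_sum]
      refine Finset.sum_congr rfl fun e _ => ?_
      rw [QuotientAddGroup.mk'_apply, ← zsmul_eq_mul]
      exact AddCircle.coe_zsmul ..
    rw [e1, e2, hΨ]
    simp only [hΘ]
    exact hψ (f u)

/-- A loop with trivial holonomies in all finitely generated free groups is null-homotopic. -/
theorem homotopic_refl_of_hol_eq_one {x : Y} (γ : Path x x)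
    (hγ : ∀ N, (hY.gauge N).hol γ = 1) : γ.Homotopic (Path.refl x) := by
  let f : C(I, Y) := γ.toContinuousMap
  choose g hg using fun N => (hY.gauge N).exists_isDev f
  choose Θ hΘ using fun e => exists_real_lift ((c e).comp f)
  have hΘ' : ∀ e t, (Θ e t : UnitAddCircle) = c e (f t) := hΘ
  choose K hK0 hK using fun e => hY.letterCount_bounded (hΘ' e)
  -- With these weights the edge `e` contributes at most `(1 / 2) ^ e` to every normalized distance,
  -- uniformly in `N`.
  let w : ℕ → ℝ := fun e => (1 / 2) ^ e / (K e + 1)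
  have hw : ∀ e, 0 < w e := fun e => div_pos (by positivity) (by linarith [hK0 e])
  have hw1 : ∀ e, w e ≤ (1 / 2) ^ e := fun e =>
    div_le_self (by positivity) (by linarith [hK0 e])
  -- The number of edges and the fineness of the subdivision grow together, so the rounding errors
  -- vanish in the limit.
  let z : ℕ → I → FreeGroup ℕ := fun N => liftPos c N (N + 1) f (g N)
  let d : ℕ → I → I → ℝ := fun N s t => treeDist (Finset.range N) w (z N s) (z N t) / (N + 1)
  have hterm : ∀ N s t e, e < N →
      w e * (letterCount e ((z N s)⁻¹ * z N t)) / (N + 1) ≤ (1 / 2) ^ e := by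
    intro N s t e he
    have h1 := hK e s t N he (g N) (hg N) (N + 1) (by omega)
    have h2 : (0 : ℝ) < N + 1 := by positivity
    rw [div_le_iff₀ h2]
    have h3 : 0 < K e + 1 := by linarith [hK0 e]
    have h4 : w e * (K e + 1) = (1 / 2) ^ e := by
      simp only [w]; field_simp
    rw [← h4, mul_assoc]
    refine mul_le_mul_of_nonneg_left (h1.trans ?_) (hw e).le
    push_cast
    nlinarith
  have hd0 : ∀ N s t, 0 ≤ d N s t := fun N s t => div_nonneg
    (Finset.sum_nonneg fun e _ => mul_nonneg (hw e).le (by positivity)) (by positivity)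
  have hgeom : ∀ n, ∑ e ∈ Finset.range n, ((1 : ℝ) / 2) ^ e ≤ 2 := fun n => sum_geometric_two_le n
  have hdeq : ∀ N s t, d N s t = ∑ e ∈ Finset.range N,
      w e * (letterCount e ((z N s)⁻¹ * z N t)) / (N + 1) := fun N s t => by
    simp only [d, treeDist, Finset.sum_div]
  have hd2 : ∀ N s t, d N s t ≤ 2 := fun N s t => by
    rw [hdeq]
    exact (Finset.sum_le_sum fun e he => hterm N s t e (Finset.mem_range.1 he)).trans (hgeom N)
  -- An ultrafilter limit exists for all pairs of points at once, and the metric and four point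
  -- inequalities pass to it.
  have hlim : ∀ s t, ∃ a, Tendsto (fun N => d N s t) (hyperfilter ℕ : Filter ℕ) (𝓝 a) := by
    intro s t
    obtain ⟨a, -, ha⟩ := (isCompact_Icc (a := (0 : ℝ)) (b := 2)).ultrafilter_le_nhds
      ((hyperfilter ℕ).map fun N => d N s t)
      (by
        rw [le_principal_iff]
        exact Filter.mem_map.2 (Filter.univ_mem' fun N => ⟨hd0 N s t, hd2 N s t⟩))
    exact ⟨a, ha⟩
  choose D hD using hlim
  have hinv : Tendsto (fun N : ℕ => 1 / ((N : ℝ) + 1)) (hyperfilter ℕ : Filter ℕ) (𝓝 0) :=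
    tendsto_one_div_add_atTop_nhds_zero_nat.mono_left Nat.hyperfilter_le_atTop
  have hev : ∀ n, ∀ᶠ N in (hyperfilter ℕ : Filter ℕ), n ≤ N := fun n =>
    Nat.hyperfilter_le_atTop (eventually_ge_atTop n)
  have hwn : ∀ e, 0 ≤ w e := fun e => (hw e).le
  have hcontour : IsContour D := by
    refine ⟨fun s => ?_, fun s t => ?_, fun s t u => ?_, fun s t u => ?_, fun ε hε => ?_, ?_⟩
    · refine tendsto_nhds_unique (hD s s) ?_
      simp only [d, treeDist_self, zero_div]
      exact tendsto_const_nhds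
    · refine tendsto_nhds_unique (hD s t) ((hD t s).congr fun N => ?_)
      simp only [d, treeDist_comm]
    · refine le_of_tendsto_of_tendsto (hD s u) ((hD s t).add (hD t u))
        (Eventually.of_forall fun N => ?_)
      simp only [d, ← add_div]
      exact div_le_div_of_nonneg_right (treeDist_triangle hwn _ _ _) (by positivity)
    · refine le_of_tendsto_of_tendsto ((hD s t).add (hD 0 u))
        (((hD s u).add (hD 0 t)).max ((hD u t).add (hD 0 s))) (Eventually.of_forall fun N => ?_)
      simp only [d, ← add_div]
      rw [max_div_div_right (by positivity)]
      exact div_le_div_of_nonneg_right (treeDist_four_point hwn _ _ _ _) (by positivity)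
    -- The edges from `n` on contribute less than `ε / 2` in total. For the first `n` edges use
    -- their oscillation with `ε / 8`: the counts are at most `ε / 4` per unit of mesh, up to
    -- rounding, and the weights sum to at most `2`.
    · obtain ⟨n, hn⟩ := exists_pow_lt_of_lt_one (show 0 < ε / 4 by linarith)
        (show (1 / 2 : ℝ) < 1 by norm_num)
      choose δ hδ hsmall using fun e => hY.letterCount_small (hΘ' e)
        (show 0 < ε / 8 by linarith)
      obtain ⟨δ₀, hδ₀, hle⟩ : ∃ δ₀ > 0, ∀ e < n, δ₀ ≤ δ e := by
        clear hn
        induction n with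
        | zero => exact ⟨1, one_pos, by simp⟩
        | succ n ih =>
          obtain ⟨δ₀, hδ₀, hle⟩ := ih
          refine ⟨min δ₀ (δ n), lt_min hδ₀ (hδ n), fun e he => ?_⟩
          rcases Nat.lt_succ_iff_lt_or_eq.1 he with h | rfl
          · exact (min_le_left _ _).trans (hle e h)
          · exact min_le_right _ _
      refine ⟨δ₀, hδ₀, fun s t hst => ?_⟩
      have hbound : ∀ N, n ≤ N → d N s t ≤
          (ε / 2 + 4 * (1 / ((N : ℝ) + 1))) + 2 * (1 / 2) ^ n := by
        intro N hN
        have hN1 : (0 : ℝ) < N + 1 := by positivity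
        rw [hdeq, ← Finset.sum_range_add_sum_Ico _ hN]
        refine add_le_add ?_ ?_
        · calc _ ≤ ∑ e ∈ Finset.range n, ((1 : ℝ) / 2) ^ e * (ε / 4 + 2 * (1 / ((N : ℝ) + 1))) := by
                refine Finset.sum_le_sum fun e he => ?_
                have he' := Finset.mem_range.1 he
                have h1 := hsmall e s t (hst.trans (hle e he')) N (he'.trans_le hN) (g N) (hg N)
                  (N + 1)
                rw [mul_div_assoc]
                refine mul_le_mul (hw1 e) ?_ (by positivity) (by positivity)
                rw [div_le_iff₀ hN1]
                refine h1.trans (le_of_eq ?_)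
                push_cast
                field_simp
                ring
          _ = (∑ e ∈ Finset.range n, ((1 : ℝ) / 2) ^ e) * (ε / 4 + 2 * (1 / ((N : ℝ) + 1))) := by
                rw [Finset.sum_mul]
          _ ≤ 2 * (ε / 4 + 2 * (1 / ((N : ℝ) + 1))) :=
                mul_le_mul_of_nonneg_right (hgeom n) (by positivity)
          _ = _ := by ring
        · calc _ ≤ ∑ e ∈ Finset.Ico n N, ((1 : ℝ) / 2) ^ e :=
                Finset.sum_le_sum fun e he => hterm N s t e (Finset.mem_Ico.1 he).2
          _ = (1 / 2) ^ n * ∑ e ∈ Finset.range (N - n), ((1 : ℝ) / 2) ^ e := by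
                rw [Finset.sum_Ico_eq_sum_range, Finset.mul_sum]
                exact Finset.sum_congr rfl fun e _ => pow_add _ _ _
          _ ≤ (1 / 2) ^ n * 2 := mul_le_mul_of_nonneg_left (hgeom _) (by positivity)
          _ = _ := by ring
      have hlim := ((hinv.const_mul 4).const_add (ε / 2)).add_const (2 * (1 / 2 : ℝ) ^ n)
      have := le_of_tendsto_of_tendsto (hD s t) hlim ((hev n).mono hbound)
      linarith
    · refine tendsto_nhds_unique (hD 0 1) ?_
      -- Trivial holonomy means that the lift to each tree is closed.
      have h01 : ∀ N, z N 0 = z N 1 := by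
        intro N
        have h1 := hγ N
        rw [(hY.gauge N).hol_eq (g := g N) (hg N), inv_mul_eq_one] at h1
        have h2 : f 0 = f 1 := γ.source.trans γ.target.symm
        simp only [z, liftPos, h1, h2]
      simp only [d, h01, treeDist_self, zero_div]
      exact tendsto_const_nhds
  refine hcontour.homotopic_refl γ fun s t hst => hY.eq_of_real_lift_eq (f := f) hΘ' fun e => ?_
  have h1 : ∀ N, e + 1 ≤ N → w e * |Θ e s - Θ e t| ≤ d N s t + w e * (1 / ((N : ℝ) + 1)) := by
    intro N hN
    have hN1 : (0 : ℝ) < N + 1 := by positivity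
    have h2 := hY.mul_abs_sub_le (hg N) (show e < N by omega) (hΘ' e) (N + 1) s t
    have h3 : w e * (letterCount e ((z N s)⁻¹ * z N t)) / (N + 1) ≤ d N s t := by
      rw [hdeq]
      exact Finset.single_le_sum
        (f := fun e => w e * (letterCount e ((z N s)⁻¹ * z N t) : ℝ) / (N + 1))
        (fun e _ => div_nonneg (mul_nonneg (hwn e) (by positivity)) hN1.le)
        (Finset.mem_range.2 (by omega))
    refine le_trans ?_ (add_le_add_left h3 _)
    rw [mul_div_assoc, ← mul_add, abs_sub_comm]
    refine mul_le_mul_of_nonneg_left ?_ (hwn e)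
    rw [← add_div, le_div_iff₀ hN1]
    push_cast at h2
    linarith
  have h2 := le_of_tendsto_of_tendsto tendsto_const_nhds
    ((hD s t).add (hinv.const_mul (w e))) ((hev (e + 1)).mono h1)
  rw [hst, mul_zero, add_zero] at h2
  have h3 : |Θ e s - Θ e t| ≤ 0 := by
    by_contra! h4
    exact absurd h2 (not_le.2 (mul_pos (hw e) h4))
  have h4 := abs_nonpos_iff.1 h3
  linarith

/-- Forgetting the last edge. -/
theorem hol_eq_of_hol_succ_eq {x : Y} (γ : Path x x) {N : ℕ} (h : (hY.gauge (N + 1)).hol γ = 1) :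
    (hY.gauge N).hol γ = 1 := by
  let p : FreeGroup ℕ →* FreeGroup ℕ := FreeGroup.lift fun e => if e = N then 1 else FreeGroup.of e
  obtain ⟨g, hg⟩ := (hY.gauge (N + 1)).exists_isDev γ.toContinuousMap
  have hg' : (hY.gauge N).IsDev γ (p ∘ g) := by
    intro t i hi
    have key : ∀ j, γ t ∈ (hY.gauge (N + 1)).U j →
        (∀ y, p ((hY.gauge (N + 1)).Φ j y) = (hY.gauge N).Φ i y) →
        ∀ᶠ u in 𝓝 t, (p ∘ g) u * ((hY.gauge N).Φ i (γ u))⁻¹ =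
          (p ∘ g) t * ((hY.gauge N).Φ i (γ t))⁻¹ := by
      intro j hj hp
      filter_upwards [hg t j hj] with u hu
      have := congrArg p hu
      simp only [map_mul, map_inv] at this
      rw [hp, hp] at this
      exact this
    cases i with
    | none =>
      -- At the midpoint of the last edge the vertex chart is not available for `N + 1`; the chart
      -- of that edge serves instead, as `p` kills its letter.
      by_cases hN : c N (γ t) = antipode
      · refine key (some N) ⟨Nat.lt_succ_self N, fun h0 => zero_ne_antipode (h0.symm.trans hN)⟩
          fun y => ?_
        simp [gauge, p]
      · refine key none (fun e he => ?_) fun y => by simp [gauge]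
        rcases Nat.lt_succ_iff_lt_or_eq.1 (Finset.mem_range.1 he) with h | rfl
        · exact hi e (Finset.mem_range.2 h)
        · exact hN
    | some e =>
      refine key (some e) ⟨hi.1.trans (Nat.lt_succ_self N), hi.2⟩ fun y => ?_
      have : e ≠ N := hi.1.ne
      simp [gauge, p, this]
  rw [(hY.gauge (N + 1)).hol_eq (g := g) hg, inv_mul_eq_one] at h
  rw [(hY.gauge N).hol_eq hg', inv_mul_eq_one]
  exact congrArg p h

/-- The holonomies for growing `N` have descending kernels, and a loop in all of them is
null-homotopic. -/
theorem isLocallyFree (x : Y) : IsLocallyFree (FundamentalGroup Y x) := by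
  refine isLocallyFree_of_antitone (fun _ => isLocallyFree_freeGroup ℕ)
    (fun N => (hY.gauge N).holHom x) (antitone_nat_of_succ_le fun N p hp => ?_) fun p hp => ?_
  · induction p using Path.Homotopic.Quotient.ind with | mk γ =>
    rw [MonoidHom.mem_ker] at hp ⊢
    rw [Gauge.holHom_mk, inv_eq_one] at hp ⊢
    exact hY.hol_eq_of_hol_succ_eq γ hp
  · induction p using Path.Homotopic.Quotient.ind with | mk γ =>
    simp only [Gauge.holHom_mk, inv_eq_one] at hp
    exact Path.Homotopic.Quotient.eq.2 (hY.homotopic_refl_of_hol_eq_one γ hp)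

end IsGraphLike

/-! ### Topology of the adjunction space -/

open Metric

/-- The inclusion of the Hawaiian earring. -/
def ofEarring (h : earring) : Space := Quot.mk _ (Sum.inl h)

/-- The canonical map of the `n`-th pair of pants. -/
def ofPants (n : ℕ+) (z : pants) : Space := Quot.mk _ (Sum.inr ⟨n, z⟩)

theorem isQuotientMap_mk : IsQuotientMap (Quot.mk (GlueRel allBoundary attach) : _ → Space) :=
  isQuotientMap_quot_mk

@[fun_prop]
theorem continuous_ofPants (n : ℕ+) : Continuous (ofPants n) :=
  isQuotientMap_mk.continuous.comp (continuous_inr.comp continuous_sigmaMk)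

theorem isClosed_iff {S : Set Space} :
    IsClosed S ↔ IsClosed (ofEarring ⁻¹' S) ∧ ∀ n, IsClosed (ofPants n ⁻¹' S) := by
  refine isQuotientMap_mk.isClosed_preimage.symm.trans ?_
  rw [isClosed_sum_iff, isClosed_sigma_iff]
  rfl

theorem ofPants_eq {n : ℕ+} {z : pants} (hz : (z : ℂ) ∈ pantsBoundary) :
    ofPants n z = ofEarring ⟨attachFun n z, attachFun_mem hz⟩ :=
  Quot.sound (GlueRel.glue (⟨⟨n, z⟩, hz⟩ : allBoundary))

theorem exists_rep (x : Space) :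
    (∃ h, ofEarring h = x) ∨ ∃ n, ∃ z : pants, (z : ℂ) ∉ pantsBoundary ∧ ofPants n z = x := by
  induction x using Quot.ind with | mk a =>
  rcases a with h | ⟨n, z⟩
  · exact Or.inl ⟨h, rfl⟩
  · by_cases hz : (z : ℂ) ∈ pantsBoundary
    · exact Or.inl ⟨_, (ofPants_eq hz).symm⟩
    · exact Or.inr ⟨n, z, hz, rfl⟩

open Classical in
/-- A function on the space from functions on the earring and on the interiors of the pants. -/
noncomputable def glueFun {T : Type} (φ : earring → T) (φ' : ℕ+ → pants → T) : Space → T :=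
  Quot.lift (Sum.elim φ fun p => if h : p ∈ allBoundary then φ (attach ⟨p, h⟩) else φ' p.1 p.2)
    fun _ _ ⟨a⟩ => by simp

section glueFun

variable {T : Type} (φ : earring → T) (φ' : ℕ+ → pants → T)

@[simp]
theorem glueFun_ofEarring (h : earring) : glueFun φ φ' (ofEarring h) = φ h := rfl

theorem glueFun_ofPants {n : ℕ+} {z : pants} (hz : (z : ℂ) ∉ pantsBoundary) :
    glueFun φ φ' (ofPants n z) = φ' n z :=
  dif_neg (c := (⟨n, z⟩ : AllPants) ∈ allBoundary) hz

end glueFun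

theorem ofEarring_injective : Function.Injective ofEarring := fun h h' e => by
  simpa using congrArg (glueFun some fun _ _ => none) e

theorem ofPants_eq_ofEarring_iff {n : ℕ+} {z : pants} {h : earring} :
    ofPants n z = ofEarring h ↔ (z : ℂ) ∈ pantsBoundary ∧ attachFun n z = h := by
  constructor
  · intro e
    by_cases hz : (z : ℂ) ∈ pantsBoundary
    · rw [ofPants_eq hz] at e
      exact ⟨hz, congrArg Subtype.val (ofEarring_injective e)⟩
    · have := congrArg (glueFun (fun _ => True) fun _ _ => False) e
      rw [glueFun_ofPants _ _ hz] at this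
      simp at this
  · rintro ⟨hz, e⟩
    rw [ofPants_eq hz]
    exact congrArg _ (Subtype.ext e)

theorem ofPants_eq_ofPants {n k : ℕ+} {z w : pants} (e : ofPants n z = ofPants k w) :
    (n = k ∧ z = w) ∨ ((z : ℂ) ∈ pantsBoundary ∧ (w : ℂ) ∈ pantsBoundary ∧
      attachFun n z = attachFun k w) := by
  by_cases hz : (z : ℂ) ∈ pantsBoundary
  · rw [ofPants_eq hz] at e
    obtain ⟨hw, e'⟩ := ofPants_eq_ofEarring_iff.1 e.symm
    exact Or.inr ⟨hz, hw, e'.symm⟩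
  · by_cases hw : (w : ℂ) ∈ pantsBoundary
    · rw [ofPants_eq hw] at e
      exact absurd (ofPants_eq_ofEarring_iff.1 e).1 hz
    · have := congrArg (glueFun (fun _ => none) fun n z => some (n, z)) e
      rw [glueFun_ofPants _ _ hz, glueFun_ofPants _ _ hw] at this
      exact Or.inl (by simpa using this)

theorem mem_C_iff {n : ℕ+} {z : ℂ} : z ∈ C n ↔ n * (z.re ^ 2 + z.im ^ 2) = 2 * z.re := by
  have hn : (0 : ℝ) < n := by exact_mod_cast n.pos
  have h1 : z - 1 / (n : ℂ) = ((z.re - 1 / n : ℝ) : ℂ) + (z.im : ℝ) * Complex.I := by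
    apply Complex.ext <;> simp [← Complex.ofReal_natCast, ← Complex.ofReal_inv]
  rw [C, mem_sphere, dist_eq_norm, h1, Complex.norm_add_mul_I, Real.sqrt_eq_iff_eq_sq
    (by positivity) (by positivity)]
  constructor
  · intro h
    field_simp at h
    nlinarith
  · intro h
    field_simp
    nlinarith

theorem mem_pants_iff {z : ℂ} : z ∈ pants ↔ z.re ^ 2 + z.im ^ 2 ≤ 16 ∧
    1 ≤ (z.re + 2) ^ 2 + z.im ^ 2 ∧ 1 ≤ (z.re - 2) ^ 2 + z.im ^ 2 := by
  simp only [pants, Set.mem_sdiff, Set.mem_union, mem_closedBall, mem_ball, dist_eq_norm,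
    not_or, not_lt, ← sq_le_sq₀ (norm_nonneg _) (by norm_num : (0 : ℝ) ≤ 4),
    ← sq_le_sq₀ (zero_le_one' ℝ) (norm_nonneg _), ← Complex.normSq_eq_norm_sq,
    Complex.normSq_apply, Complex.sub_re, Complex.sub_im, Complex.neg_re, Complex.neg_im]
  norm_num [sq]

theorem mem_outer_iff {z : ℂ} : z ∈ sphere (0 : ℂ) 4 ↔ z.re ^ 2 + z.im ^ 2 = 16 := by
  rw [mem_sphere, dist_eq_norm, ← sq_eq_sq₀ (norm_nonneg _) (by norm_num),
    ← Complex.normSq_eq_norm_sq, Complex.normSq_apply]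
  norm_num [sq]

theorem mem_left_iff {z : ℂ} : z ∈ sphere (-2 : ℂ) 1 ↔ (z.re + 2) ^ 2 + z.im ^ 2 = 1 := by
  rw [mem_sphere, dist_eq_norm, ← sq_eq_sq₀ (norm_nonneg _) (by norm_num),
    ← Complex.normSq_eq_norm_sq, Complex.normSq_apply]
  norm_num [sq]

theorem mem_right_iff {z : ℂ} : z ∈ sphere (2 : ℂ) 1 ↔ (z.re - 2) ^ 2 + z.im ^ 2 = 1 := by
  rw [mem_sphere, dist_eq_norm, ← sq_eq_sq₀ (norm_nonneg _) (by norm_num),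
    ← Complex.normSq_eq_norm_sq, Complex.normSq_apply]
  norm_num [sq]

section attachFun

variable {n : ℕ+} {z : ℂ}

theorem attachFun_of_outer (n : ℕ+) (h : z ∈ sphere (0 : ℂ) 4) :
    attachFun n z = 1 / (n : ℂ) * (1 + z / 4) := if_pos h

theorem attachFun_of_left (n : ℕ+) (h : z ∈ sphere (-2 : ℂ) 1) :
    attachFun n z = 1 / ((2 * n : ℕ+) : ℂ) * (1 + (z + 2)) := by
  rw [attachFun, if_neg fun h' => (sphere_disjoint_aux h').1 h, if_pos h]

theorem attachFun_of_right (n : ℕ+) (h : z ∈ sphere (2 : ℂ) 1) :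
    attachFun n z = 1 / ((2 * n + 1 : ℕ+) : ℂ) * (1 + (z - 2)) := by
  rw [attachFun, if_neg fun h' => (sphere_disjoint_aux h').2 h, if_neg (sphere_disjoint_aux' h)]

theorem attachFun_mem_of_outer (n : ℕ+) (h : z ∈ sphere (0 : ℂ) 4) : attachFun n z ∈ C n := by
  rw [attachFun_of_outer n h]
  refine mem_C_of_norm_eq_one n ?_
  rw [mem_sphere_zero_iff_norm] at h
  simp [h]

theorem attachFun_mem_of_left (n : ℕ+) (h : z ∈ sphere (-2 : ℂ) 1) :
    attachFun n z ∈ C (2 * n) := by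
  rw [attachFun_of_left n h]
  refine mem_C_of_norm_eq_one _ ?_
  simpa [dist_eq_norm] using h

theorem attachFun_mem_of_right (n : ℕ+) (h : z ∈ sphere (2 : ℂ) 1) :
    attachFun n z ∈ C (2 * n + 1) := by
  rw [attachFun_of_right n h]
  refine mem_C_of_norm_eq_one _ ?_
  simpa [dist_eq_norm] using h

theorem exists_attachFun_mem (n : ℕ+) (hz : z ∈ pantsBoundary) :
    ∃ k, n ≤ k ∧ attachFun n z ∈ C k := by
  rcases hz with h | h | h
  · exact ⟨n, le_rfl, attachFun_mem_of_outer n h⟩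
  · exact ⟨2 * n, by rw [← PNat.coe_le_coe]; push_cast; omega, attachFun_mem_of_left n h⟩
  · exact ⟨2 * n + 1, by rw [← PNat.coe_le_coe]; push_cast; omega, attachFun_mem_of_right n h⟩

theorem continuousOn_attachFun (n : ℕ+) : ContinuousOn (attachFun n) pantsBoundary := by
  refine ContinuousOn.union_of_isClosed ?_ (ContinuousOn.union_of_isClosed ?_ ?_
    isClosed_sphere isClosed_sphere) isClosed_sphere (isClosed_sphere.union isClosed_sphere)
  · exact ContinuousOn.congr (by fun_prop) fun z hz => attachFun_of_outer n hz
  · exact ContinuousOn.congr (by fun_prop) fun z hz => attachFun_of_left n hz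
  · exact ContinuousOn.congr (by fun_prop) fun z hz => attachFun_of_right n hz

end attachFun

theorem isClosed_pantsBoundary : IsClosed pantsBoundary :=
  isClosed_sphere.union (isClosed_sphere.union isClosed_sphere)

theorem isCompact_pants : IsCompact pants :=
  (isCompact_closedBall _ _).diff (isOpen_ball.union isOpen_ball)

instance : CompactSpace pants := isCompact_iff_compactSpace.1 isCompact_pants

theorem eq_zero_of_mem_C {n k : ℕ+} {z : ℂ} (hn : z ∈ C n) (hk : z ∈ C k) (h : n ≠ k) : z = 0 := by
  rw [mem_C_iff] at hn hk
  have h1 : ((n : ℝ) - k) * (z.re ^ 2 + z.im ^ 2) = 0 := by linarith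
  have h2 : (n : ℝ) - k ≠ 0 := by
    rw [sub_ne_zero]
    exact_mod_cast h
  have h3 := (mul_eq_zero.1 h1).resolve_left h2
  refine Complex.ext ?_ ?_ <;> simp <;> nlinarith [sq_nonneg z.re, sq_nonneg z.im]

theorem isClosed_boundary_preimage {A : Set earring} (hA : IsClosed A) (n : ℕ+) :
    IsClosed {z : pants | ∃ hz : (z : ℂ) ∈ pantsBoundary,
      (⟨attachFun n z, attachFun_mem hz⟩ : earring) ∈ A} := by
  let e : {z : pants | (z : ℂ) ∈ pantsBoundary} → earring :=
    fun z => ⟨attachFun n z.1, attachFun_mem z.2⟩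
  have he : Continuous e := by
    refine Continuous.subtype_mk ?_ _
    exact (continuousOn_attachFun n).comp_continuous (by fun_prop) fun z => z.2
  have h1 := (isClosed_pantsBoundary.preimage (continuous_subtype_val (p := (· ∈ pants)))
    ).isClosedEmbedding_subtypeVal.isClosedMap _ (hA.preimage he)
  convert h1 using 1
  ext z
  constructor
  · rintro ⟨hz, h⟩
    exact ⟨⟨z, hz⟩, h, rfl⟩
  · rintro ⟨⟨z, hz⟩, h, rfl⟩
    exact ⟨hz, h⟩

theorem isClosedMap_ofEarring : IsClosedMap ofEarring := by
  intro A hA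
  refine isClosed_iff.2 ⟨?_, fun n => ?_⟩
  · rwa [Set.preimage_image_eq _ ofEarring_injective]
  · convert isClosed_boundary_preimage hA n using 1
    ext z
    constructor
    · rintro ⟨h, hA, e⟩
      obtain ⟨hz, e'⟩ := ofPants_eq_ofEarring_iff.1 e.symm
      refine ⟨hz, ?_⟩
      convert hA
    · rintro ⟨hz, h⟩
      exact ⟨_, h, (ofPants_eq hz).symm⟩

/-- The trace on the earring is a compact image of the boundary part of `B`, and the other pants see
the image of `B` only through this trace. -/
theorem isClosedMap_ofPants (n : ℕ+) : IsClosedMap (ofPants n) := by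
  intro B hB
  have h1 : IsClosed (ofEarring ⁻¹' (ofPants n '' B)) := by
    let e : {z : pants | z ∈ B ∧ (z : ℂ) ∈ pantsBoundary} → earring :=
      fun z => ⟨attachFun n z.1, attachFun_mem z.2.2⟩
    have he : Continuous e := by
      refine Continuous.subtype_mk ?_ _
      exact (continuousOn_attachFun n).comp_continuous (by fun_prop) fun z => z.2.2
    have hc : CompactSpace {z : pants | z ∈ B ∧ (z : ℂ) ∈ pantsBoundary} :=
      isCompact_iff_compactSpace.1
        (hB.inter (isClosed_pantsBoundary.preimage continuous_subtype_val)).isCompact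
    convert (isCompact_range he).isClosed using 1
    ext h
    constructor
    · rintro ⟨z, hz, e⟩
      obtain ⟨hz', e'⟩ := ofPants_eq_ofEarring_iff.1 e
      exact ⟨⟨z, hz, hz'⟩, Subtype.ext e'⟩
    · rintro ⟨⟨z, hz, hz'⟩, rfl⟩
      exact ⟨z, hz, ofPants_eq hz'⟩
  refine isClosed_iff.2 ⟨h1, fun k => ?_⟩
  have h2 := isClosed_boundary_preimage h1 k
  by_cases hk : k = n
  · subst hk
    convert h2.union hB using 1
    ext z
    constructor
    · rintro ⟨w, hw, e⟩
      rcases ofPants_eq_ofPants e with ⟨-, rfl⟩ | ⟨-, hz, -⟩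
      · exact Or.inr hw
      · exact Or.inl ⟨hz, w, hw, e.trans (ofPants_eq hz)⟩
    · rintro (⟨hz, w, hw, e⟩ | h)
      · exact ⟨w, hw, e.trans (ofPants_eq hz).symm⟩
      · exact ⟨z, h, rfl⟩
  · convert h2 using 1
    ext z
    constructor
    · rintro ⟨w, hw, e⟩
      rcases ofPants_eq_ofPants e with ⟨h, -⟩ | ⟨-, hz, -⟩
      · exact absurd h.symm hk
      · exact ⟨hz, w, hw, e.trans (ofPants_eq hz)⟩
    · rintro ⟨hz, w, hw, e⟩
      exact ⟨w, hw, e.trans (ofPants_eq hz).symm⟩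

/-! ### Vertical deformation of one pair of pants -/

/-- The half height of the inner disks of the pair of pants at the abscissa `x`. -/
noncomputable def height (x : ℝ) : ℝ := Real.sqrt (1 - (|x| - 2) ^ 2)

theorem height_nonneg (x : ℝ) : 0 ≤ height x := Real.sqrt_nonneg _

@[fun_prop]
theorem continuous_height : Continuous height := by unfold height; fun_prop

/-- Only an inequality: over abscissas that miss the inner disks the left side is negative, and the
square root of a negative number is `0`, which is the wanted height of the axis. -/
theorem one_le_height_sq (x : ℝ) : 1 - (|x| - 2) ^ 2 ≤ height x ^ 2 := by
  rw [height, Real.sq_sqrt']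
  exact le_max_left _ _

theorem abs_sub_two_sq_le (x : ℝ) : (|x| - 2) ^ 2 ≤ (x + 2) ^ 2 ∧ (|x| - 2) ^ 2 ≤ (x - 2) ^ 2 := by
  rcases abs_cases x with ⟨h, h'⟩ | ⟨h, h'⟩ <;> rw [h] <;> constructor <;> nlinarith

/-- The vertical deformation of the plane onto the region `|y| ≤ height x`. -/
noncomputable def clamp (z : ℂ) (s : ℝ) : ℂ :=
  z.re + ((1 - s) * z.im + s * max (-height z.re) (min (height z.re) z.im) : ℝ) * Complex.I

@[simp]
theorem clamp_re (z : ℂ) (s : ℝ) : (clamp z s).re = z.re := by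
  rw [clamp, Complex.add_re, Complex.re_ofReal_mul]; simp

theorem clamp_im (z : ℂ) (s : ℝ) : (clamp z s).im =
    (1 - s) * z.im + s * max (-height z.re) (min (height z.re) z.im) := by
  rw [clamp, Complex.add_im, Complex.im_ofReal_mul]; simp

theorem continuous_clamp : Continuous fun p : ℂ × ℝ => clamp p.1 p.2 := by
  unfold clamp
  fun_prop

theorem clamp_zero (z : ℂ) : clamp z 0 = z :=
  Complex.ext (clamp_re _ _) (by rw [clamp_im]; simp)

theorem clamp_eq_self {z : ℂ} (h : |z.im| ≤ height z.re) (s : ℝ) : clamp z s = z := by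
  rw [abs_le] at h
  refine Complex.ext (clamp_re _ _) ?_
  rw [clamp_im, min_eq_right h.2, max_eq_right h.1]
  ring

theorem clamp_im_sq_le (z : ℂ) (s : I) : (clamp z s).im ^ 2 ≤ z.im ^ 2 := by
  by_cases h : |z.im| ≤ height z.re
  · rw [clamp_eq_self h]
  · have h0 := height_nonneg z.re
    have h1 := s.2.1
    have h2 := s.2.2
    rw [clamp_im, sq_le_sq, abs_le]
    rcases abs_cases z.im with ⟨h3, h4⟩ | ⟨h3, h4⟩ <;> rw [h3] at h ⊢ <;> push Not at h
    · rw [min_eq_left h.le, max_eq_right (by linarith)]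
      constructor <;> nlinarith
    · rw [min_eq_right (by linarith), max_eq_left (by linarith)]
      constructor <;> nlinarith

theorem height_sq_le_clamp_im_sq {z : ℂ} (h : height z.re < |z.im|) (s : I) :
    height z.re ^ 2 ≤ (clamp z s).im ^ 2 := by
  have h0 := height_nonneg z.re
  have h1 := s.2.1
  have h2 := s.2.2
  rw [clamp_im, sq_le_sq, abs_of_nonneg h0, le_abs]
  rcases abs_cases z.im with ⟨h3, h4⟩ | ⟨h3, h4⟩ <;> rw [h3] at h
  · rw [min_eq_left h.le, max_eq_right (by linarith)]
    left; nlinarith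
  · rw [min_eq_right (by linarith), max_eq_left (by linarith)]
    right; nlinarith

theorem clamp_one_im_sq {z : ℂ} (h : height z.re < |z.im|) :
    (clamp z 1).im ^ 2 = height z.re ^ 2 := by
  have h0 := height_nonneg z.re
  rw [clamp_im]
  rcases abs_cases z.im with ⟨h3, h4⟩ | ⟨h3, h4⟩ <;> rw [h3] at h
  · rw [min_eq_left h.le, max_eq_right (by linarith)]
    ring
  · rw [min_eq_right (by linarith), max_eq_left (by linarith)]
    ring

/-- Points move vertically towards the axis, so they stay in the outer disk, and those that move
never pass below the boundary of an inner disk. -/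
theorem clamp_mem_pants {z : ℂ} (hz : z ∈ pants) (s : I) : clamp z s ∈ pants := by
  by_cases h : |z.im| ≤ height z.re
  · rwa [clamp_eq_self h]
  · have h1 := height_sq_le_clamp_im_sq (not_le.1 h) s
    have h2 := clamp_im_sq_le z s
    have h3 := one_le_height_sq z.re
    have h4 := abs_sub_two_sq_le z.re
    rw [mem_pants_iff] at hz ⊢
    rw [clamp_re]
    refine ⟨?_, ?_, ?_⟩ <;> linarith

/-- The region onto which the pair of pants is deformed: the real axis and the inner circles. -/
def IsSpinal (z : ℂ) : Prop := z.im = 0 ∨ z ∈ sphere (-2 : ℂ) 1 ∨ z ∈ sphere (2 : ℂ) 1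

theorem abs_im_le_height {z : ℂ} (h : IsSpinal z) : |z.im| ≤ height z.re := by
  rcases h with h | h | h
  · rw [h, abs_zero]
    exact height_nonneg _
  · rw [mem_left_iff] at h
    refine Real.le_sqrt_of_sq_le ?_
    have : z.re ≤ 0 := by nlinarith
    rw [abs_of_nonpos this, sq_abs]
    linarith
  · rw [mem_right_iff] at h
    refine Real.le_sqrt_of_sq_le ?_
    have : 0 ≤ z.re := by nlinarith
    rw [abs_of_nonneg this, sq_abs]
    linarith

theorem clamp_eq_self_of_isSpinal {z : ℂ} (h : IsSpinal z) (s : ℝ) : clamp z s = z :=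
  clamp_eq_self (abs_im_le_height h) s

/-- Over an inner disk the points of the pants within this height lie on its boundary circle;
elsewhere the height is `0`. -/
theorem isSpinal_of_im_sq {z : ℂ} (hz : z ∈ pants)
    (h : z.im ^ 2 ≤ height z.re ^ 2) :
    IsSpinal z := by
  rw [mem_pants_iff] at hz
  rw [height, Real.sq_sqrt'] at h
  rcases le_max_iff.1 h with h | h
  · rcases abs_cases z.re with ⟨h1, h2⟩ | ⟨h1, h2⟩ <;> rw [h1] at h
    · right; right
      rw [mem_right_iff]
      linarith
    · right; left
      rw [mem_left_iff]
      linarith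
  · left
    exact pow_eq_zero_iff (two_ne_zero) |>.1 (le_antisymm h (sq_nonneg _))

theorem isSpinal_clamp_one {z : ℂ} (hz : z ∈ pants) : IsSpinal (clamp z 1) := by
  refine isSpinal_of_im_sq (clamp_mem_pants hz 1) ?_
  rw [clamp_re]
  rcases le_or_gt |z.im| (height z.re) with h | h
  · rw [clamp_eq_self h, ← sq_abs]
    exact pow_le_pow_left₀ (abs_nonneg _) h 2
  · exact (clamp_one_im_sq h).le

/-- The deformation of the `n`-th pair of pants inside the space. -/
noncomputable def clampPants (n : ℕ+) : C(pants, C(I, Space)) :=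
  ContinuousMap.curry ⟨fun p : pants × I => ofPants n ⟨clamp p.1 p.2, clamp_mem_pants p.1.2 p.2⟩,
    (continuous_ofPants n).comp (Continuous.subtype_mk
      (continuous_clamp.comp (f := fun p : pants × I => ((p.1 : ℂ), (p.2 : ℝ))) (by fun_prop)) _)⟩

theorem clampPants_apply (n : ℕ+) (z : pants) (s : I) :
    clampPants n z s = ofPants n ⟨clamp z s, clamp_mem_pants z.2 s⟩ := rfl

theorem clampPants_of_isSpinal (n : ℕ+) {z : pants} (h : IsSpinal z) :
    clampPants n z = ContinuousMap.const I (ofPants n z) := by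
  ext s
  rw [clampPants_apply, ContinuousMap.const_apply]
  congr 1
  exact Subtype.ext (clamp_eq_self_of_isSpinal h s)

/-! ### Stages and the successive collapse of the pants -/

/-- The union of the circles of index greater than `n`. -/
def tail (n : ℕ) : Set earring := {h | ∃ k : ℕ+, n < k ∧ (h : ℂ) ∈ C k}

/-- The index of the circle through a nonzero point is `2 * re / (re ^ 2 + im ^ 2)`, so the tail is
cut out by a closed condition; the base point lies on all circles. -/
theorem mem_tail_iff {n : ℕ} {h : earring} :
    h ∈ tail n ↔ (n + 1) * ((h : ℂ).re ^ 2 + (h : ℂ).im ^ 2) ≤ 2 * (h : ℂ).re := by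
  constructor
  · rintro ⟨k, hk, h1⟩
    rw [mem_C_iff] at h1
    rw [← h1]
    have : (n : ℝ) + 1 ≤ k := by exact_mod_cast hk
    exact mul_le_mul_of_nonneg_right this (by positivity)
  · intro h1
    obtain ⟨k, hk⟩ := Set.mem_iUnion.1 h.2
    by_cases h0 : (h : ℂ) = 0
    · exact ⟨n.succPNat, by simp, by rw [h0, mem_C_iff]; simp⟩
    · refine ⟨k, ?_, hk⟩
      rw [mem_C_iff] at hk
      rw [← hk] at h1
      have h2 : 0 < (h : ℂ).re ^ 2 + (h : ℂ).im ^ 2 := by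
        have := Complex.normSq_pos.2 h0
        rw [Complex.normSq_apply] at this
        nlinarith
      have := le_of_mul_le_mul_right h1 h2
      exact_mod_cast this

theorem isClosed_tail (n : ℕ) : IsClosed (tail n) := by
  have : tail n = {h : earring |
      (n + 1) * ((h : ℂ).re ^ 2 + (h : ℂ).im ^ 2) ≤ 2 * (h : ℂ).re} :=
    Set.ext fun _ => mem_tail_iff
  rw [this]
  exact isClosed_le (by fun_prop) (by fun_prop)

theorem zero_mem_tail (n : ℕ) : (⟨0, zero_mem_earring⟩ : earring) ∈ tail n := by
  rw [mem_tail_iff]; simp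

/-- The part of the space that consists of the circles of index greater than `n`, the pants of
index `n + 1, …, m` and the real axes of the pants of index at most `min n m`. -/
def stage (n m : ℕ) : Set Space :=
  ofEarring '' tail n ∪ ⋃ k ∈ {k : ℕ+ | (k : ℕ) ≤ m}, ofPants k '' {z | n < k ∨ (z : ℂ).im = 0}

theorem mem_stage_iff {n m : ℕ} {x : Space} : x ∈ stage n m ↔ (∃ h ∈ tail n, ofEarring h = x) ∨
    ∃ k : ℕ+, (k : ℕ) ≤ m ∧ ∃ z : pants, (n < k ∨ (z : ℂ).im = 0) ∧ ofPants k z = x := by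
  simp [stage]

theorem isClosed_stage (n m : ℕ) : IsClosed (stage n m) := by
  refine (isClosedMap_ofEarring _ (isClosed_tail n)).union (Set.Finite.isClosed_biUnion
    ((Set.finite_Iic m).preimage PNat.coe_injective.injOn) fun k _ => isClosedMap_ofPants k _ ?_)
  by_cases h : n < k
  · simp [h]
  · simp only [h, false_or]
    exact isClosed_eq (by fun_prop) continuous_const

theorem basePoint_mem_stage (n m : ℕ) : basePoint ∈ stage n m :=
  mem_stage_iff.2 (Or.inl ⟨_, zero_mem_tail n, rfl⟩)

theorem exists_outer {n : ℕ+} {w : ℂ} (hw : w ∈ C n) :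
    ∃ z ∈ sphere (0 : ℂ) 4, z ∈ pants ∧ attachFun n z = w := by
  have hn : (n : ℂ) ≠ 0 := by exact_mod_cast n.pos.ne'
  -- The inverse of the similarity `z ↦ (1 + z / 4) / n`.
  have h1 : 4 * (n * w - 1) ∈ sphere (0 : ℂ) 4 := by
    rw [mem_C_iff] at hw
    rw [mem_outer_iff]
    simp
    nlinarith
  refine ⟨4 * (n * w - 1), h1, ⟨sphere_subset_closedBall h1, ?_⟩, ?_⟩
  · rintro (h | h)
    · rw [mem_sphere_zero_iff_norm] at h1
      rw [mem_ball, dist_eq_norm] at h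
      have := norm_sub_norm_le (4 * (n * w - 1)) (-2)
      rw [h1] at this
      norm_num at this h
      linarith
    · rw [mem_sphere_zero_iff_norm] at h1
      rw [mem_ball, dist_eq_norm] at h
      have := norm_sub_norm_le (4 * (n * w - 1)) 2
      rw [h1] at this
      norm_num at this h
      linarith
  · rw [attachFun_of_outer n h1]
    field_simp
    ring

theorem im_eq_zero_of_attachFun_outer {n : ℕ+} {z : ℂ} (hz : z ∈ sphere (0 : ℂ) 4)
    (h : (attachFun n z).im = 0) : z.im = 0 := by
  have hn : (n : ℝ) ≠ 0 := by exact_mod_cast n.pos.ne'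
  rw [attachFun_of_outer n hz, one_div, ← Complex.ofReal_natCast, ← Complex.ofReal_inv,
    Complex.im_ofReal_mul] at h
  have h1 := (mul_eq_zero.1 h).resolve_left (inv_ne_zero hn)
  simpa using h1

theorem attachFun_im_of_im_eq_zero (n : ℕ+) {z : ℂ} (h : z.im = 0) : (attachFun n z).im = 0 := by
  unfold attachFun
  split_ifs <;> rw [one_div, ← Complex.ofReal_natCast, ← Complex.ofReal_inv,
    Complex.im_ofReal_mul] <;> simp [h]

/-- The only circle lost on passing to `n + 1` is `C (n + 1)`, and the outer boundary of `P_{n + 1}`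
covers it. -/
theorem stage_eq {n m : ℕ} (h : n < m) :
    stage n m = Set.range (ofPants n.succPNat) ∪ stage (n + 1) m := by
  ext x
  rw [Set.mem_union, mem_stage_iff, mem_stage_iff]
  constructor
  · rintro (⟨w, ⟨k, hk, hw⟩, rfl⟩ | ⟨k, hk, z, hz, rfl⟩)
    · by_cases hkn : k = n.succPNat
      · subst hkn
        obtain ⟨z, hz, hz', e⟩ := exists_outer hw
        exact Or.inl ⟨⟨z, hz'⟩, ofPants_eq_ofEarring_iff.2 ⟨Or.inl hz, e⟩⟩
      · refine Or.inr (Or.inl ⟨w, ⟨k, ?_, hw⟩, rfl⟩)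
        rw [← PNat.coe_inj, Nat.succPNat_coe] at hkn
        omega
    · by_cases hkn : k = n.succPNat
      · subst hkn
        exact Or.inl ⟨z, rfl⟩
      · refine Or.inr (Or.inr ⟨k, hk, z, hz.imp_left fun h => ?_, rfl⟩)
        rw [← PNat.coe_inj, Nat.succPNat_coe] at hkn
        omega
  · rintro (⟨z, rfl⟩ | ⟨w, ⟨k, hk, hw⟩, rfl⟩ | ⟨k, hk, z, hz, rfl⟩)
    · exact Or.inr ⟨_, by rw [Nat.succPNat_coe]; omega, z, Or.inl (by simp), rfl⟩
    · exact Or.inl ⟨w, ⟨k, by omega, hw⟩, rfl⟩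
    · exact Or.inr ⟨k, hk, z, hz.imp_left fun h => by omega, rfl⟩

/-- The outer circle of `P_{n + 1}` is a free face up to real points. Circles and pants of larger
index meet `C (n + 1)` in the base point only. Pants with `C (n + 1)` as an inner boundary have
smaller index, so they are already reduced to their axes, which attach at real points. -/
theorem isSpinal_of_ofPants_mem_stage {n m : ℕ} {z : pants}
    (h : ofPants n.succPNat z ∈ stage (n + 1) m) : IsSpinal z := by
  have key : (z : ℂ) ∈ pantsBoundary → ∀ k : ℕ+, n + 1 < k → attachFun n.succPNat z ∈ C k →
      IsSpinal z := by
    rintro (hz | hz) k hk hzk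
    · left
      refine im_eq_zero_of_attachFun_outer (n := n.succPNat) hz ?_
      rw [eq_zero_of_mem_C (attachFun_mem_of_outer n.succPNat hz) hzk]
      · simp
      · rw [← PNat.coe_inj.ne, Nat.succPNat_coe]
        omega
    · exact Or.inr hz
  rcases mem_stage_iff.1 h with ⟨w, ⟨k, hk, hw⟩, e⟩ | ⟨k, hk, w, hw, e⟩
  · obtain ⟨hz, e'⟩ := ofPants_eq_ofEarring_iff.1 e.symm
    exact key hz k hk (e' ▸ hw)
  · rcases ofPants_eq_ofPants e.symm with ⟨h1, h2⟩ | ⟨h1, h2, h3⟩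
    · subst h1 h2
      left
      refine hw.resolve_left ?_
      simp
    · rcases hw with hw | hw
      · obtain ⟨j, hj, hjw⟩ := exists_attachFun_mem k h2
        rw [← PNat.coe_le_coe] at hj
        exact key h1 j (by omega) (h3 ▸ hjw)
      · rcases h1 with h1 | h1
        · left
          refine im_eq_zero_of_attachFun_outer (n := n.succPNat) h1 ?_
          rw [h3]
          exact attachFun_im_of_im_eq_zero _ hw
        · exact Or.inr h1

theorem ofPants_mem_stage_of_isSpinal {n m : ℕ} (hnm : n < m) {z : pants} (h : IsSpinal z) :
    ofPants n.succPNat z ∈ stage (n + 1) m := by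
  rw [mem_stage_iff]
  rcases h with h | h | h
  · exact Or.inr ⟨_, by rw [Nat.succPNat_coe]; omega, z, Or.inr h, rfl⟩
  · refine Or.inl ⟨_, ⟨_, ?_, attachFun_mem_of_left n.succPNat h⟩,
      (ofPants_eq (Or.inr (Or.inl h))).symm⟩
    rw [PNat.mul_coe, Nat.succPNat_coe]
    simp only [PNat.val_ofNat]
    omega
  · refine Or.inl ⟨_, ⟨_, ?_, attachFun_mem_of_right n.succPNat h⟩,
      (ofPants_eq (Or.inr (Or.inr h))).symm⟩
    rw [PNat.add_coe, PNat.mul_coe, Nat.succPNat_coe]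
    simp only [PNat.val_ofNat]
    omega

theorem attachFun_outer_injOn (n : ℕ+) {z w : ℂ} (hz : z ∈ sphere (0 : ℂ) 4)
    (hw : w ∈ sphere (0 : ℂ) 4) (h : attachFun n z = attachFun n w) : z = w := by
  rw [attachFun_of_outer n hz, attachFun_of_outer n hw] at h
  have hn : (1 / (n : ℂ)) ≠ 0 := one_div_ne_zero (by exact_mod_cast n.pos.ne')
  have := mul_left_cancel₀ hn h
  linear_combination 4 * this

/-- Points of a pair of pants that become equal are equal or lie on the spine. -/
theorem eq_or_isSpinal {n : ℕ+} {z w : pants} (h : ofPants n z = ofPants n w) :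
    z = w ∨ IsSpinal z := by
  rcases ofPants_eq_ofPants h with ⟨-, h⟩ | ⟨h1, h2, h3⟩
  · exact Or.inl h
  · rcases h1 with h1 | h1
    · rcases h2 with h2 | h2
      · exact Or.inl (Subtype.ext (attachFun_outer_injOn n h1 h2 h3))
      · right; left
        refine im_eq_zero_of_attachFun_outer (n := n) h1 ?_
        have h4 := attachFun_mem_of_outer n h1
        rcases h2 with h2 | h2
        · rw [eq_zero_of_mem_C h4 (h3 ▸ attachFun_mem_of_left n h2)]
          · simp
          · rw [← PNat.coe_inj.ne]
            have := n.pos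
            push_cast
            omega
        · rw [eq_zero_of_mem_C h4 (h3 ▸ attachFun_mem_of_right n h2)]
          · simp
          · rw [← PNat.coe_inj.ne]
            have := n.pos
            push_cast
            omega
    · exact Or.inr (Or.inr h1)

theorem continuousOn_range_of_comp {X Y Z : Type*} [TopologicalSpace X] [TopologicalSpace Y]
    [TopologicalSpace Z] {j : X → Y} (hj : IsClosedMap j) {f : Y → Z}
    (h : Continuous (f ∘ j)) : ContinuousOn f (Set.range j) := by
  rw [continuousOn_iff_isClosed]
  intro t ht
  refine ⟨_, hj _ (ht.preimage h), ?_⟩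
  ext y
  constructor
  · rintro ⟨hy, x, rfl⟩
    exact ⟨⟨x, hy, rfl⟩, x, rfl⟩
  · rintro ⟨⟨x, hx, rfl⟩, hr⟩
    exact ⟨hx, hr⟩

open Classical in
/-- The deformation of the stages that moves the `n`-th pair of pants only. -/
noncomputable def deform (n : ℕ+) (x : Space) : C(I, Space) :=
  if h : ∃ z, ofPants n z = x then clampPants n h.choose else ContinuousMap.const I x

/-- The choice of a preimage is harmless: distinct points of a pair of pants with the same image lie
on the spine and do not move. -/
theorem deform_ofPants (n : ℕ+) (z : pants) : deform n (ofPants n z) = clampPants n z := by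
  have h : ∃ w, ofPants n w = ofPants n z := ⟨z, rfl⟩
  rw [deform, dif_pos h]
  have h1 := h.choose_spec
  rcases eq_or_isSpinal h1 with h2 | h2
  · rw [h2]
  · rcases eq_or_isSpinal h1.symm with h3 | h3
    · rw [← h3]
    · rw [clampPants_of_isSpinal n h2, clampPants_of_isSpinal n h3, h1]

theorem deform_of_mem {n m : ℕ} {x : Space} (h : x ∈ stage (n + 1) m) :
    deform n.succPNat x = ContinuousMap.const I x := by
  by_cases hx : ∃ z, ofPants n.succPNat z = x
  · obtain ⟨z, rfl⟩ := hx
    rw [deform_ofPants, clampPants_of_isSpinal _ (isSpinal_of_ofPants_mem_stage h)]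
  · exact dif_neg hx

/-- With values in the path space `C(I, Space)`, continuity can be checked on two closed pieces,
without products of the quotient map with the interval. -/
theorem continuousOn_deform {n m : ℕ} (h : n < m) :
    ContinuousOn (deform n.succPNat) (stage n m) := by
  rw [stage_eq h]
  refine ContinuousOn.union_of_isClosed ?_ ?_ (isClosedMap_ofPants _).isClosed_range
    (isClosed_stage _ _)
  · refine continuousOn_range_of_comp (isClosedMap_ofPants _) ?_
    convert (clampPants n.succPNat).continuous using 1
    ext1 z
    exact deform_ofPants _ z
  · exact ContinuousOn.congr (ContinuousMap.continuous_const'.continuousOn)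
      fun x hx => deform_of_mem hx

theorem deform_zero (n : ℕ+) (x : Space) : deform n x 0 = x := by
  by_cases hx : ∃ z, ofPants n z = x
  · obtain ⟨z, rfl⟩ := hx
    rw [deform_ofPants, clampPants_apply]
    congr 1
    exact Subtype.ext (clamp_zero _)
  · rw [deform, dif_neg hx, ContinuousMap.const_apply]

theorem deform_mem {n m : ℕ} (h : n < m) {x : Space} (hx : x ∈ stage n m) (s : I) :
    deform n.succPNat x s ∈ stage n m := by
  rw [stage_eq h] at hx ⊢
  rcases hx with ⟨z, rfl⟩ | hx
  · rw [deform_ofPants]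
    exact Or.inl ⟨_, rfl⟩
  · rw [deform_of_mem hx]
    exact Or.inr hx

theorem deform_one_mem {n m : ℕ} (h : n < m) {x : Space} (hx : x ∈ stage n m) :
    deform n.succPNat x 1 ∈ stage (n + 1) m := by
  rw [stage_eq h] at hx
  rcases hx with ⟨z, rfl⟩ | hx
  · rw [deform_ofPants]
    exact ofPants_mem_stage_of_isSpinal h (isSpinal_clamp_one z.2)
  · rw [deform_of_mem hx]
    exact hx

/-- A map `r` such that `i ∘ r` is homotopic to the identity relative to the base point is
injective on the fundamental group. -/
theorem fundamentalGroup_map_injective {X Y : Type} [TopologicalSpace X] [TopologicalSpace Y]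
    (r : C(X, Y)) (i : C(Y, X)) {x : X} (hx : i (r x) = x)
    (F : ContinuousMap.HomotopyRel (ContinuousMap.id X) (i.comp r) {x}) :
    Function.Injective (FundamentalGroup.map r x) := by
  rw [injective_iff_map_eq_one]
  intro p hp
  induction p using Path.Homotopic.Quotient.ind with | mk γ =>
  obtain ⟨G⟩ : (γ.map r.continuous).Homotopic (Path.refl (r x)) :=
    Path.Homotopic.Quotient.eq.1 hp
  refine Path.Homotopic.Quotient.eq.2 ?_
  have h1 : γ.Homotopic ((γ.map (i.comp r).continuous).cast hx.symm hx.symm) :=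
    ⟨{ toFun := fun p => F (p.1, γ p.2)
       continuous_toFun := by fun_prop
       map_zero_left := fun t => by simp
       map_one_left := fun t => by simp
       prop' := fun t u hu => by
        rcases hu with rfl | rfl
        · simpa using F.eq_fst t (show γ 0 ∈ ({x} : Set X) by simp)
        · simpa using F.eq_fst t (show γ 1 ∈ ({x} : Set X) by simp) }⟩
  refine h1.trans
    ⟨{ toFun := fun p => i (G p)
       continuous_toFun := by fun_prop
       map_zero_left := fun t => by simp
       map_one_left := fun t => by simp [hx]
       prop' := fun t u hu => by
        rcases hu with rfl | rfl <;> simp [hx] }⟩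

/-- The fundamental group of a stage embeds into the fundamental group of the next one. -/
theorem isLocallyFree_stage_of_succ {n m : ℕ} (h : n < m)
    (H : IsLocallyFree (FundamentalGroup (stage (n + 1) m) ⟨basePoint, basePoint_mem_stage _ _⟩)) :
    IsLocallyFree (FundamentalGroup (stage n m) ⟨basePoint, basePoint_mem_stage _ _⟩) := by
  have hc : Continuous fun x : stage n m => deform n.succPNat x :=
    continuousOn_iff_continuous_domRestrict.1 (continuousOn_deform h)
  let r : C(stage n m, stage (n + 1) m) :=
    ⟨fun x => ⟨deform n.succPNat x 1, deform_one_mem h x.2⟩, by fun_prop⟩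
  have hsub : stage (n + 1) m ⊆ stage n m := by
    rw [stage_eq h]
    exact Set.subset_union_right
  let i : C(stage (n + 1) m, stage n m) := ⟨Set.inclusion hsub, continuous_inclusion hsub⟩
  have hb : r ⟨basePoint, basePoint_mem_stage _ _⟩ = ⟨basePoint, basePoint_mem_stage _ _⟩ :=
    Subtype.ext (by simp [r, deform_of_mem (basePoint_mem_stage (n + 1) m)])
  refine IsLocallyFree.of_injective (by rw [hb]; exact H) _ (fundamentalGroup_map_injective r i
    (x := ⟨basePoint, basePoint_mem_stage _ _⟩) (by rw [hb]; rfl)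
    { toFun := fun p => ⟨deform n.succPNat p.2 p.1, deform_mem h p.2.2 p.1⟩
      continuous_toFun := ((hc.comp continuous_snd).eval continuous_fst).subtype_mk _
      map_zero_left := fun x => Subtype.ext (deform_zero _ _)
      map_one_left := fun x => rfl
      prop' := fun t x hx => by
        obtain rfl : x = _ := hx
        exact Subtype.ext (by simp [deform_of_mem (basePoint_mem_stage (n + 1) m)]) })

/-! ### Edge and vertex functions on the one-dimensional part -/

/-- A family of functions indexed by an encodable type that is graph like after encoding. -/
theorem isGraphLike_of_encodable {Y : Type} [TopologicalSpace Y] {ι : Type} [Encodable ι]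
    (c : ι → C(Y, UnitAddCircle)) (disj : ∀ y i j, c i y ≠ 0 → c j y ≠ 0 → i = j)
    (sep : ∀ y y', y ≠ y' → ∃ (ψ : C(Y, UnitAddCircle)) (q : ℕ), q ≠ 0 ∧
      q • ψ ∈ Submodule.span ℤ (Set.range c) ∧ ψ y ≠ ψ y') :
    IsGraphLike Y fun n => (Encodable.decode₂ ι n).elim 0 c := by
  -- `decode₂` accepts only the canonical code of each edge, so no edge is listed twice; other
  -- indices carry the function `0`.
  refine ⟨fun y i j hi hj => ?_, fun y y' h => ?_⟩
  · have key : ∀ n, ((Encodable.decode₂ ι n).elim 0 c) y ≠ 0 →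
        ∃ a, Encodable.decode₂ ι n = some a ∧ c a y ≠ 0 := by
      intro n hn
      cases h : Encodable.decode₂ ι n with
      | none => simp [h] at hn
      | some a => exact ⟨a, rfl, by simpa [h] using hn⟩
    obtain ⟨a, ha, ha'⟩ := key i hi
    obtain ⟨b, hb, hb'⟩ := key j hj
    have hab := disj y a b ha' hb'
    rw [← Encodable.mem_decode₂.1 ha, ← Encodable.mem_decode₂.1 hb, hab]
  · obtain ⟨ψ, q, hq, hψ, hne⟩ := sep y y' h
    obtain ⟨a, ha⟩ := (Finsupp.mem_span_range_iff_exists_finsupp).1 hψ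
    refine ⟨ψ, q, a.support.map ⟨Encodable.encode, Encodable.encode_injective⟩,
      fun n => (Encodable.decode₂ ι n).elim 0 a, hq, fun u => ?_, hne⟩
    rw [Finset.sum_map]
    have := congrArg (fun f : C(Y, UnitAddCircle) => f u) ha
    simp only [Finsupp.sum, ContinuousMap.sum_apply] at this
    simpa using this.symm

theorem IsGraphLike.comp_injective {Y Y' : Type} [TopologicalSpace Y] [TopologicalSpace Y']
    {c : ℕ → C(Y, UnitAddCircle)} (hY : IsGraphLike Y c) (f : C(Y', Y))
    (hf : Function.Injective f) : IsGraphLike Y' fun n => (c n).comp f := by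
  refine ⟨fun y i j hi hj => hY.disj (f y) i j hi hj, fun y y' h => ?_⟩
  obtain ⟨ψ, q, S, n, hq, h1, h2⟩ := hY.sep _ _ (hf.ne h)
  exact ⟨ψ.comp f, q, S, n, hq, fun u => h1 (f u), h2⟩

/-- The union of the earring and of the real axes of all pants. -/
def graph : Set Space := {x | (∃ h, ofEarring h = x) ∨
  ∃ k, ∃ z : pants, (z : ℂ).im = 0 ∧ ofPants k z = x}

theorem stage_subset_graph (m : ℕ) : stage m m ⊆ graph := by
  intro x hx
  rcases mem_stage_iff.1 hx with ⟨h, -, rfl⟩ | ⟨k, hk, z, hz, rfl⟩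
  · exact Or.inl ⟨h, rfl⟩
  · exact Or.inr ⟨k, z, hz.resolve_left (by omega), rfl⟩

theorem graph_cases (y : graph) : (∃ h, y.1 = ofEarring h) ∨
    ∃ k, ∃ z : pants, (z : ℂ).im = 0 ∧ (z : ℂ) ∉ pantsBoundary ∧ y.1 = ofPants k z := by
  rcases y.2 with ⟨h, e⟩ | ⟨k, z, hz, e⟩
  · exact Or.inl ⟨h, e.symm⟩
  · by_cases hz' : (z : ℂ) ∈ pantsBoundary
    · exact Or.inl ⟨_, e.symm.trans (ofPants_eq hz')⟩
    · exact Or.inr ⟨k, z, hz, hz', e.symm⟩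

/-- A continuous function on the graph from functions on the earring and on the axes. -/
noncomputable def graphMap {T : Type} [TopologicalSpace T] (φ : C(earring, T)) (g : ℕ+ → C(ℝ, T))
    (H : ∀ k, ∀ z : pants, ∀ hz : (z : ℂ) ∈ pantsBoundary, (z : ℂ).im = 0 →
      g k (z : ℂ).re = φ ⟨attachFun k z, attachFun_mem hz⟩) : C(graph, T) where
  toFun x := glueFun φ (fun k z => g k (z : ℂ).re) x.1
  continuous_toFun := by
    suffices h : ContinuousOn (glueFun φ fun k z => g k (z : ℂ).re) graph from
      continuousOn_iff_continuous_domRestrict.1 h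
    refine continuousOn_iff_isClosed.2 fun t ht =>
      ⟨(glueFun φ fun k z => g k (z : ℂ).re) ⁻¹' t ∩ graph, ?_, by
        rw [Set.inter_assoc, Set.inter_self]⟩
    rw [isClosed_iff]
    refine ⟨?_, fun k => ?_⟩
    · convert ht.preimage φ.continuous using 1
      ext h
      exact and_iff_left (Or.inl ⟨h, rfl⟩)
    · have h1 : IsClosed {z : pants | (z : ℂ).im = 0 ∧ g k (z : ℂ).re ∈ t} :=
        (isClosed_eq (by fun_prop) continuous_const).inter
          (ht.preimage (f := fun z : pants => g k (z : ℂ).re) (by fun_prop))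
      convert (isClosed_boundary_preimage (ht.preimage φ.continuous) k).union h1 using 1
      ext z
      by_cases hz : (z : ℂ) ∈ pantsBoundary
      · have hg : ofPants k z ∈ graph := by
          rw [ofPants_eq hz]
          exact Or.inl ⟨_, rfl⟩
        rw [Set.mem_preimage, Set.mem_inter_iff, and_iff_left hg, Set.mem_preimage,
          ofPants_eq hz, glueFun_ofEarring]
        constructor
        · exact fun h => Or.inl ⟨hz, h⟩
        · rintro (⟨_, h⟩ | ⟨h1, h2⟩)
          · exact h
          · rwa [H k z hz h1] at h2
      · rw [Set.mem_preimage, Set.mem_inter_iff, Set.mem_preimage, glueFun_ofPants _ _ hz]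
        constructor
        · rintro ⟨h1, ⟨h, e⟩ | ⟨j, w, hw, e⟩⟩
          · exact absurd (ofPants_eq_ofEarring_iff.1 e.symm).1 hz
          · rcases ofPants_eq_ofPants e.symm with ⟨-, rfl⟩ | ⟨h, -⟩
            · exact Or.inr ⟨hw, h1⟩
            · exact absurd h hz
        · rintro (⟨h, -⟩ | ⟨h1, h2⟩)
          · exact absurd h hz
          · exact ⟨h2, Or.inr ⟨k, z, h1, rfl⟩⟩

section graphMap

variable {T : Type} [TopologicalSpace T] {φ : C(earring, T)} {g : ℕ+ → C(ℝ, T)}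
    {H : ∀ k, ∀ z : pants, ∀ hz : (z : ℂ) ∈ pantsBoundary, (z : ℂ).im = 0 →
      g k (z : ℂ).re = φ ⟨attachFun k z, attachFun_mem hz⟩} {y : graph}

theorem graphMap_of_earring {h : earring} (e : y.1 = ofEarring h) : graphMap φ g H y = φ h := by
  change glueFun φ (fun k (z : pants) => g k (z : ℂ).re) y.1 = _
  rw [e, glueFun_ofEarring]

theorem graphMap_of_pants {k : ℕ+} {z : pants} (hz : (z : ℂ) ∉ pantsBoundary)
    (e : y.1 = ofPants k z) : graphMap φ g H y = g k (z : ℂ).re := by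
  change glueFun φ (fun k (z : pants) => g k (z : ℂ).re) y.1 = _
  rw [e, glueFun_ofPants _ _ hz]

end graphMap

/-- The point of `C k` opposite to the base point. -/
noncomputable def apex (k : ℕ+) : earring := ⟨((2 / k : ℝ) : ℂ), Set.mem_iUnion.2 ⟨k, by
  rw [mem_C_iff, Complex.ofReal_re, Complex.ofReal_im]
  field_simp
  ring⟩⟩

theorem apex_mem (k : ℕ+) : (apex k : ℂ) ∈ C k := by
  rw [mem_C_iff, apex, Complex.ofReal_re, Complex.ofReal_im]
  field_simp
  ring

/-- The real points of the boundary of a pair of pants. -/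
theorem real_boundary_cases (k : ℕ+) {z : ℂ} (hz : z ∈ pantsBoundary) (h : z.im = 0) :
    ((z.re = -4 ∨ z.re = -3 ∨ z.re = 1) ∧ attachFun k z = 0) ∨
    (z.re = -1 ∧ attachFun k z = apex (2 * k)) ∨ (z.re = 3 ∧ attachFun k z = apex (2 * k + 1)) ∨
    (z.re = 4 ∧ attachFun k z = apex k) := by
  obtain ⟨x, y⟩ := z
  obtain rfl : y = 0 := h
  rw [show (⟨x, 0⟩ : ℂ) = x from rfl] at hz ⊢
  simp only [Complex.ofReal_re]
  rcases hz with hz | hz | hz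
  · have hz' := hz
    rw [mem_outer_iff, Complex.ofReal_re, Complex.ofReal_im] at hz'
    have : (x - 4) * (x + 4) = 0 := by linarith
    rw [attachFun_of_outer k hz]
    rcases mul_eq_zero.1 this with h | h
    · obtain rfl : x = 4 := by linarith
      refine Or.inr (Or.inr (Or.inr ⟨rfl, ?_⟩))
      simp [apex]
      ring
    · obtain rfl : x = -4 := by linarith
      refine Or.inl ⟨Or.inl rfl, ?_⟩
      norm_num
  · have hz' := hz
    rw [mem_left_iff, Complex.ofReal_re, Complex.ofReal_im] at hz'
    have : (x + 1) * (x + 3) = 0 := by linarith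
    rw [attachFun_of_left k hz]
    rcases mul_eq_zero.1 this with h | h
    · obtain rfl : x = -1 := by linarith
      refine Or.inr (Or.inl ⟨rfl, ?_⟩)
      simp [apex]
      ring
    · obtain rfl : x = -3 := by linarith
      refine Or.inl ⟨Or.inr (Or.inl rfl), ?_⟩
      norm_num
  · have hz' := hz
    rw [mem_right_iff, Complex.ofReal_re, Complex.ofReal_im] at hz'
    have : (x - 3) * (x - 1) = 0 := by linarith
    rw [attachFun_of_right k hz]
    rcases mul_eq_zero.1 this with h | h
    · obtain rfl : x = 3 := by linarith
      refine Or.inr (Or.inr (Or.inl ⟨rfl, ?_⟩))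
      simp [apex]
      ring
    · obtain rfl : x = 1 := by linarith
      refine Or.inl ⟨Or.inr (Or.inr rfl), ?_⟩
      norm_num

/-- The retraction of the line onto the unit interval. -/
noncomputable def unitClamp (s : ℝ) : ℝ := max 0 (min 1 s)

@[fun_prop]
theorem continuous_unitClamp : Continuous unitClamp := by unfold unitClamp; fun_prop

theorem unitClamp_of_nonpos {s : ℝ} (h : s ≤ 0) : unitClamp s = 0 :=
  max_eq_left ((min_le_right _ _).trans h)

theorem unitClamp_of_one_le {s : ℝ} (h : 1 ≤ s) : unitClamp s = 1 := by
  rw [unitClamp, min_eq_left h, max_eq_right zero_le_one]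

theorem unitClamp_of_mem {s : ℝ} (h : 0 ≤ s) (h' : s ≤ 1) : unitClamp s = s := by
  rw [unitClamp, min_eq_right h', max_eq_right h]

theorem coe_one : ((1 : ℝ) : UnitAddCircle) = 0 := AddCircle.coe_period 1

theorem coe_unitClamp {s : ℝ} (h : s ≤ 0 ∨ 1 ≤ s) : (unitClamp s : UnitAddCircle) = 0 := by
  rcases h with h | h
  · rw [unitClamp_of_nonpos h, AddCircle.coe_zero]
  · rw [unitClamp_of_one_le h, coe_one]

theorem mem_Ioo_of_coe_unitClamp_ne_zero {s : ℝ} (h : (unitClamp s : UnitAddCircle) ≠ 0) :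
    0 < s ∧ s < 1 := by
  by_contra! h'
  refine h (coe_unitClamp ?_)
  by_cases h0 : 0 < s
  · exact Or.inr (h' h0)
  · exact Or.inl (not_lt.1 h0)

theorem eq_of_coe_eq {s t : ℝ} (hs : 0 ≤ s ∧ s < 1) (ht : 0 ≤ t ∧ t < 1)
    (h : (s : UnitAddCircle) = t) : s = t := by
  have : Fact ((0 : ℝ) < 1) := ⟨one_pos⟩
  exact (AddCircle.coe_eq_coe_iff_of_mem_Ico (p := 1) (a := 0) (by simpa using hs)
    (by simpa using ht)).1 h

/-- Parameters on the three segments of the real axis of a pair of pants. -/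
noncomputable def axisParam (i : Fin 3) (t : ℝ) : ℝ := ![t + 4, (t + 1) / 2, t - 3] i

@[fun_prop]
theorem continuous_axisParam (i : Fin 3) : Continuous (axisParam i) := by
  unfold axisParam
  fin_cases i <;> simp <;> fun_prop

theorem axisParam_injective (i : Fin 3) : Function.Injective (axisParam i) := by
  intro s t h
  fin_cases i <;> simp [axisParam] at h <;> linarith

theorem axisParam_disjoint {i j : Fin 3} {t : ℝ} (hi : 0 < axisParam i t ∧ axisParam i t < 1)
    (hj : 0 < axisParam j t ∧ axisParam j t < 1) : i = j := by
  fin_cases i <;> fin_cases j <;> simp [axisParam] at hi hj ⊢ <;> linarith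

theorem exists_axisParam_mem {z : ℂ} (hz : z ∈ pants) (hz' : z ∉ pantsBoundary) (h : z.im = 0) :
    ∃ i, 0 < axisParam i z.re ∧ axisParam i z.re < 1 := by
  rw [mem_pants_iff] at hz
  have h1 : z.re ^ 2 + z.im ^ 2 ≠ 16 := fun h => hz' (Or.inl (mem_outer_iff.2 h))
  have h2 : (z.re + 2) ^ 2 + z.im ^ 2 ≠ 1 := fun h => hz' (Or.inr (Or.inl (mem_left_iff.2 h)))
  have h3 : (z.re - 2) ^ 2 + z.im ^ 2 ≠ 1 := fun h => hz' (Or.inr (Or.inr (mem_right_iff.2 h)))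
  rw [h] at hz h1 h2 h3
  have e1 := lt_of_le_of_ne hz.1 h1
  have e2 := lt_of_le_of_ne hz.2.1 h2.symm
  have e3 := lt_of_le_of_ne hz.2.2 h3.symm
  by_cases c1 : z.re < -2
  · exact ⟨0, by simp only [axisParam]; constructor <;> simp <;> nlinarith⟩
  · by_cases c2 : z.re < 2
    · exact ⟨1, by simp only [axisParam]; constructor <;> simp <;> nlinarith⟩
    · exact ⟨2, by simp only [axisParam]; constructor <;> simp <;> nlinarith⟩

theorem coe_unitClamp_axisParam_boundary {z : ℂ} (hz : z ∈ pantsBoundary) (h : z.im = 0)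
    (i : Fin 3) : (unitClamp (axisParam i z.re) : UnitAddCircle) = 0 := by
  apply coe_unitClamp
  rcases real_boundary_cases 1 hz h with ⟨h | h | h, -⟩ | ⟨h, -⟩ | ⟨h, -⟩ | ⟨h, -⟩ <;> rw [h] <;>
    fin_cases i <;> norm_num [axisParam]

/-- The circle valued function of a segment of the axis of a pair of pants. -/
noncomputable def axisMap (j : ℕ+) (i : Fin 3) : C(graph, UnitAddCircle) :=
  graphMap 0 (fun k => if k = j then
      ⟨fun t => (unitClamp (axisParam i t) : UnitAddCircle), by
        exact continuous_quotient_mk'.comp (by fun_prop)⟩ else 0) <| by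
    intro k z hz h
    split_ifs
    · exact coe_unitClamp_axisParam_boundary hz h i
    · rfl

theorem axisMap_of_earring {y : graph} {h : earring} (e : y.1 = ofEarring h) (j : ℕ+) (i : Fin 3) :
    axisMap j i y = 0 := graphMap_of_earring e

theorem axisMap_of_pants {y : graph} {k : ℕ+} {z : pants} (hz : (z : ℂ) ∉ pantsBoundary)
    (e : y.1 = ofPants k z) (j : ℕ+) (i : Fin 3) : axisMap j i y =
      if k = j then (unitClamp (axisParam i (z : ℂ).re) : UnitAddCircle) else 0 := by
  rw [axisMap, graphMap_of_pants hz e]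
  split_ifs <;> rfl

/-- The curvature of the circle through `h`, which is `k` on `C k` away from the base point. -/
noncomputable def curvature (h : earring) : ℝ :=
  2 * (h : ℂ).re / ((h : ℂ).re ^ 2 + (h : ℂ).im ^ 2)

/-- A function on the earring that is linear on `C k` and vanishes on the other circles. -/
noncomputable def bump (k : ℕ+) (h : earring) : ℝ :=
  k * (h : ℂ).re / 2 * max 0 (1 - |curvature h - k|)

theorem sq_add_sq_pos {z : ℂ} (h : z ≠ 0) : 0 < z.re ^ 2 + z.im ^ 2 := by
  have := Complex.normSq_pos.2 h
  rw [Complex.normSq_apply] at this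
  nlinarith

theorem curvature_of_mem {k : ℕ+} {h : earring} (hk : (h : ℂ) ∈ C k) (h0 : (h : ℂ) ≠ 0) :
    curvature h = k := by
  rw [mem_C_iff] at hk
  rw [curvature, ← hk, mul_div_cancel_right₀ _ (sq_add_sq_pos h0).ne']

theorem bump_zero (k : ℕ+) {h : earring} (h0 : (h : ℂ) = 0) : bump k h = 0 := by
  simp [bump, h0]

theorem bump_of_mem {k : ℕ+} {h : earring} (hk : (h : ℂ) ∈ C k) :
    bump k h = k * (h : ℂ).re / 2 := by
  by_cases h0 : (h : ℂ) = 0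
  · rw [bump_zero k h0, h0]; simp
  · rw [bump, curvature_of_mem hk h0]; simp

theorem bump_of_mem_of_ne {k j : ℕ+} {h : earring} (hj : (h : ℂ) ∈ C j) (hne : j ≠ k) :
    bump k h = 0 := by
  by_cases h0 : (h : ℂ) = 0
  · exact bump_zero k h0
  · rw [bump, curvature_of_mem hj h0, max_eq_left, mul_zero]
    have h1 : ((j : ℕ) : ℤ) ≠ (k : ℕ) := by exact_mod_cast hne
    have h2 : (1 : ℝ) ≤ |((j : ℕ) : ℝ) - (k : ℕ)| := by
      exact_mod_cast Int.one_le_abs (sub_ne_zero.2 h1)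
    linarith

/-- The curvature is discontinuous at the base point only, and there the factor `re` tends to `0`
while the cutoff stays bounded. -/
theorem continuous_bump (k : ℕ+) : Continuous (bump k) := by
  rw [continuous_iff_continuousAt]
  intro h
  by_cases h0 : (h : ℂ) = 0
  · rw [ContinuousAt, bump_zero k h0]
    refine squeeze_zero_norm (a := fun h : earring => |k * (h : ℂ).re / 2|) (fun h => ?_) ?_
    · rw [bump, Real.norm_eq_abs, abs_mul]
      refine mul_le_of_le_one_right (abs_nonneg _) ?_
      rw [abs_of_nonneg (le_max_left _ _)]
      exact max_le zero_le_one (by linarith [abs_nonneg (curvature h - k)])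
    · have : Continuous fun h : earring => |k * (h : ℂ).re / 2| := by fun_prop
      simpa [h0] using this.tendsto h
  · have h1 : ContinuousAt curvature h := by
      refine ContinuousAt.div (by fun_prop) (by fun_prop) (sq_add_sq_pos h0).ne'
    unfold bump
    fun_prop

theorem bump_mem (k : ℕ+) (h : earring) : 0 ≤ bump k h ∧ bump k h ≤ 1 := by
  obtain ⟨j, hj⟩ := Set.mem_iUnion.1 h.2
  by_cases hjk : j = k
  · subst hjk
    rw [bump_of_mem hj]
    rw [mem_C_iff] at hj
    have hk : (0 : ℝ) < j := by exact_mod_cast j.pos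
    have h1 : 0 ≤ (h : ℂ).re := by nlinarith [sq_nonneg (h : ℂ).re, sq_nonneg (h : ℂ).im]
    refine ⟨by positivity, ?_⟩
    by_contra! h2
    have h3 : 0 < (h : ℂ).re := by
      refine lt_of_le_of_ne h1 fun e => ?_
      rw [← e] at h2
      simp at h2
      linarith
    have h4 : 0 < (h : ℂ).re * (j * (h : ℂ).re - 2) := mul_pos h3 (by linarith)
    have h5 : 0 ≤ (j : ℝ) * (h : ℂ).im ^ 2 := by positivity
    linarith
  · rw [bump_of_mem_of_ne hj hjk]
    simp

theorem bump_of_im_eq_zero (k : ℕ+) {h : earring} (h0 : (h : ℂ).im = 0) :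
    bump k h = 0 ∨ bump k h = 1 := by
  obtain ⟨j, hj⟩ := Set.mem_iUnion.1 h.2
  by_cases hjk : j = k
  · subst hjk
    rw [bump_of_mem hj]
    rw [mem_C_iff, h0] at hj
    have : (h : ℂ).re * (j * (h : ℂ).re - 2) = 0 := by linarith
    rcases mul_eq_zero.1 this with h1 | h1
    · left; rw [h1]; simp
    · right; linarith
  · exact Or.inl (bump_of_mem_of_ne hj hjk)

theorem coe_bump_of_im_eq_zero (k : ℕ+) {h : earring} (h0 : (h : ℂ).im = 0) :
    (bump k h : UnitAddCircle) = 0 := by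
  rcases bump_of_im_eq_zero k h0 with e | e <;> rw [e]
  · rfl
  · exact coe_one

theorem bump_apex (k j : ℕ+) : bump k (apex j) = if j = k then 1 else 0 := by
  split_ifs with h
  · subst h
    rw [bump_of_mem (apex_mem j), apex, Complex.ofReal_re]
    field_simp
  · exact bump_of_mem_of_ne (apex_mem j) h

/-- The sign that distinguishes the upper half of a circle from the lower half. -/
def halfSign (b : Bool) : ℝ := if b then 1 else -1

/-- The circle valued function of one half of the circle `C k`. -/
noncomputable def halfMap (k : ℕ+) (b : Bool) : C(graph, UnitAddCircle) :=
  graphMap ⟨fun h => if 0 ≤ halfSign b * (h : ℂ).im then (bump k h : UnitAddCircle) else 0, by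
      refine Continuous.if_le (continuous_quotient_mk'.comp (continuous_bump k)) continuous_const
        continuous_const (by fun_prop) fun h e => coe_bump_of_im_eq_zero k ?_
      refine (mul_eq_zero.1 e.symm).resolve_left ?_
      cases b <;> simp [halfSign]⟩ 0 <| by
    intro j z hz h
    have h1 : (attachFun j z).im = 0 := attachFun_im_of_im_eq_zero j h
    simp [h1, coe_bump_of_im_eq_zero k (h := ⟨attachFun j z, attachFun_mem hz⟩) h1]

theorem halfMap_of_earring {y : graph} {h : earring} (e : y.1 = ofEarring h) (k : ℕ+) (b : Bool) :
    halfMap k b y = if 0 ≤ halfSign b * (h : ℂ).im then (bump k h : UnitAddCircle) else 0 :=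
  graphMap_of_earring e

theorem halfMap_of_pants {y : graph} {k : ℕ+} {z : pants} (hz : (z : ℂ) ∉ pantsBoundary)
    (e : y.1 = ofPants k z) (j : ℕ+) (b : Bool) : halfMap j b y = 0 :=
  graphMap_of_pants hz e

/-- The edges of the graph: the segments of the axes and the halves of the circles. -/
noncomputable def edgeMap : (ℕ+ × Fin 3) ⊕ (ℕ+ × Bool) → C(graph, UnitAddCircle) :=
  Sum.elim (fun p => axisMap p.1 p.2) fun p => halfMap p.1 p.2

theorem axisMap_ne_zero {y : graph} {j : ℕ+} {i : Fin 3} (h : axisMap j i y ≠ 0) :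
    ∃ z : pants, (z : ℂ).im = 0 ∧ (z : ℂ) ∉ pantsBoundary ∧ y.1 = ofPants j z ∧
      0 < axisParam i (z : ℂ).re ∧ axisParam i (z : ℂ).re < 1 ∧
      axisMap j i y = (axisParam i (z : ℂ).re : UnitAddCircle) := by
  rcases graph_cases y with ⟨w, e⟩ | ⟨k, z, hz, hz', e⟩
  · exact absurd (axisMap_of_earring e j i) h
  · rw [axisMap_of_pants hz' e] at h ⊢
    split_ifs at h ⊢ with hk
    · subst hk
      have h1 := mem_Ioo_of_coe_unitClamp_ne_zero h
      exact ⟨z, hz, hz', e, h1.1, h1.2, by rw [unitClamp_of_mem h1.1.le h1.2.le]⟩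
    · exact absurd rfl h

theorem mem_C_of_bump_ne_zero {k : ℕ+} {h : earring} (hb : bump k h ≠ 0) : (h : ℂ) ∈ C k := by
  obtain ⟨j, hj⟩ := Set.mem_iUnion.1 h.2
  by_cases hjk : j = k
  · rwa [← hjk]
  · exact absurd (bump_of_mem_of_ne hj hjk) hb

theorem halfMap_ne_zero {y : graph} {k : ℕ+} {b : Bool} (h : halfMap k b y ≠ 0) :
    ∃ w : earring, (w : ℂ) ∈ C k ∧ y.1 = ofEarring w ∧ 0 < halfSign b * (w : ℂ).im ∧
      0 < bump k w ∧ bump k w < 1 ∧ halfMap k b y = (bump k w : UnitAddCircle) := by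
  rcases graph_cases y with ⟨w, e⟩ | ⟨k', z, hz, hz', e⟩
  · rw [halfMap_of_earring e] at h ⊢
    split_ifs at h ⊢ with hs
    · have h1 : bump k w ≠ 0 := fun h0 => h (by rw [h0]; rfl)
      have h2 : bump k w ≠ 1 := fun h0 => h (by rw [h0]; exact coe_one)
      refine ⟨w, mem_C_of_bump_ne_zero h1, e, lt_of_le_of_ne hs fun h0 => ?_,
        lt_of_le_of_ne (bump_mem k w).1 h1.symm, lt_of_le_of_ne (bump_mem k w).2 h2, rfl⟩
      refine h (coe_bump_of_im_eq_zero k ((mul_eq_zero.1 h0.symm).resolve_left ?_))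
      cases b <;> simp [halfSign]
    · exact absurd rfl h
  · exact absurd (halfMap_of_pants hz' e k b) h

theorem edgeMap_disjoint (y : graph) (e e' : (ℕ+ × Fin 3) ⊕ (ℕ+ × Bool)) (h : edgeMap e y ≠ 0)
    (h' : edgeMap e' y ≠ 0) : e = e' := by
  rcases e with ⟨j, i⟩ | ⟨k, b⟩ <;> rcases e' with ⟨j', i'⟩ | ⟨k', b'⟩
  · obtain ⟨z, h1, h2, h3, h4, h5, -⟩ := axisMap_ne_zero h
    obtain ⟨z', h1', h2', h3', h4', h5', -⟩ := axisMap_ne_zero h'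
    rcases ofPants_eq_ofPants (h3.symm.trans h3') with ⟨rfl, rfl⟩ | ⟨h6, -⟩
    · have hi : i = i' := axisParam_disjoint ⟨h4, h5⟩ ⟨h4', h5'⟩
      rw [hi]
    · exact absurd h6 h2
  · obtain ⟨z, h1, h2, h3, -⟩ := axisMap_ne_zero h
    obtain ⟨w, -, h4, -⟩ := halfMap_ne_zero h'
    exact absurd (ofPants_eq_ofEarring_iff.1 (h3.symm.trans h4)).1 h2
  · obtain ⟨z, h1, h2, h3, -⟩ := axisMap_ne_zero h'
    obtain ⟨w, -, h4, -⟩ := halfMap_ne_zero h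
    exact absurd (ofPants_eq_ofEarring_iff.1 (h3.symm.trans h4)).1 h2
  · obtain ⟨w, h1, h2, h3, h4, h5, -⟩ := halfMap_ne_zero h
    obtain ⟨w', h1', h2', h3', h4', h5', -⟩ := halfMap_ne_zero h'
    obtain rfl := ofEarring_injective (h2.symm.trans h2')
    obtain rfl : k = k' := by
      by_contra hk
      rw [bump_of_mem_of_ne h1' (Ne.symm hk)] at h4
      exact lt_irrefl _ h4
    congr 2
    cases b <;> cases b' <;> simp [halfSign] at h3 h3' ⊢ <;> linarith

/-- The function of an edge is injective on the open edge. -/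
theorem eq_of_edgeMap_eq {y y' : graph} {e : (ℕ+ × Fin 3) ⊕ (ℕ+ × Bool)} (h : edgeMap e y ≠ 0)
    (h' : edgeMap e y = edgeMap e y') : y = y' := by
  have h0 : edgeMap e y' ≠ 0 := h' ▸ h
  rcases e with ⟨j, i⟩ | ⟨k, b⟩
  · obtain ⟨z, h1, h2, h3, h4, h5, h6⟩ := axisMap_ne_zero h
    obtain ⟨z', h1', h2', h3', h4', h5', h6'⟩ := axisMap_ne_zero h0
    have h7 := axisParam_injective i (eq_of_coe_eq ⟨h4.le, h5⟩ ⟨h4'.le, h5'⟩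
      (h6.symm.trans (Eq.trans h' h6')))
    obtain rfl : z = z' := Subtype.ext (Complex.ext h7 (h1.trans h1'.symm))
    exact Subtype.ext (h3.trans h3'.symm)
  · obtain ⟨w, h1, h2, h3, h4, h5, h6⟩ := halfMap_ne_zero h
    obtain ⟨w', h1', h2', h3', h4', h5', h6'⟩ := halfMap_ne_zero h0
    have h7 := eq_of_coe_eq ⟨h4.le, h5⟩ ⟨h4'.le, h5'⟩ (h6.symm.trans (Eq.trans h' h6'))
    have hk : (0 : ℝ) < k := by exact_mod_cast k.pos
    rw [bump_of_mem h1, bump_of_mem h1'] at h7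
    have h8 : (w : ℂ).re = (w' : ℂ).re := by
      have : (k : ℝ) * ((w : ℂ).re - (w' : ℂ).re) = 0 := by linarith
      linarith [(mul_eq_zero.1 this).resolve_left hk.ne']
    rw [mem_C_iff] at h1 h1'
    have h9 : (w : ℂ).im ^ 2 = (w' : ℂ).im ^ 2 := by
      rw [h8] at h1
      have := mul_left_cancel₀ hk.ne' (h1.trans h1'.symm)
      linarith
    have h10 : (w : ℂ).im = (w' : ℂ).im := by
      rcases sq_eq_sq_iff_eq_or_eq_neg.1 h9 with h | h
      · exact h
      · rw [h] at h3
        linarith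
    obtain rfl : w = w' := Subtype.ext (Complex.ext h8 h10)
    exact Subtype.ext (h2.trans h2'.symm)

/-- The points where all edge functions vanish are the vertices. -/
theorem vertex_of_edgeMap_eq_zero {y : graph} (h : ∀ e, edgeMap e y = 0) :
    y.1 = basePoint ∨ ∃ k, y.1 = ofEarring (apex k) := by
  rcases graph_cases y with ⟨w, e⟩ | ⟨k, z, hz, hz', e⟩
  · obtain ⟨k, hk⟩ := Set.mem_iUnion.1 w.2
    have hk0 : (0 : ℝ) < k := by exact_mod_cast k.pos
    have him : (w : ℂ).im = 0 := by
      by_contra him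
      obtain ⟨b, hb⟩ : ∃ b, 0 ≤ halfSign b * (w : ℂ).im := by
        rcases le_total 0 (w : ℂ).im with h | h
        · exact ⟨true, by simpa [halfSign] using h⟩
        · exact ⟨false, by simpa [halfSign] using h⟩
      have h1 : halfMap k b y = 0 := h (Sum.inr (k, b))
      rw [halfMap_of_earring e, if_pos hb] at h1
      have h2 := bump_mem k w
      have h3 : bump k w = 0 ∨ bump k w = 1 := by
        rcases h2.2.eq_or_lt with h3 | h3
        · exact Or.inr h3
        · exact Or.inl (eq_of_coe_eq ⟨h2.1, h3⟩ ⟨le_rfl, one_pos⟩ h1)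
      rw [bump_of_mem hk] at h3
      rw [mem_C_iff] at hk
      have h4 : 0 < (k : ℝ) * (w : ℂ).im ^ 2 := by positivity
      rcases h3 with h3 | h3
      · have h5 : (w : ℂ).re = 0 := by
          have : (k : ℝ) * (w : ℂ).re = 0 := by linarith
          exact (mul_eq_zero.1 this).resolve_left hk0.ne'
        rw [h5] at hk
        linarith
      · have h5 : (k : ℝ) * (w : ℂ).re ^ 2 = 2 * (w : ℂ).re := by
          have : (k : ℝ) * (w : ℂ).re = 2 := by linarith
          rw [sq, ← mul_assoc, this]
        linarith
    rw [mem_C_iff, him] at hk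
    have h1 : (w : ℂ).re * (k * (w : ℂ).re - 2) = 0 := by linarith
    rcases mul_eq_zero.1 h1 with h1 | h1
    · left
      rw [e, basePoint]
      exact congrArg ofEarring (Subtype.ext (Complex.ext h1 him))
    · right
      refine ⟨k, e.trans (congrArg ofEarring (Subtype.ext (Complex.ext ?_ ?_)))⟩
      · rw [apex, Complex.ofReal_re]
        field_simp
        linarith
      · rw [apex, Complex.ofReal_im, him]
  · obtain ⟨i, hi⟩ := exists_axisParam_mem z.2 hz' hz
    have h1 : axisMap k i y = 0 := h (Sum.inl (k, i))
    rw [axisMap_of_pants hz' e, if_pos rfl, unitClamp_of_mem hi.1.le hi.2.le] at h1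
    exact absurd (eq_of_coe_eq ⟨hi.1.le, hi.2⟩ ⟨le_rfl, one_pos⟩ h1) hi.1.ne'

theorem axisParam_one (t : ℝ) : axisParam 1 t = (t + 1) / 2 := rfl

theorem axisParam_two (t : ℝ) : axisParam 2 t = t - 3 := rfl

/-- The values on the axis of the `j`-th pair of pants of the hat function of `apex k`, doubled. -/
noncomputable def axisHat (k j : ℕ+) (t : ℝ) : ℝ :=
  -- On the axis of `P_j` the boundary points `-1`, `3` and `4` are attached to the apexes of `C (2
  -- * j)`, `C (2 * j + 1)` and `C j`, all others to the base point. Each summand equals `1` at its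
  -- own point and `0` at the rest; the ramps at `t + 2` and `t - 2` rise inside the removed disks.
  (if 2 * j = k then unitClamp (t + 2) - unitClamp (axisParam 1 t) else 0) +
  (if 2 * j + 1 = k then unitClamp (t - 2) - unitClamp (axisParam 2 t) else 0) +
  (if j = k then unitClamp (axisParam 2 t) else 0)

theorem continuous_axisHat (k j : ℕ+) : Continuous (axisHat k j) := by
  unfold axisHat
  refine (Continuous.add ?_ ?_).add ?_ <;> split_ifs <;> fun_prop

/-- The hat function of the vertex `apex k`. -/
noncomputable def hatMap (k : ℕ+) : C(graph, UnitAddCircle) :=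
  graphMap ⟨fun h => (bump k h / 2 : ℝ), continuous_quotient_mk'.comp
      ((continuous_bump k).div_const 2)⟩
    (fun j => ⟨fun t => (axisHat k j t / 2 : ℝ), continuous_quotient_mk'.comp
      ((continuous_axisHat k j).div_const 2)⟩) <| by
    intro j z hz h
    change ((axisHat k j (z : ℂ).re / 2 : ℝ) : UnitAddCircle) =
      (bump k ⟨attachFun j z, attachFun_mem hz⟩ / 2 : ℝ)
    congr 2
    rcases real_boundary_cases j hz h with ⟨h1, h2⟩ | ⟨h1, h2⟩ | ⟨h1, h2⟩ | ⟨h1, h2⟩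
    · rw [bump_zero k h2]
      rcases h1 with h1 | h1 | h1 <;> rw [h1] <;>
        norm_num [axisHat, axisParam_one, axisParam_two, unitClamp]
    · rw [show (⟨attachFun j z, attachFun_mem hz⟩ : earring) = apex (2 * j) from Subtype.ext h2,
        bump_apex, h1]
      norm_num [axisHat, axisParam_one, axisParam_two, unitClamp]
    · rw [show (⟨attachFun j z, attachFun_mem hz⟩ : earring) = apex (2 * j + 1) from
        Subtype.ext h2, bump_apex, h1]
      norm_num [axisHat, axisParam_one, axisParam_two, unitClamp]
    · rw [show (⟨attachFun j z, attachFun_mem hz⟩ : earring) = apex j from Subtype.ext h2,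
        bump_apex, h1]
      norm_num [axisHat, axisParam_one, axisParam_two, unitClamp]

/-- At most one pair of pants is involved, so a single edge function or `0` will do. This avoids
distinguishing the parity of `k` in the relation for `hatMap k`. -/
theorem exists_mem_span (p : ℕ+ → Prop) [DecidablePred p] (hp : ∀ j j', p j → p j' → j = j')
    (i : Fin 3) :
    ∃ r ∈ Submodule.span ℤ (Set.range edgeMap), (∀ y h, y.1 = ofEarring h → r y = 0) ∧
      ∀ y j, ∀ z : pants, (z : ℂ) ∉ pantsBoundary → y.1 = ofPants j z →
        r y = ((if p j then unitClamp (axisParam i (z : ℂ).re) else 0 : ℝ) : UnitAddCircle) := by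
  by_cases h : ∃ j, p j
  · obtain ⟨j₀, hj₀⟩ := h
    refine ⟨axisMap j₀ i, Submodule.subset_span ⟨Sum.inl (j₀, i), rfl⟩,
      fun y w e => axisMap_of_earring e _ _, fun y j z hz e => ?_⟩
    rw [axisMap_of_pants hz e]
    by_cases hj : p j
    · rw [if_pos hj, if_pos (hp _ _ hj hj₀)]
    · rw [if_neg hj, if_neg]
      · rfl
      · rintro rfl
        exact hj hj₀
  · push Not at h
    refine ⟨0, zero_mem _, fun _ _ _ => rfl, fun y j z _ _ => ?_⟩
    rw [if_neg (h j)]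
    rfl

/-- On the three segments the auxiliary ramps are integers, so they vanish in the circle. -/
theorem coe_axisHat {z : ℂ} (hz : z ∈ pants) (hz' : z ∉ pantsBoundary) (h : z.im = 0) (k j : ℕ+) :
    (axisHat k j z.re : UnitAddCircle) =
      -((if 2 * j = k then unitClamp (axisParam 1 z.re) else 0 : ℝ) : UnitAddCircle) -
      ((if 2 * j + 1 = k then unitClamp (axisParam 2 z.re) else 0 : ℝ) : UnitAddCircle) +
      ((if j = k then unitClamp (axisParam 2 z.re) else 0 : ℝ) : UnitAddCircle) := by
  have h1 : (unitClamp (z.re + 2) : UnitAddCircle) = 0 ∧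
      (unitClamp (z.re - 2) : UnitAddCircle) = 0 := by
    obtain ⟨i, hi⟩ := exists_axisParam_mem hz hz' h
    constructor <;> apply coe_unitClamp <;> fin_cases i <;> simp [axisParam] at hi <;>
      first
      | left; linarith
      | right; linarith
  simp only [axisHat, AddCircle.coe_add]
  split_ifs <;> (simp [h1]; try abel)

/-- The doubled hat function is an integer at every vertex, and along each edge at the apex of `C k`
it runs once between `0` and `1`. Modulo `1` it is therefore a signed sum of the functions of those
edges: the halves of `C k` and the adjacent axis segments. -/
theorem two_smul_hatMap_mem (k : ℕ+) :
    2 • hatMap k ∈ Submodule.span ℤ (Set.range edgeMap) := by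
  obtain ⟨r₁, hr₁, h₁, h₁'⟩ := exists_mem_span (fun j => 2 * j = k)
    (fun j j' h h' => mul_left_cancel (h.trans h'.symm)) 1
  obtain ⟨r₂, hr₂, h₂, h₂'⟩ := exists_mem_span (fun j => 2 * j + 1 = k)
    (fun j j' h h' => mul_left_cancel (add_right_cancel (h.trans h'.symm))) 2
  obtain ⟨r₃, hr₃, h₃, h₃'⟩ := exists_mem_span (fun j => j = k)
    (fun j j' h h' => h.trans h'.symm) 2
  have key : 2 • hatMap k = halfMap k true + halfMap k false + (-r₁ - r₂ + r₃) := by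
    ext y
    simp only [ContinuousMap.smul_apply, ContinuousMap.add_apply, ContinuousMap.sub_apply,
      ContinuousMap.neg_apply]
    have two : ∀ t : ℝ, 2 • ((t / 2 : ℝ) : UnitAddCircle) = t := fun t => by
      rw [← AddCircle.coe_nsmul, two_nsmul, add_halves]
    rcases graph_cases y with ⟨w, e⟩ | ⟨j, z, hz, hz', e⟩
    · rw [h₁ y w e, h₂ y w e, h₃ y w e, hatMap, graphMap_of_earring e, halfMap_of_earring e,
        halfMap_of_earring e]
      refine (two _).trans ?_
      simp only [halfSign, if_true, one_mul, Bool.false_eq_true, if_false, neg_mul, neg_zero,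
        sub_zero, add_zero, Left.nonneg_neg_iff]
      rcases lt_trichotomy (w : ℂ).im 0 with h | h | h
      · rw [if_neg h.not_ge, if_pos h.le, zero_add]
      · rw [coe_bump_of_im_eq_zero k h]
        simp
      · rw [if_pos h.le, if_neg h.not_ge, add_zero]
    · rw [h₁' y j z hz' e, h₂' y j z hz' e, h₃' y j z hz' e, hatMap, graphMap_of_pants hz' e,
        halfMap_of_pants hz' e, halfMap_of_pants hz' e, add_zero, zero_add]
      exact (two _).trans (coe_axisHat z.2 hz' hz k j)
  rw [key]
  have hb : ∀ b, halfMap k b ∈ Submodule.span ℤ (Set.range edgeMap) := fun b =>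
    Submodule.subset_span ⟨Sum.inr (k, b), rfl⟩
  exact add_mem (add_mem (hb _) (hb _)) (add_mem (sub_mem (neg_mem hr₁) hr₂) hr₃)

/-- The edge functions separate all pairs of points except two vertices; these are told apart by the
hat function of an apex, which is `1 / 2` there and `0` at the other vertices. -/
theorem isGraphLike_graph : ∃ c, IsGraphLike graph c := by
  refine ⟨_, isGraphLike_of_encodable edgeMap edgeMap_disjoint fun y y' hne => ?_⟩
  by_cases h : ∃ e, edgeMap e y ≠ edgeMap e y'
  · obtain ⟨e, he⟩ := h
    exact ⟨edgeMap e, 1, one_ne_zero, by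
      rw [one_smul]; exact Submodule.subset_span ⟨e, rfl⟩, he⟩
  push Not at h
  have h0 : ∀ e, edgeMap e y = 0 := fun e => by
    by_contra he
    exact hne (eq_of_edgeMap_eq he (h e))
  have h0' : ∀ e, edgeMap e y' = 0 := fun e => (h e).symm.trans (h0 e)
  have half_ne : ((1 / 2 : ℝ) : UnitAddCircle) ≠ ((0 / 2 : ℝ) : UnitAddCircle) := fun e => by
    have := eq_of_coe_eq (by norm_num) (by norm_num) e
    norm_num at this
  have hhat : ∀ k, ∀ y : graph, ∀ w, y.1 = ofEarring w →
      hatMap k y = ((bump k w / 2 : ℝ) : UnitAddCircle) := fun k y w e => graphMap_of_earring e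
  rcases vertex_of_edgeMap_eq_zero h0 with e | ⟨k, e⟩ <;>
    rcases vertex_of_edgeMap_eq_zero h0' with e' | ⟨k', e'⟩
  · exact absurd (Subtype.ext (e.trans e'.symm)) hne
  · refine ⟨hatMap k', 2, two_ne_zero, two_smul_hatMap_mem k', ?_⟩
    rw [hhat k' y _ e, hhat k' y' _ e', bump_apex, if_pos rfl, bump_zero k' rfl]
    exact half_ne.symm
  · refine ⟨hatMap k, 2, two_ne_zero, two_smul_hatMap_mem k, ?_⟩
    rw [hhat k y _ e, hhat k y' _ e', bump_apex, if_pos rfl, bump_zero k rfl]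
    exact half_ne
  · have hk : k' ≠ k := by
      rintro rfl
      exact hne (Subtype.ext (e.trans e'.symm))
    refine ⟨hatMap k, 2, two_ne_zero, two_smul_hatMap_mem k, ?_⟩
    rw [hhat k y _ e, hhat k y' _ e', bump_apex, if_pos rfl, bump_apex, if_neg hk]
    exact half_ne

theorem isLocallyFree_of_subset_graph {S : Set Space} (hS : S ⊆ graph) (x : S) :
    IsLocallyFree (FundamentalGroup S x) := by
  obtain ⟨c, hc⟩ := isGraphLike_graph
  exact (hc.comp_injective ⟨Set.inclusion hS, continuous_inclusion hS⟩
    (Set.inclusion_injective hS)).isLocallyFree x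

/-- Collapse the remaining pants in order of index; at `n = m` the stage lies in the one-dimensional
part. -/
theorem isLocallyFree_stage {n m : ℕ} (h : n ≤ m) :
    IsLocallyFree (FundamentalGroup (stage n m) ⟨basePoint, basePoint_mem_stage _ _⟩) := by
  induction h using Nat.decreasingInduction with
  | self => exact isLocallyFree_of_subset_graph (stage_subset_graph m) _
  | of_succ n h ih => exact isLocallyFree_stage_of_succ h ih

/-! ### Compactness and the direct limit -/

theorem ofPants_injOn_interior {n k : ℕ+} {z w : pants} (hz : (z : ℂ) ∉ pantsBoundary)
    (e : ofPants n z = ofPants k w) : n = k ∧ z = w :=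
  (ofPants_eq_ofPants e).resolve_right fun h => hz h.1

theorem stage_zero_mono {i j : ℕ} (h : i ≤ j) : stage 0 i ⊆ stage 0 j := by
  intro x hx
  rw [mem_stage_iff] at hx ⊢
  exact hx.imp_right fun ⟨k, hk, hx⟩ => ⟨k, hk.trans h, hx⟩

theorem exists_of_notMem_stage {m : ℕ} {x : Space} (hx : x ∉ stage 0 m) :
    ∃ k : ℕ+, m < k ∧ ∃ z : pants, (z : ℂ) ∉ pantsBoundary ∧ ofPants k z = x := by
  rcases exists_rep x with ⟨h, rfl⟩ | ⟨k, z, hz, rfl⟩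
  · obtain ⟨k, hk⟩ := Set.mem_iUnion.1 h.2
    exact absurd (mem_stage_iff.2 (Or.inl ⟨h, ⟨k, k.pos, hk⟩, rfl⟩)) hx
  · refine ⟨k, not_le.1 fun hk => hx (mem_stage_iff.2 ?_), z, hz, rfl⟩
    exact Or.inr ⟨k, hk, z, Or.inl k.pos, rfl⟩

/-- Compact subsets of the space meet the interiors of finitely many pants only. -/
theorem exists_subset_stage {K : Set Space} (hK : IsCompact K) : ∃ m, K ⊆ stage 0 m := by
  by_contra! hn
  choose x hxK hx using fun m => Set.not_subset.1 (hn m)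
  choose k hk z hz hxz using fun m => exists_of_notMem_stage (hx m)
  -- Points in the interiors of pants of unbounded index meet each pair of pants in a finite set and
  -- the earring not at all. So all tails of the sequence are closed, and their empty intersection
  -- contradicts compactness.
  have hF : ∀ m, IsClosed (x '' Set.Ici m) := by
    refine fun m => isClosed_iff.2 ⟨?_, fun n => Set.Finite.isClosed ?_⟩
    · convert isClosed_empty
      refine Set.eq_empty_of_forall_notMem ?_
      rintro h ⟨j, -, e⟩
      rw [← hxz] at e
      exact hz j (ofPants_eq_ofEarring_iff.1 e).1
    · refine ((Set.finite_Iio (n : ℕ)).image z).subset ?_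
      rintro w ⟨j, -, e⟩
      rw [← hxz] at e
      obtain ⟨h1, h2⟩ := ofPants_injOn_interior (hz j) e
      exact ⟨j, h1 ▸ hk j, h2⟩
  obtain ⟨y, -, hy⟩ := hK.inter_iInter_nonempty (fun m => x '' Set.Ici m) hF fun u =>
    ⟨x (u.sup id), hxK _, Set.mem_iInter₂.2 fun i hi => ⟨_, Finset.le_sup (f := id) hi, rfl⟩⟩
  rw [Set.mem_iInter] at hy
  obtain ⟨i, -, rfl⟩ := hy 0
  obtain ⟨j, hj, e⟩ := hy (k i)
  rw [← hxz, ← hxz] at e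
  obtain ⟨h1, -⟩ := ofPants_injOn_interior (hz j) e
  have h2 := hk j
  rw [h1] at h2
  exact absurd (h2.trans_le hj) (lt_irrefl _)

/-- The inclusion of a stage into a later one. -/
def stageInclusion {i j : ℕ} (h : i ≤ j) : C(stage 0 i, stage 0 j) :=
  ⟨Set.inclusion (stage_zero_mono h), continuous_inclusion _⟩

/-- The base point of a stage. -/
def stageBase (i : ℕ) : stage 0 i := ⟨basePoint, basePoint_mem_stage 0 i⟩

/-- The images of loops and of homotopies are compact, so each lies in some `stage 0 m`; this is
what makes the group the direct limit of the groups of these stages. -/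
theorem isLocallyFree_fundamentalGroup : IsLocallyFree (FundamentalGroup Space basePoint) := by
  refine isLocallyFree_of_directLimit (G := fun i => FundamentalGroup (stage 0 i) (stageBase i))
    (fun i => isLocallyFree_stage (Nat.zero_le i))
    (fun i j hij => FundamentalGroup.map (stageInclusion hij) (stageBase i))
    (fun i => FundamentalGroup.map ⟨Subtype.val, continuous_subtype_val⟩ (stageBase i))
    (fun i j k hij hjk p => ?_) (fun i j hij p => ?_) (fun p => ?_) (fun i p hp => ?_)
  · induction p using Path.Homotopic.Quotient.ind with | mk γ => rfl
  · induction p using Path.Homotopic.Quotient.ind with | mk γ => rfl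
  · induction p using Path.Homotopic.Quotient.ind with | mk γ =>
    obtain ⟨m, hm⟩ := exists_subset_stage (isCompact_range γ.continuous)
    exact ⟨m, Path.Homotopic.Quotient.mk
      { toFun := fun t => ⟨γ t, hm ⟨t, rfl⟩⟩
        continuous_toFun := γ.continuous.subtype_mk _
        source' := Subtype.ext γ.source
        target' := Subtype.ext γ.target }, rfl⟩
  · induction p using Path.Homotopic.Quotient.ind with | mk γ =>
    obtain ⟨F⟩ : (γ.map continuous_subtype_val).Homotopic (Path.refl basePoint) :=
      Path.Homotopic.Quotient.eq.1 hp
    obtain ⟨m, hm⟩ := exists_subset_stage (isCompact_range F.continuous)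
    refine ⟨max i m, le_max_left _ _, Path.Homotopic.Quotient.eq.2
      ⟨{ toFun := fun p => ⟨F p, stage_zero_mono (le_max_right i m) (hm ⟨p, rfl⟩)⟩
         continuous_toFun := F.continuous.subtype_mk _
         map_zero_left := fun t => Subtype.ext (F.map_zero_left t)
         map_one_left := fun t => Subtype.ext (F.map_one_left t)
         prop' := fun t u hu => Subtype.ext (F.prop' t u hu) }⟩⟩

end HawaiianPants

theorem mainTheorem7 :
    HawaiianPants.IsLocallyFree
      (FundamentalGroup HawaiianPants.Space HawaiianPants.basePoint) :=
  HawaiianPants.isLocallyFree_fundamentalGroup
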